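/- **Setting.** Let $\Omega\subset\mathbb R^3$ be a bounded domain tessellated by a conforming unstructured mesh of curvilinear hexahedra $e=X_e([-1,1]^3)$, where the $X_e$ are $C^2$ with positive Jacobian on $[-1,1]^3$ and injective on $(-1,1)^3$, elements have disjoint interiors, and the two sides of an interior face are matched by a symmetry of $[-1,1]^2$, with the two elements on opposite sides. Let $\sigma,\varepsilon,t_{CH},\rho_1,\rho_2,c_0>0$, $\eta_1,\eta_2\in\mathbb R$, $M_0=\varepsilon/(\sigma t_{CH})$, $\rho_0=\max(\rho_1,\rho_2)$, $f_0(c)=\frac{12\sigma}{\varepsilon}c^2(1-c)^2$, $\eta(c)=\eta_1c+\eta_2(1-c)$, let $f_w\in C^1(\mathbb R)$ be a boundary free energy, and let $\rho(c)=\rho_1c+\rho_2(1-c)$, where $c$ may be replaced by $\min(\max(c,0),1)$; $\rho>0$ is assumed along solutions. Every physical boundary face is a free-slip or a no-slip wall. Let $I\subset\mathbb R$ be open. There are no source terms. **(a) Continuous bound.** Let $(c,u,p)$ be a classical solution on $I\times\overline\Omega$ (with $c\in C^4$, $u\in C^2$, $p\in C^3$, $\rho(c)\in C^1$ up to the boundary)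 of $$c_t+\nabla\cdot(cu)=M_0\nabla^2\mu,\qquad \mu=f_0'(c)-\tfrac32\sigma\varepsilon\nabla^2c,$$ $$\sqrt\rho(\sqrt\rho u)_t+\nabla\cdot(\tfrac12\rho uu)+\tfrac12\rho u\cdot\nabla u+c\nabla\mu=-\nabla p+\nabla\cdot(2\eta S),\qquad S=\tfrac12(\nabla u+\nabla u^T),$$ $$-\nabla^2p_t+\rho_0c_0^2\nabla\cdot u=0,$$ with, on $\partial\Omega$, $-\frac32\sigma\varepsilon\,\partial_nc=f_w'(c)$, $\partial_n\mu=0$, $\partial_np_t=0$, and $u=0$ (no-slip) or $u\cdot n=0$, $S n=0$ (free-slip). With $$\mathcal E_2=f_0(c)+\tfrac34\sigma\varepsilon|\nabla c|^2+\tfrac12\rho|u|^2+\frac{|\nabla p|^2}{2\rho_0c_0^2},$$ $\mathcal E_2$ and $M_0|\nabla\mu|^2+2\eta S:S$ are integrable on $\Omega$ and, for all $t\in I$, $$\frac{d}{dt}\Big(\int_\Omega\mathcal E_2\,dx+\int_{\partial\Omega}f_w(c)\,dS\Big)=-\int_\Omega\big(M_0|\nabla\mu|^2+2\eta S:S\big)dx,$$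 and the right-hand side is $\le0$ if $\eta(c)\ge0$ in $\Omega$. **(b) Discrete entropy law.** Consider the semi-discrete nodal discontinuous Galerkin scheme of tensor degree $N$ in each variable on the same mesh: collocation and quadrature $\langle\cdot,\cdot\rangle_{E,N}$, $\int_{\partial e,N}$ at the $N+1$ Gauss-Lobatto points per direction, interpolated mapping $\mathcal X=\mathbb I^NX$, metric terms $\mathcal Ja^i$ in curl form $\mathcal Ja^i_n=-\hat x_i\cdot\nabla_\xi\times\mathbb I^N(\mathcal X_l\nabla_\xi\mathcal X_m)$, $(n,m,l)$ cyclic, and nodal Jacobian $\mathcal J$ of $\mathcal X$, assumed positive at all nodes. Tildes denote contravariant components $\tilde F^i=\mathcal Ja^i\cdot F$, and $\{\cdot\}$, $[\![\cdot]\!]=(\cdot)_R-(\cdot)_L$ averages and jumps at interior faces. State, entropy variables and gradients are $Q=(C,\sqrt\rho U,P)$, $W=(\mu,U,P/(\rho_0c_0^2))$ and $G,G_c,G_p$ (discrete gradients of $W,C,P$). With $K=\rho_0c_0^2$, the inviscid fluxes are $F_e=(CU,\ \tfrac12\rho U_iU+Pe_i,\ 0)$, the non-conservative coefficients $\Phi_m$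 are given by $\Phi_1=(0,Ce_1,Ce_2,Ce_3,0)$, $\Phi_{i+1}=$ ($\tfrac12\rho U$ in the $i$-th momentum row, $Ke_i$ in the last row, zero otherwise), $\Phi_5=0$, and $F_v=(M_0G_\mu,2\eta\mathcal S,0)$ with $\mathcal S$ the symmetric part of the velocity block $G_u$ of $G$. For each element and all polynomial test functions the scheme reads: $$\langle\mathcal JG_g,\varphi\rangle=\int_{\partial e,N}(g^\star-g)\,\varphi\cdot n\,dS+\langle\tilde\varphi,\nabla_\xi g\rangle\quad\text{for }g=C,\ P,\ W_1,\dots,W_5,$$ $$\langle\mathcal J\mu,\varphi\rangle=\langle\mathcal Jf_0'(C),\varphi\rangle-\int_{\partial e,N}\tfrac32\sigma\varepsilon\,\varphi\,G_c^\star\cdot n\,dS+\langle\tfrac32\sigma\varepsilon\tilde G_c,\nabla_\xi\varphi\rangle,$$ $$\langle\mathcal JC_t,\varphi_1\rangle+\sum_i\langle\mathcal J\sqrt\rho(\sqrt\rho U_i)_t,\varphi_{i+1}\rangle-\int_{\partial e,N}\varphi_5G_{p,t}^\star\cdot n\,dS+\langle\tilde G_{p,t},\nabla_\xi\varphi_5\rangle$$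 $$+\int_{\partial e,N}\varphi^T\Big(F_e^\star-F_e+\sum_m(\Phi_mW_m)^\diamondsuit-\Phi_mW_m\Big)\cdot n\,dS+\langle\varphi,\nabla_\xi\cdot\tilde F_e\rangle+\sum_m\langle\varphi,\tilde\Phi_m\cdot\nabla_\xi W_m\rangle=\int_{\partial e,N}\varphi^TF_v^\star\cdot n\,dS-\langle\tilde F_v,\nabla_\xi\varphi\rangle.$$ At interior faces: $W^\star=\{W\}$, $C^\star=\{C\}$, $P^\star=\{P\}$, $G_{p,t}^\star=\{G_{p,t}\}$, $F_v^\star=\{F_v\}+\beta[\![\mu]\!]e_1n_L$, $G_c^\star=\{G_c\}+\beta[\![C]\!]n_L$ (Bassi-Rebay 1 with penalty), $\beta=\kappa_\beta\frac{N(N+1)}2|\mathcal J_f|\{\mathcal J^{-1}\}$, $\kappa_\beta\ge0$. The inviscid fluxes are one of two choices. *Central:* $F_e^\star=\{F_e\}$, $(\Phi_mW_m)^\diamondsuit=\Phi_m\{W_m\}$ with the element's own $\Phi_m$. *Exact Riemann solver*, with $n=n_L$, $a=\sqrt{U_n^2+4K/\rho}$, $\lambda^\pm=(U_n\pm a)/2$: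 $$U_n^\star=\frac{P_L-P_R+\rho_LU_{nL}\lambda_L^+-\rho_RU_{nR}\lambda_R^-}{\rho_L\lambda_L^+-\rho_R\lambda_R^-},\qquad P^\star=P_L+\rho_L\lambda_L^+(U_{nL}-U_n^\star),$$ $\rho^\star=\frac{\rho_L\lambda_L^+}{U_n^\star-\lambda_L^-}$ and tangential velocity $V_t^\star=V_{tL}$ if $U_n^\star\ge0$, $\rho^\star=\frac{\rho_R\lambda_R^-}{U_n^\star-\lambda_R^+}$ and $V_t^\star=V_{tR}$ otherwise, $U^\star=U_n^\star n+V_t^\star$, $F_e^\star\cdot n=(\{CU_n\},\ \tfrac12\rho^\star U_n^\star U^\star+P^\star n,\ 0)$, and $\sum_m(\Phi_mW_m)^\diamondsuit\cdot n=(0,\ \tfrac12\rho^\star U_n^\star U^\star+\tfrac12\rho U_nU-\tfrac12\rho^\star U_n^\star U+C\{\mu\}n,\ KU_n^\star)$ with unstarred quantities from the element itself. At walls: the chosen inviscid fluxes are evaluated with the mirrored state (normal velocity reversed), $C^\star=C$, $P^\star=P$, $G_{p,t}^\star\cdot n=0$, $\frac32\sigma\varepsilon G_c^\star\cdot n=-f_w'(C)$,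 and $W^\star=W$, $F_v^\star\cdot n=0$ (free-slip) or $W^\star=(\mu,0,0,0,P/K)$, $F_v^\star\cdot n=(0,2\eta\mathcal S,0)\cdot n$ (no-slip). For any solution of this scheme on $I$ with $C,\sqrt\rho U,P$ differentiable in time, put $$\bar{\mathcal E}_2^\beta=\sum_e\Big\langle\mathcal J\Big(f_0(C)+\tfrac34\sigma\varepsilon|G_c|^2+\tfrac12\rho|U|^2+\tfrac{|G_p|^2}{2\rho_0c_0^2}\Big),1\Big\rangle_{E,N}+\tfrac34\sigma\varepsilon\sum_{\text{interior faces}}\int_{f,N}\beta[\![C]\!]^2dS.$$ Then for all $t\in I$ the following derivative exists and $$\frac{d}{dt}\Big(\bar{\mathcal E}_2^\beta+\sum_{\text{boundary faces}}\int_{f,N}f_w(C)\,dS\Big)\le-\sum_e\big\langle\mathcal J(M_0|G_\mu|^2+2\eta\,\mathcal S:\mathcal S),1\big\rangle_{E,N},$$ with equality for central fluxes and $\kappa_\beta=0$, and the right-hand side is $\le0$ if $\eta(C)\ge0$ at all nodes. -/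

import Mathlib

open Set MeasureTheory
open scoped Matrix

noncomputable section

namespace INSCH

/-! ## Vectors and differential operators on `ℝ³` -/

/-- Vectors of `ℝ³`; inner products are written `v ⬝ᵥ w` and the Euclidean length `vlen`. -/
abbrev Vec : Type := Fin 3 → ℝ

/-- Euclidean length. -/
def vlen (v : Vec) : ℝ := Real.sqrt (v ⬝ᵥ v)

/-- The `i`-th Cartesian unit vector. -/
def unitVec (i : Fin 3) : Vec := Pi.single i 1

/-- Partial derivative `∂f/∂x_i`. -/
def pd (i : Fin 3) (f : Vec → ℝ) (x : Vec) : ℝ := fderiv ℝ f x (unitVec i)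

def grad (f : Vec → ℝ) (x : Vec) : Vec := fun i => pd i f x

def lap (f : Vec → ℝ) (x : Vec) : ℝ := ∑ i, pd i (pd i f) x

def divg (F : Vec → Vec) (x : Vec) : ℝ := ∑ i, pd i (fun y => F y i) x

/-! ## Model parameters and constitutive laws -/

/-- Parameters of the two-phase model. The boundary free energy `fw` is a general `C¹` function.
`cutoff` says whether the density law uses the concentration cut off to `[0,1]`. -/
structure Params where
  /-- interface tension -/
  σ : ℝ
  /-- interface width -/
  ε : ℝ
  /-- chemical characteristic time -/
  tCH : ℝ
  ρ₁ : ℝ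
  ρ₂ : ℝ
  η₁ : ℝ
  η₂ : ℝ
  /-- artificial speed of sound -/
  c₀ : ℝ
  /-- boundary free energy -/
  fw : ℝ → ℝ
  cutoff : Bool
  σ_pos : 0 < σ
  ε_pos : 0 < ε
  tCH_pos : 0 < tCH
  ρ₁_pos : 0 < ρ₁
  ρ₂_pos : 0 < ρ₂
  c₀_pos : 0 < c₀
  fw_smooth : ContDiff ℝ 1 fw

namespace Params

variable (pr : Params)

/-- Mobility. -/
def M₀ : ℝ := pr.ε / (pr.σ * pr.tCH)

/-- `ρ₀ c₀²` with `ρ₀ = max (ρ₁, ρ₂)`. -/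
def K : ℝ := max pr.ρ₁ pr.ρ₂ * pr.c₀ ^ 2

/-- Chemical free energy. -/
def f0 (c : ℝ) : ℝ := 12 * pr.σ / pr.ε * c ^ 2 * (1 - c) ^ 2

/-- The coefficient `(3/2) σ ε`. -/
def s32 : ℝ := 3 / 2 * pr.σ * pr.ε

/-- The coefficient `(3/4) σ ε`. -/
def s34 : ℝ := 3 / 4 * pr.σ * pr.ε

/-- Density law `ρ₁ c + ρ₂ (1 - c)`, with `c` replaced by `min (max c 0) 1` under cutoff. -/
def rho (c : ℝ) : ℝ :=
  let cc := if pr.cutoff then min (max c 0) 1 else c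
  pr.ρ₁ * cc + pr.ρ₂ * (1 - cc)

/-- Viscosity law. -/
def visc (c : ℝ) : ℝ := pr.η₁ * c + pr.η₂ * (1 - c)

end Params

/-- Symmetric part of a velocity gradient, `A i j` standing for `∂u_i/∂x_j`. -/
def strain (A : Fin 3 → Vec) (i j : Fin 3) : ℝ := (A i j + A j i) / 2

/-- `S : S` for the symmetric part `S` of `A`. -/
def strainSq (A : Fin 3 → Vec) : ℝ := ∑ i, ∑ j, strain A i j ^ 2

/-- The two types of physical walls. -/
inductive WallKind
  | freeSlip
  | noSlip

/-! ## Curvilinear hexahedral meshes -/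

/-- Reference element `[-1,1]³`. -/
def cube : Set Vec := Icc (fun _ => -1) (fun _ => 1)

/-- Interior of the reference element. -/
def openCube : Set Vec := {ξ | ∀ i, ξ i ∈ Ioo (-1 : ℝ) 1}

/-- Reference square `[-1,1]²`. -/
def square : Set (Fin 2 → ℝ) := Icc (fun _ => -1) (fun _ => 1)

/-- A face of the reference element: `(i, true)` is `ξ^i = 1`, `(i, false)` is `ξ^i = -1`. -/
abbrev RefFace : Type := Fin 3 × Bool

def RefFace.sign (a : RefFace) : ℝ := if a.2 then 1 else -1

/-- The point of a reference face with the given tangential coordinates (in increasing order). -/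
def facePt (a : RefFace) (y : Fin 2 → ℝ) : Vec := a.1.insertNth (RefFace.sign a) y

/-- Covariant basis vector `a_i = ∂X/∂ξ^i`. -/
def covBasis (X : Vec → Vec) (ξ : Vec) (i : Fin 3) : Vec := fderiv ℝ X ξ (unitVec i)

/-- Jacobian `J = a₁ · (a₂ × a₃)`. -/
def jac (X : Vec → Vec) (ξ : Vec) : ℝ :=
  covBasis X ξ 0 ⬝ᵥ (crossProduct (covBasis X ξ 1) (covBasis X ξ 2))

/-- Volume-weighted contravariant basis vector `J a^i = a_j × a_k`, `(i,j,k)` cyclic. -/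
def contra (X : Vec → Vec) (ξ : Vec) (i : Fin 3) : Vec :=
  crossProduct (covBasis X ξ (i + 1)) (covBasis X ξ (i + 2))

/-- A symmetry of the square, describing how the tangential coordinates of the two sides of an
interior face are related: the `k`-th new coordinate is plus or minus the `perm k`-th old one. -/
structure FaceOrient where
  perm : Equiv.Perm (Fin 2)
  flip : Fin 2 → Bool

namespace FaceOrient

variable (o : FaceOrient)

/-- Action on points of the square. -/
def pt (y : Fin 2 → ℝ) : Fin 2 → ℝ := fun k => if o.flip k then -y (o.perm k) else y (o.perm k)

/-- Action on tensor-product node indices. -/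
def node {N : ℕ} (s : Fin 2 → Fin (N + 1)) : Fin 2 → Fin (N + 1) :=
  fun k => if o.flip k then Fin.rev (s (o.perm k)) else s (o.perm k)

/-- Inverse action on tensor-product node indices. -/
def nodeInv {N : ℕ} (s : Fin 2 → Fin (N + 1)) : Fin 2 → Fin (N + 1) :=
  fun k => if o.flip (o.perm.symm k) then Fin.rev (s (o.perm.symm k)) else s (o.perm.symm k)

/-- Determinant of the symmetry of the square. -/
def det : ℝ := ((Equiv.Perm.sign o.perm : ℤ) : ℝ) * ∏ k, (if o.flip k then (-1 : ℝ) else 1)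

end FaceOrient

/-- Sign of the frame (outward reference normal, first tangential, second tangential coordinate)
of a reference face. -/
def RefFace.frameSign (a : RefFace) : ℝ := RefFace.sign a * (-1) ^ (a.1 : ℕ)

/-- A conforming unstructured mesh of curvilinear hexahedra. Each of the six faces of each element
is exactly one of: the left side of an interior face, the right side of an interior face, a
physical boundary face. -/
structure HexMesh where
  /-- number of elements -/
  nE : ℕ
  /-- number of interior faces -/
  nI : ℕ
  /-- number of physical boundary faces -/
  nB : ℕ
  /-- the mapping from the reference element to each element -/
  X : Fin nE → Vec → Vec
  smooth : ∀ e, ContDiff ℝ 2 (X e)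
  jac_pos : ∀ e, ∀ ξ ∈ cube, 0 < jac (X e) ξ
  inj : ∀ e, InjOn (X e) openCube
  nonoverlap : ∀ e e', e ≠ e' → Disjoint (X e '' openCube) (X e' '' openCube)
  faces : (Fin nI ⊕ Fin nI) ⊕ Fin nB ≃ Fin nE × RefFace
  orient : Fin nI → FaceOrient
  /-- the two sides of an interior face are the same surface -/
  conform : ∀ f, ∀ y ∈ square,
    X (faces (.inl (.inl f))).1 (facePt (faces (.inl (.inl f))).2 y) =
      X (faces (.inl (.inr f))).1 (facePt (faces (.inl (.inr f))).2 ((orient f).pt y))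
  /-- the two elements lie on opposite sides of the face -/
  opposite : ∀ f, RefFace.frameSign (faces (.inl (.inl f))).2 * (orient f).det =
    -RefFace.frameSign (faces (.inl (.inr f))).2

namespace HexMesh

variable (M : HexMesh)

/-- Left side of an interior face. -/
def left (f : Fin M.nI) : Fin M.nE × RefFace := M.faces (.inl (.inl f))

/-- Right side of an interior face. -/
def right (f : Fin M.nI) : Fin M.nE × RefFace := M.faces (.inl (.inr f))

/-- Element face underlying a physical boundary face. -/
def bdry (b : Fin M.nB) : Fin M.nE × RefFace := M.faces (.inr b)

/-- The closed physical domain. -/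
def closedDomain : Set Vec := ⋃ e, M.X e '' cube

/-- The physical domain. -/
def domain : Set Vec := interior M.closedDomain

/-- Point of a physical boundary face. -/
def bdryPt (b : Fin M.nB) (y : Fin 2 → ℝ) : Vec := M.X (M.bdry b).1 (facePt (M.bdry b).2 y)

/-- Outward normal `± J a^i` of a physical boundary face; its length is the surface Jacobian. -/
def bdryAreaVec (b : Fin M.nB) (y : Fin 2 → ℝ) : Vec :=
  RefFace.sign (M.bdry b).2 •
    contra (M.X (M.bdry b).1) (facePt (M.bdry b).2 y) (M.bdry b).2.1

/-- Outward unit normal of a physical boundary face. -/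
def bdryNormal (b : Fin M.nB) (y : Fin 2 → ℝ) : Vec :=
  (vlen (M.bdryAreaVec b y))⁻¹ • M.bdryAreaVec b y

/-- Surface integral over the boundary of the domain, `dS = |J a^i| dξ^j dξ^k`. -/
def bdryIntegral (g : Vec → ℝ) : ℝ :=
  ∑ b, ∫ y in square, g (M.bdryPt b y) * vlen (M.bdryAreaVec b y)

end HexMesh

/-! ## The continuous problem -/

section Continuous

variable (pr : Params)

/-- Chemical potential. -/
def chemPot (c : Vec → ℝ) (x : Vec) : ℝ := deriv pr.f0 (c x) - pr.s32 * lap c x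

/-- Velocity gradient, `velGrad u x i j = ∂u_i/∂x_j`. -/
def velGrad (u : Vec → Vec) (x : Vec) : Fin 3 → Vec := fun i => grad (fun y => u y i) x

/-- The entropy density `ℰ₂`, with `|∇p|²/(2ρ₀c₀²)` as its pressure part. -/
def entropy2 (c : Vec → ℝ) (u : Vec → Vec) (p : Vec → ℝ) (x : Vec) : ℝ :=
  pr.f0 (c x) + pr.s34 * (grad c x ⬝ᵥ grad c x) + 1 / 2 * pr.rho (c x) * (u x ⬝ᵥ u x)
    + (grad p x ⬝ᵥ grad p x) / (2 * pr.K)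

/-- The dissipation density `M₀|∇μ|² + 2η S:S`. -/
def dissipation (c : Vec → ℝ) (u : Vec → Vec) (x : Vec) : ℝ :=
  pr.M₀ * (grad (chemPot pr c) x ⬝ᵥ grad (chemPot pr c) x)
    + 2 * pr.visc (c x) * strainSq (velGrad u x)

/-- Classical solutions, on the time set `I` and the domain of `M`, of the incompressible
Navier-Stokes/Cahn-Hilliard system with the artificial compressibility equation
`-∇²p_t + ρ₀c₀² ∇·u = 0`, wall boundary conditions, and `∇p_t · n = 0` on the boundary. -/
structure IsClassicalSolution (M : HexMesh) (wall : Fin M.nB → WallKind) (I : Set ℝ)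
    (c : ℝ → Vec → ℝ) (u : ℝ → Vec → Vec) (p : ℝ → Vec → ℝ) : Prop where
  /-- the derivatives in the equations are continuous up to the boundary -/
  regular : ∃ W : Set (ℝ × Vec), IsOpen W ∧ I ×ˢ M.closedDomain ⊆ W ∧
    ContDiffOn ℝ 4 (fun z : ℝ × Vec => c z.1 z.2) W ∧
    ContDiffOn ℝ 2 (fun z : ℝ × Vec => u z.1 z.2) W ∧
    ContDiffOn ℝ 3 (fun z : ℝ × Vec => p z.1 z.2) W ∧
    ∃ r : ℝ × Vec → ℝ, ContDiffOn ℝ 1 r W ∧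
      ∀ t ∈ I, ∀ x ∈ M.closedDomain, r (t, x) = pr.rho (c t x)
  rho_pos : ∀ t ∈ I, ∀ x ∈ M.closedDomain, 0 < pr.rho (c t x)
  /-- Cahn-Hilliard equation -/
  cahnHilliard : ∀ t ∈ I, ∀ x ∈ M.domain,
    deriv (fun s => c s x) t + divg (fun y => c t y • u t y) x
      = pr.M₀ * lap (chemPot pr (c t)) x
  /-- skew-symmetric momentum equation -/
  momentum : ∀ t ∈ I, ∀ x ∈ M.domain, ∀ i : Fin 3,
    Real.sqrt (pr.rho (c t x)) * deriv (fun s => Real.sqrt (pr.rho (c s x)) * u s x i) t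
      + divg (fun y => (1 / 2 * pr.rho (c t y) * u t y i) • u t y) x
      + 1 / 2 * pr.rho (c t x) * (u t x ⬝ᵥ grad (fun y => u t y i) x)
      + c t x * pd i (chemPot pr (c t)) x
      = -pd i (p t) x
        + divg (fun y j => 2 * pr.visc (c t y) * strain (velGrad (u t) y) i j) x
  /-- artificial compressibility with the pressure Laplacian -/
  compressibility : ∀ t ∈ I, ∀ x ∈ M.domain,
    -lap (fun y => deriv (fun s => p s y) t) x + pr.K * divg (u t) x = 0
  bc_c : ∀ t ∈ I, ∀ b, ∀ y ∈ square,
    -pr.s32 * (grad (c t) (M.bdryPt b y) ⬝ᵥ M.bdryNormal b y)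
      = deriv pr.fw (c t (M.bdryPt b y))
  bc_mu : ∀ t ∈ I, ∀ b, ∀ y ∈ square,
    grad (chemPot pr (c t)) (M.bdryPt b y) ⬝ᵥ M.bdryNormal b y = 0
  bc_u : ∀ t ∈ I, ∀ b, ∀ y ∈ square,
    match wall b with
    | .noSlip => u t (M.bdryPt b y) = 0
    | .freeSlip => u t (M.bdryPt b y) ⬝ᵥ M.bdryNormal b y = 0 ∧
        ∀ i, strain (velGrad (u t) (M.bdryPt b y)) i ⬝ᵥ M.bdryNormal b y = 0
  bc_p : ∀ t ∈ I, ∀ b, ∀ y ∈ square,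
    grad (fun x => deriv (fun s => p s x) t) (M.bdryPt b y) ⬝ᵥ M.bdryNormal b y = 0

end Continuous

/-! ## Gauss-Lobatto collocation -/

/-- Tensor-product node indices in an element and on a face. -/
abbrev Node (N : ℕ) : Type := Fin 3 → Fin (N + 1)

abbrev FaceNode (N : ℕ) : Type := Fin 2 → Fin (N + 1)

/-- The Gauss-Lobatto quadrature with `N + 1` nodes: both end points are nodes, and the rule is
exact on polynomials of degree at most `2N - 1`. -/
structure GaussLobatto (N : ℕ) where
  ξ : Fin (N + 1) → ℝ
  w : Fin (N + 1) → ℝ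
  mono : StrictMono ξ
  first : ξ 0 = -1
  last : ξ (Fin.last N) = 1
  exact : ∀ p : Polynomial ℝ, p.degree < (2 * N : ℕ) →
    ∫ x in (-1 : ℝ)..1, p.eval x = ∑ i, w i * p.eval (ξ i)

namespace GaussLobatto

variable {N : ℕ} (gl : GaussLobatto N)

/-- Derivative matrix `D_ij = l_j'(ξ_i)` of the Lagrange polynomials. -/
def D (i j : Fin (N + 1)) : ℝ :=
  (Polynomial.derivative (Lagrange.basis Finset.univ gl.ξ j)).eval (gl.ξ i)

/-- Nodal values of `∂/∂ξ^d` of the polynomial with the nodal values `g`. -/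
def dXi (d : Fin 3) (g : Node N → ℝ) (n : Node N) : ℝ :=
  ∑ m, gl.D (n d) m * g (Function.update n d m)

/-- Quadrature over the reference element. -/
def vol (g : Node N → ℝ) : ℝ := ∑ n, (∏ d, gl.w (n d)) * g n

/-- Quadrature over a reference face. -/
def face (g : FaceNode N → ℝ) : ℝ := ∑ s, (∏ k, gl.w (s k)) * g s

end GaussLobatto

/-- The element node which is the given node of the given face. -/
def faceNode {N : ℕ} (a : RefFace) (s : FaceNode N) : Node N :=
  a.1.insertNth (if a.2 then Fin.last N else 0) s

/-! ## Discrete geometry -/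

namespace HexMesh

variable (M : HexMesh) {N : ℕ} (gl : GaussLobatto N)

/-- Nodal values of the interpolated mapping. -/
def nodalX (e : Fin M.nE) (n : Node N) : Vec := M.X e (fun d => gl.ξ (n d))

/-- Covariant basis of the interpolated mapping at the nodes. -/
def dCov (e : Fin M.nE) (n : Node N) (d : Fin 3) : Vec :=
  fun k => gl.dXi d (fun n' => M.nodalX gl e n' k) n

/-- Nodal Jacobian. -/
def dJac (e : Fin M.nE) (n : Node N) : ℝ :=
  M.dCov gl e n 0 ⬝ᵥ (crossProduct (M.dCov gl e n 1) (M.dCov gl e n 2))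

/-- Nodal values of the vector field `𝕀ᴺ(𝒳_l ∇_ξ 𝒳_m)`, where `(n,m,l) = (k, k+1, k+2)`. -/
def curlArg (e : Fin M.nE) (k d : Fin 3) (n : Node N) : ℝ :=
  M.nodalX gl e n (k + 2) * M.dCov gl e n d (k + 1)

/-- Discrete contravariant basis `𝒥a^i` in curl form:
its `k`-th component is minus the `i`-th component of `∇_ξ × 𝕀ᴺ(𝒳_{k+2} ∇_ξ 𝒳_{k+1})`. -/
def dContra (e : Fin M.nE) (n : Node N) (i : Fin 3) : Vec :=
  fun k => -(gl.dXi (i + 1) (M.curlArg gl e k (i + 2)) n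
    - gl.dXi (i + 2) (M.curlArg gl e k (i + 1)) n)

/-- Outward vector `± 𝒥a^i` at a node of an element face. -/
def areaVec (a : Fin M.nE × RefFace) (s : FaceNode N) : Vec :=
  RefFace.sign a.2 • M.dContra gl a.1 (faceNode a.2 s) a.2.1

/-- Face Jacobian `𝒥_f = |𝒥a^i|`. -/
def faceJac (a : Fin M.nE × RefFace) (s : FaceNode N) : ℝ := vlen (M.areaVec gl a s)

/-- Outward unit normal at a node of an element face. -/
def normal (a : Fin M.nE × RefFace) (s : FaceNode N) : Vec :=
  (M.faceJac gl a s)⁻¹ • M.areaVec gl a s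

/-- Quadrature `∫_{∂e,N} g dS` over the six faces of an element. -/
def surf (e : Fin M.nE) (g : RefFace → FaceNode N → ℝ) : ℝ :=
  ∑ a, gl.face (fun s => M.faceJac gl (e, a) s * g a s)

/-- Case distinction at node `s` of an element face. On an interior face `f` the value is
`inner sgn f s'`, where `s'` is the node as numbered on the left side, and `sgn` is `1` seen from
the left element and `-1` seen from the right element (whose outward normal is `-n_L`). -/
def onFace {α : Type} (a : Fin M.nE × RefFace) (s : FaceNode N)
    (inner : ℝ → Fin M.nI → FaceNode N → α) (bd : Fin M.nB → α) : α :=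
  match M.faces.symm a with
  | .inl (.inl f) => inner 1 f s
  | .inl (.inr f) => inner (-1) f ((M.orient f).nodeInv s)
  | .inr b => bd b

variable {M}

/-- Trace of a nodal field from the left element of an interior face. -/
def trL {α : Type} (g : Fin M.nE → Node N → α) (f : Fin M.nI) (s : FaceNode N) : α :=
  g (M.left f).1 (faceNode (M.left f).2 s)

/-- Trace of a nodal field from the right element, at the node which is `s` on the left. -/
def trR {α : Type} (g : Fin M.nE → Node N → α) (f : Fin M.nI) (s : FaceNode N) : α :=
  g (M.right f).1 (faceNode (M.right f).2 ((M.orient f).node s))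

/-- Trace from the element itself. -/
def trOwn {α : Type} (g : Fin M.nE → Node N → α) (a : Fin M.nE × RefFace) (s : FaceNode N) : α :=
  g a.1 (faceNode a.2 s)

/-- The jump `g_R - g_L`. -/
def jump (g : Fin M.nE → Node N → ℝ) (f : Fin M.nI) (s : FaceNode N) : ℝ := trR g f s - trL g f s

/-- The average of a scalar field. -/
def aver (g : Fin M.nE → Node N → ℝ) (f : Fin M.nI) (s : FaceNode N) : ℝ :=
  (trL g f s + trR g f s) / 2

/-- The average of a vector field, in the direction of the left outward normal. -/
def averN (g : Fin M.nE → Node N → Vec) (f : Fin M.nI) (s : FaceNode N) : ℝ :=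
  ((2⁻¹ : ℝ) • (trL g f s + trR g f s)) ⬝ᵥ M.normal gl (M.left f) s

/-- Interface value which is the average at interior faces and the own value at walls. -/
def starAver (g : Fin M.nE → Node N → ℝ) (a : Fin M.nE × RefFace) (s : FaceNode N) : ℝ :=
  M.onFace a s (fun _ f s' => aver g f s') (fun _ => trOwn g a s)

variable (M)

/-- `G` is the DG gradient of `g` in element `e`, with the interface values `gs`. -/
def IsDGGradient (e : Fin M.nE) (g : Node N → ℝ) (gs : RefFace → FaceNode N → ℝ)
    (G : Node N → Vec) : Prop :=
  ∀ φ : Node N → Vec,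
    gl.vol (fun n => M.dJac gl e n * (G n ⬝ᵥ φ n)) =
      M.surf gl e (fun a s => (gs a s - g (faceNode a s)) *
        (φ (faceNode a s) ⬝ᵥ M.normal gl (e, a) s))
      + gl.vol (fun n => ∑ d, (M.dContra gl e n d ⬝ᵥ φ n) * gl.dXi d g n)

/-- Penalty parameter `β = κ_β N(N+1)/2 |𝒥_f| {𝒥⁻¹}` on an interior face. -/
def penalty (κ : ℝ) (f : Fin M.nI) (s : FaceNode N) : ℝ :=
  κ * ((N : ℝ) * (N + 1) / 2) * M.faceJac gl (M.left f) s *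
    aver (fun e n => (M.dJac gl e n)⁻¹) f s

end HexMesh

/-! ## Pointwise fluxes -/

/-- Point values of concentration, velocity, pressure and chemical potential. -/
structure PtState where
  C : ℝ
  U : Vec
  P : ℝ
  μ : ℝ

/-- The mirrored ghost state at a wall. -/
def PtState.ghost (q : PtState) (n : Vec) : PtState :=
  { q with U := q.U - (2 * (q.U ⬝ᵥ n)) • n }

/-- Position of the `i`-th momentum component in a state vector `(c, √ρ u, p)`. -/
def momIdx (i : Fin 3) : Fin 5 := i.succ.castSucc

/-- The two options for the inviscid fluxes. -/
inductive InviscidFlux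
  | central
  | ers

namespace Params

variable (pr : Params)

/-- Entropy variables `(μ, u, p/(ρ₀c₀²))`. -/
def W (q : PtState) : Fin 5 → ℝ := ![q.μ, q.U 0, q.U 1, q.U 2, q.P / pr.K]

/-- Inviscid fluxes; `fe q k` is the flux vector of the `k`-th state component. -/
def fe (q : PtState) : Fin 5 → Vec :=
  ![q.C • q.U,
    (1 / 2 * pr.rho q.C * q.U 0) • q.U + q.P • unitVec 0,
    (1 / 2 * pr.rho q.C * q.U 1) • q.U + q.P • unitVec 1,
    (1 / 2 * pr.rho q.C * q.U 2) • q.U + q.P • unitVec 2,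
    0]

/-- Coefficients of the non-conservative terms; `phi q m k` is the `k`-th row of `φ_m`. -/
def phi (q : PtState) : Fin 5 → Fin 5 → Vec :=
  ![![0, q.C • unitVec 0, q.C • unitVec 1, q.C • unitVec 2, 0],
    ![0, (1 / 2 * pr.rho q.C) • q.U, 0, 0, pr.K • unitVec 0],
    ![0, 0, (1 / 2 * pr.rho q.C) • q.U, 0, pr.K • unitVec 1],
    ![0, 0, 0, (1 / 2 * pr.rho q.C) • q.U, pr.K • unitVec 2],
    ![0, 0, 0, 0, 0]]

/-- Viscous fluxes at concentration `C` and gradients `G` of the entropy variables. -/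
def fv (C : ℝ) (G : Fin 5 → Vec) : Fin 5 → Vec :=
  let S := strain (fun i => G (momIdx i))
  ![pr.M₀ • G 0,
    (2 * pr.visc C) • S 0,
    (2 * pr.visc C) • S 1,
    (2 * pr.visc C) • S 2,
    0]

/-! Exact Riemann solver: `L`, `R` are the states on both sides and `n` the left unit normal. -/

/-- `a = √(U_n² + 4ρ₀c₀²/ρ)`. -/
def wave (q : PtState) (n : Vec) : ℝ := Real.sqrt ((q.U ⬝ᵥ n) ^ 2 + 4 * pr.K / pr.rho q.C)

def lamP (q : PtState) (n : Vec) : ℝ := (q.U ⬝ᵥ n + pr.wave q n) / 2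

def lamM (q : PtState) (n : Vec) : ℝ := (q.U ⬝ᵥ n - pr.wave q n) / 2

/-- Star velocity `U_n^⋆`. -/
def starU (L R : PtState) (n : Vec) : ℝ :=
  (L.P - R.P + pr.rho L.C * (L.U ⬝ᵥ n) * pr.lamP L n - pr.rho R.C * (R.U ⬝ᵥ n) * pr.lamM R n) /
    (pr.rho L.C * pr.lamP L n - pr.rho R.C * pr.lamM R n)

/-- Star pressure `P^⋆`. -/
def starP (L R : PtState) (n : Vec) : ℝ :=
  L.P + pr.rho L.C * pr.lamP L n * (L.U ⬝ᵥ n - pr.starU L R n)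

open Classical in
/-- Star density `ρ^⋆`. -/
def starRho (L R : PtState) (n : Vec) : ℝ :=
  if 0 ≤ pr.starU L R n then pr.rho L.C * pr.lamP L n / (pr.starU L R n - pr.lamM L n)
  else pr.rho R.C * pr.lamM R n / (pr.starU L R n - pr.lamP R n)

open Classical in
/-- Star velocity vector: normal part `U_n^⋆`, tangential part upwinded. -/
def starVel (L R : PtState) (n : Vec) : Vec :=
  pr.starU L R n • n +
    (if 0 ≤ pr.starU L R n then L.U - (L.U ⬝ᵥ n) • n else R.U - (R.U ⬝ᵥ n) • n)

/-- Inviscid numerical flux `F_e^⋆ · n`. -/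
def numFlux (k : InviscidFlux) (L R : PtState) (n : Vec) : Fin 5 → ℝ :=
  match k with
  | .central => fun j => (pr.fe L j ⬝ᵥ n + pr.fe R j ⬝ᵥ n) / 2
  | .ers =>
    let m : Vec := (1 / 2 * pr.starRho L R n * pr.starU L R n) • pr.starVel L R n
      + pr.starP L R n • n
    ![(L.C * (L.U ⬝ᵥ n) + R.C * (R.U ⬝ᵥ n)) / 2, m 0, m 1, m 2, 0]

/-- Non-conservative terms `∑ₘ φ_m W_m · n` of one state. -/
def ncFlux (q : PtState) (n : Vec) : Fin 5 → ℝ :=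
  fun j => ∑ m, (pr.phi q m j ⬝ᵥ n) * pr.W q m

/-- Diamond flux `∑ₘ (φ_m W_m)^◇ · n`, where `own` is the state of the element it is used in. -/
def diamondFlux (k : InviscidFlux) (own L R : PtState) (n : Vec) : Fin 5 → ℝ :=
  match k with
  | .central => fun j => ∑ m, (pr.phi own m j ⬝ᵥ n) * ((pr.W L m + pr.W R m) / 2)
  | .ers =>
    let m : Vec := (1 / 2 * pr.starRho L R n * pr.starU L R n) • pr.starVel L R n
      + (1 / 2 * pr.rho own.C * (own.U ⬝ᵥ n)) • own.U
      - (1 / 2 * pr.starRho L R n * pr.starU L R n) • own.U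
      + (own.C * ((L.μ + R.μ) / 2)) • n
    ![0, m 0, m 1, m 2, pr.K * pr.starU L R n]

end Params

/-! ## The semi-discrete scheme -/

/-- The nodal unknowns: state `(C, √ρU, P)`, chemical potential, and the discrete gradients
of the entropy variables, of the concentration and of the pressure. -/
structure DGFields (M : HexMesh) (N : ℕ) where
  C : Fin M.nE → Node N → ℝ
  /-- `√ρ U` -/
  Q : Fin M.nE → Node N → Vec
  P : Fin M.nE → Node N → ℝ
  μ : Fin M.nE → Node N → ℝ
  /-- gradient of the entropy variables -/
  G : Fin M.nE → Node N → Fin 5 → Vec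
  /-- gradient of the concentration -/
  Gc : Fin M.nE → Node N → Vec
  /-- gradient of the pressure -/
  Gp : Fin M.nE → Node N → Vec

section Scheme

variable (pr : Params) (M : HexMesh) {N : ℕ} (gl : GaussLobatto N)

namespace DGFields

variable {M} (Y : DGFields M N)

/-- Point values, with `U = √ρU / √ρ`. -/
def state (e : Fin M.nE) (n : Node N) : PtState :=
  { C := Y.C e n, U := (Real.sqrt (pr.rho (Y.C e n)))⁻¹ • Y.Q e n, P := Y.P e n, μ := Y.μ e n }

/-- Nodal values of the `k`-th entropy variable. -/
def Wn (k : Fin 5) (e : Fin M.nE) (n : Node N) : ℝ := pr.W (Y.state pr e n) k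

/-- Nodal values of the viscous flux of the `k`-th component. -/
def Fv (k : Fin 5) (e : Fin M.nE) (n : Node N) : Vec := pr.fv (Y.C e n) (Y.G e n) k

/-- Interface values `W^⋆`. -/
def Wstar (wall : Fin M.nB → WallKind) (k : Fin 5) (a : Fin M.nE × RefFace) (s : FaceNode N) : ℝ :=
  M.onFace a s (fun _ f s' => HexMesh.aver (Y.Wn pr k) f s')
    (fun b => match wall b with
      | .freeSlip => HexMesh.trOwn (Y.Wn pr k) a s
      | .noSlip => ![HexMesh.trOwn (Y.Wn pr 0) a s, 0, 0, 0, HexMesh.trOwn (Y.Wn pr 4) a s] k)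

/-- `G_c^⋆ · n`. -/
def GcStar (κ : ℝ) (a : Fin M.nE × RefFace) (s : FaceNode N) : ℝ :=
  M.onFace a s
    (fun sgn f s' => sgn * (HexMesh.averN gl Y.Gc f s'
      + M.penalty gl κ f s' * HexMesh.jump Y.C f s'))
    (fun _ => -deriv pr.fw (HexMesh.trOwn Y.C a s) / pr.s32)

/-- `F_v^⋆ · n`. -/
def FvStar (κ : ℝ) (wall : Fin M.nB → WallKind) (k : Fin 5) (a : Fin M.nE × RefFace)
    (s : FaceNode N) : ℝ :=
  M.onFace a s
    (fun sgn f s' => sgn * (HexMesh.averN gl (Y.Fv pr k) f s'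
      + if k = 0 then M.penalty gl κ f s' * HexMesh.jump Y.μ f s' else 0))
    (fun b => match wall b with
      | .freeSlip => 0
      | .noSlip => if k = 0 then 0 else HexMesh.trOwn (Y.Fv pr k) a s ⬝ᵥ M.normal gl a s)

/-- `F_e^⋆ · n` plus the diamond flux, in the outward direction of the element. -/
def FeStar (fl : InviscidFlux) (k : Fin 5) (a : Fin M.nE × RefFace) (s : FaceNode N) : ℝ :=
  let own := HexMesh.trOwn (Y.state pr) a s
  M.onFace a s
    (fun sgn f s' =>
      let L := HexMesh.trL (Y.state pr) f s'
      let R := HexMesh.trR (Y.state pr) f s'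
      let n := M.normal gl (M.left f) s'
      sgn * (pr.numFlux fl L R n k + pr.diamondFlux fl own L R n k))
    (fun _ =>
      let n := M.normal gl a s
      pr.numFlux fl own (own.ghost n) n k + pr.diamondFlux fl own own (own.ghost n) n k)

end DGFields

/-- `G_{p,t}^⋆ · n`: averages at interior faces, homogeneous Neumann condition at walls. -/
def gptStar (Gpt : Fin M.nE → Node N → Vec) (a : Fin M.nE × RefFace) (s : FaceNode N) : ℝ :=
  M.onFace a s (fun sgn f s' => sgn * HexMesh.averN gl Gpt f s') (fun _ => 0)

/-- `Y` solves the semi-discrete DG scheme on the time set `I`, with penalty coefficient `κ`,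
inviscid fluxes `fl` and wall types `wall`, the source terms being zero. -/
structure IsSemiDiscreteSolution (κ : ℝ) (fl : InviscidFlux) (wall : Fin M.nB → WallKind)
    (I : Set ℝ) (Y : ℝ → DGFields M N) : Prop where
  diff_C : ∀ t ∈ I, ∀ e n, DifferentiableAt ℝ (fun s => (Y s).C e n) t
  diff_Q : ∀ t ∈ I, ∀ e n, DifferentiableAt ℝ (fun s => (Y s).Q e n) t
  diff_P : ∀ t ∈ I, ∀ e n, DifferentiableAt ℝ (fun s => (Y s).P e n) t
  rho_pos : ∀ t ∈ I, ∀ e n, 0 < pr.rho ((Y t).C e n)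
  /-- concentration gradient -/
  eq_c : ∀ t ∈ I, ∀ e, M.IsDGGradient gl e ((Y t).C e)
    (fun a s => HexMesh.starAver (Y t).C (e, a) s) ((Y t).Gc e)
  /-- pressure gradient -/
  eq_p : ∀ t ∈ I, ∀ e, M.IsDGGradient gl e ((Y t).P e)
    (fun a s => HexMesh.starAver (Y t).P (e, a) s) ((Y t).Gp e)
  /-- gradients of the entropy variables -/
  eq_g : ∀ t ∈ I, ∀ e k, M.IsDGGradient gl e ((Y t).Wn pr k e)
    (fun a s => (Y t).Wstar pr wall k (e, a) s) (fun n => (Y t).G e n k)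
  /-- chemical potential -/
  eq_μ : ∀ t ∈ I, ∀ e, ∀ φ : Node N → ℝ,
    gl.vol (fun n => M.dJac gl e n * (Y t).μ e n * φ n) =
      gl.vol (fun n => M.dJac gl e n * deriv pr.f0 ((Y t).C e n) * φ n)
      - M.surf gl e (fun a s => pr.s32 * φ (faceNode a s) * (Y t).GcStar pr gl κ (e, a) s)
      + gl.vol (fun n => ∑ d, pr.s32 * (M.dContra gl e n d ⬝ᵥ (Y t).Gc e n) * gl.dXi d φ n)
  /-- evolution equations for `(C, √ρU, P)`, the pressure term being `-∇²p_t` -/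
  eq_q : ∀ t ∈ I, ∀ e, ∀ φ : Fin 5 → Node N → ℝ,
    gl.vol (fun n => M.dJac gl e n * (deriv (fun s => (Y s).C e n) t * φ 0 n
        + ∑ i, Real.sqrt (pr.rho ((Y t).C e n)) * deriv (fun s => (Y s).Q e n) t i
            * φ (momIdx i) n))
    - (M.surf gl e (fun a s => φ 4 (faceNode a s) *
          gptStar M gl (fun e' n' => deriv (fun r => (Y r).Gp e' n') t) (e, a) s)
        - gl.vol (fun n => ∑ d,
            (M.dContra gl e n d ⬝ᵥ deriv (fun s => (Y s).Gp e n) t) * gl.dXi d (φ 4) n))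
    + M.surf gl e (fun a s => ∑ k, φ k (faceNode a s) *
        ((Y t).FeStar pr gl fl k (e, a) s
          - pr.fe ((Y t).state pr e (faceNode a s)) k ⬝ᵥ M.normal gl (e, a) s
          - pr.ncFlux ((Y t).state pr e (faceNode a s)) (M.normal gl (e, a) s) k))
    + gl.vol (fun n => ∑ k, φ k n * ∑ d,
        gl.dXi d (fun n' => M.dContra gl e n' d ⬝ᵥ pr.fe ((Y t).state pr e n') k) n)
    + gl.vol (fun n => ∑ k, φ k n * ∑ m, ∑ d,
        (M.dContra gl e n d ⬝ᵥ pr.phi ((Y t).state pr e n) m k) * gl.dXi d ((Y t).Wn pr m e) n)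
    = M.surf gl e (fun a s => ∑ k, φ k (faceNode a s) * (Y t).FvStar pr gl κ wall k (e, a) s)
      - gl.vol (fun n => ∑ k, ∑ d,
          (M.dContra gl e n d ⬝ᵥ (Y t).Fv pr k e n) * gl.dXi d (φ k) n)

variable {M}

/-- Nodal entropy density `ℰ₂`. -/
def dEntropy2 (Y : DGFields M N) (e : Fin M.nE) (n : Node N) : ℝ :=
  let q := Y.state pr e n
  pr.f0 q.C + pr.s34 * (Y.Gc e n ⬝ᵥ Y.Gc e n) + 1 / 2 * pr.rho q.C * (q.U ⬝ᵥ q.U)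
    + (Y.Gp e n ⬝ᵥ Y.Gp e n) / (2 * pr.K)

/-- Total discrete entropy, including the interface term `(3/4)σε ∑_f ∫_{f,N} β ⟦C⟧²`. -/
def dTotalEntropy (κ : ℝ) (Y : DGFields M N) : ℝ :=
  ∑ e, gl.vol (fun n => M.dJac gl e n * dEntropy2 pr Y e n)
    + pr.s34 * ∑ f, gl.face (fun s => M.faceJac gl (M.left f) s *
        (M.penalty gl κ f s * HexMesh.jump Y.C f s ^ 2))

/-- Discrete surface free energy `∑_b ∫_{b,N} f_w(C) dS`. -/
def dSurfaceEnergy (Y : DGFields M N) : ℝ :=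
  ∑ b, gl.face (fun s => M.faceJac gl (M.bdry b) s * pr.fw (HexMesh.trOwn Y.C (M.bdry b) s))

/-- Discrete dissipation `∑_e ⟨𝒥 (M₀|G_μ|² + 2η S:S), 1⟩`. -/
def dDissipation (Y : DGFields M N) : ℝ :=
  ∑ e, gl.vol (fun n => M.dJac gl e n *
    (pr.M₀ * (Y.G e n 0 ⬝ᵥ Y.G e n 0)
      + 2 * pr.visc (Y.C e n) * strainSq (fun i => Y.G e n (momIdx i))))

end Scheme

end INSCH

end

/-! Both laws come from testing the evolution equations with the entropy variables `(μ, u, p/K)` and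
the definition of `μ` with `c_t`. The formulation is chosen so that everything conservative becomes
a divergence: `u · √ρ(√ρu)_t = ½(ρ|u|²)_t`, and the two transport terms add up to `∇·(½ρ|u|²u)`, so
no mass equation for `ρ` is needed; `μ∇·(cu) + cu·∇μ = ∇·(μcu)`; `u·∇p + (p/K)(-∇²p_t + K∇·u)` is
`∂_t|∇p|²/(2K)` plus a divergence. What remains is `-M₀|∇μ|² - 2ηS:S`, and the wall conditions
annihilate the whole boundary flux except `-f_w'(c)c_t`, which is minus the rate of change of the
surface energy.

Continuous law: the pointwise identity is `local_balance` and the wall fluxes are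
`energyFlux_boundary`. The divergence theorem is proved element by element with the Piola transform;
interior faces cancel because the area vectors of their two sides are opposite
(`contAreaVec_right`). Differentiation under the integral is dominated by a constant, by
compactness.

Discrete law: integration by parts survives as `GaussLobatto.vol_by_parts`, because the derivative
of a product of two polynomials of degree `N` has degree at most `2N - 1`, which the quadrature
integrates exactly. The identity `sum_W_phi`, contracting the non-conservative coefficients with the
entropy variables to the inviscid flux, turns the inviscid volume terms into surface terms. In curl
form the metric terms on a face involve only tangential derivatives of the node positions on it, so
both sides see opposite normals (`areaVec_right`), and `sum_surf` reduces everything to pointwise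
statements at face nodes: the averaged fluxes telescope (`averN_balance`, `central_balance`), and
the exact Riemann solver leaves a sum of squares (`ers_dissipation`). Positivity of the quadrature
weights transfers these signs to the sums. -/

namespace INSCH

/-! ### Gauss-Lobatto quadrature: uniqueness, symmetry, positive weights, summation by parts. -/

namespace GaussLobatto

open Polynomial

variable {N : ℕ} (gl : GaussLobatto N)

/-- With a single node the first and last node coincide and cannot be both `-1` and `1`. -/
theorem one_le {N : ℕ} (gl : GaussLobatto N) : 1 ≤ N := by
  rcases Nat.eq_zero_or_pos N with h | h
  · subst h
    have h1 := gl.first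
    have h2 := gl.last
    have : (Fin.last 0) = (0 : Fin 1) := rfl
    rw [this, h1] at h2
    norm_num at h2
  · exact h

theorem injOn : Set.InjOn gl.ξ (Finset.univ : Finset (Fin (N + 1))) := gl.mono.injective.injOn

theorem mem_Icc (i : Fin (N + 1)) : gl.ξ i ∈ Icc (-1 : ℝ) 1 := by
  constructor
  · rw [← gl.first]; exact gl.mono.monotone (Fin.zero_le i)
  · rw [← gl.last]; exact gl.mono.monotone (Fin.le_last i)

/-- Nodal polynomial. -/
noncomputable def nodal : ℝ[X] := ∏ i, (X - C (gl.ξ i))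

theorem nodal_monic : gl.nodal.Monic := monic_prod_of_monic _ _ fun _ _ => monic_X_sub_C _

theorem nodal_degree : gl.nodal.degree = (N + 1 : ℕ) := by
  rw [nodal, degree_prod]; simp

theorem nodal_eval (i : Fin (N + 1)) : gl.nodal.eval (gl.ξ i) = 0 := by
  rw [nodal, eval_prod]
  exact Finset.prod_eq_zero (Finset.mem_univ i) (by simp)

theorem integral_nodal_mul (r : ℝ[X]) (hr : (gl.nodal * r).degree < (2 * N : ℕ)) :
    ∫ x in (-1 : ℝ)..1, (gl.nodal * r).eval x = 0 := by
  rw [gl.exact _ hr]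
  exact Finset.sum_eq_zero fun i _ => by rw [eval_mul, nodal_eval]; ring

/-- A nonzero polynomial has finitely many roots, so it is strictly positive somewhere on the
interval. -/
theorem integral_eval_pos {p : ℝ[X]} (hp : p ≠ 0) (h : ∀ x ∈ Icc (-1 : ℝ) 1, 0 ≤ p.eval x) :
    0 < ∫ x in (-1 : ℝ)..1, p.eval x := by
  refine intervalIntegral.integral_pos (by norm_num) p.continuous.continuousOn
    (fun x hx => h x (Ioc_subset_Icc_self hx)) ?_
  by_contra! hc
  have hz : (Icc (-1 : ℝ) 1) ⊆ {x | p.IsRoot x} := fun x hx => le_antisymm (hc x hx) (h x hx)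
  exact ((Set.Icc_infinite (by norm_num : (-1 : ℝ) < 1)).mono hz) (finite_setOfPred_isRoot hp)

/-- The difference `d` of the two monic nodal polynomials has degree at most `N` and vanishes at
`±1`, so `d = (X - 1)(X + 1) r`. Each nodal polynomial is orthogonal to `r`, hence `∫ d r = 0`; but
`-d r = (1 - x²) r²` is nonnegative on the interval and not the zero polynomial. The structure fixes
only the end points and the exactness, so uniqueness is the source of the reflection symmetry of the
rule. -/
theorem nodal_unique (gl' : GaussLobatto N) : gl.nodal = gl'.nodal := by
  by_contra hne
  set d := gl.nodal - gl'.nodal with hd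
  have hd0 : d ≠ 0 := sub_ne_zero.2 hne
  have hdeg : d.degree < (N + 1 : ℕ) := by
    rw [← gl.nodal_degree]
    exact degree_sub_lt_left (by rw [nodal_degree, nodal_degree]) gl.nodal_monic.ne_zero
      (by rw [gl.nodal_monic.leadingCoeff, gl'.nodal_monic.leadingCoeff])
  have h1 : (X - C (1 : ℝ)) ∣ d := by
    rw [dvd_iff_isRoot, IsRoot, hd, eval_sub]
    have a := gl.nodal_eval (Fin.last N)
    have b := gl'.nodal_eval (Fin.last N)
    rw [gl.last] at a; rw [gl'.last] at b; rw [a, b]; ring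
  have h2 : (X - C (-1 : ℝ)) ∣ d := by
    rw [dvd_iff_isRoot, IsRoot, hd, eval_sub]
    have a := gl.nodal_eval 0
    have b := gl'.nodal_eval 0
    rw [gl.first] at a; rw [gl'.first] at b; rw [a, b]; ring
  have hcop : IsCoprime (X - C (1 : ℝ)) (X - C (-1 : ℝ)) :=
    isCoprime_X_sub_C_of_isUnit_sub (by norm_num)
  obtain ⟨r, hr⟩ := hcop.mul_dvd h1 h2
  have hr0 : r ≠ 0 := by rintro rfl; simp at hr; exact hd0 hr
  have hdn : d.natDegree = 2 + r.natDegree := by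
    rw [hr, natDegree_mul (mul_ne_zero (X_sub_C_ne_zero _) (X_sub_C_ne_zero _)) hr0,
      natDegree_mul (X_sub_C_ne_zero _) (X_sub_C_ne_zero _), natDegree_X_sub_C, natDegree_X_sub_C]
  have hdl : d.natDegree < N + 1 := (natDegree_lt_iff_degree_lt hd0).2 hdeg
  -- Degree count: `N + 1` for the nodal polynomial plus at most `N - 2` for `r`, which is the
  -- exactness limit `2N - 1`.
  have key : ∀ g : GaussLobatto N, ∫ x in (-1 : ℝ)..1, (g.nodal * r).eval x = 0 := by
    intro g
    apply g.integral_nodal_mul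
    rw [degree_mul, nodal_degree, degree_eq_natDegree hr0]
    norm_cast
    omega
  have hzero : ∫ x in (-1 : ℝ)..1, (-(d * r)).eval x = 0 := by
    have e : ∀ x, (-(d * r)).eval x = (gl'.nodal * r).eval x - (gl.nodal * r).eval x := by
      intro x; simp only [hd, eval_neg, eval_mul, eval_sub]; ring
    simp_rw [e]
    rw [intervalIntegral.integral_sub
      ((gl'.nodal * r).continuous.intervalIntegrable _ _)
      ((gl.nodal * r).continuous.intervalIntegrable _ _), key, key, sub_zero]
  have hpos := integral_eval_pos (p := -(d * r)) (neg_ne_zero.2 (mul_ne_zero hd0 hr0)) (by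
    intro x hx
    rw [hr]
    simp only [eval_neg, eval_mul, eval_sub, eval_X, eval_C]
    have := mul_nonneg (mul_nonneg (sub_nonneg.2 hx.2) (by linarith [hx.1] : 0 ≤ x + 1))
      (sq_nonneg (r.eval x))
    nlinarith [this])
  linarith

theorem range_ξ : Set.range gl.ξ = {x | gl.nodal.IsRoot x} := by
  ext x
  simp only [Set.mem_range, Set.mem_ofPred_eq, IsRoot, nodal, eval_prod, Finset.prod_eq_zero_iff,
    Finset.mem_univ, true_and, eval_sub, eval_X, eval_C, sub_eq_zero]
  exact ⟨fun ⟨i, h⟩ => ⟨i, h.symm⟩, fun ⟨i, h⟩ => ⟨i, h.symm⟩⟩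

theorem ξ_unique (gl' : GaussLobatto N) : gl.ξ = gl'.ξ := by
  rw [← StrictMono.range_inj gl.mono gl'.mono, range_ξ, range_ξ, gl.nodal_unique gl']

theorem two_mul_lt_of_le {m : ℕ} {p : ℝ[X]} (hp : p.degree ≤ (m : ℕ)) (h : m < 2 * N) :
    p.degree < (2 * N : ℕ) := hp.trans_lt (by exact_mod_cast h)

/-- The basis polynomial has degree `N < 2N` as `1 ≤ N`, so the rule is exact on it. Hence the nodes
determine the weights. -/
theorem w_eq_integral (i : Fin (N + 1)) :
    gl.w i = ∫ x in (-1 : ℝ)..1, (Lagrange.basis Finset.univ gl.ξ i).eval x := by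
  rw [gl.exact]
  · rw [Finset.sum_eq_single i]
    · rw [Lagrange.eval_basis_self gl.injOn (Finset.mem_univ i), mul_one]
    · intro j _ hj
      rw [Lagrange.eval_basis_of_ne hj.symm (Finset.mem_univ j), mul_zero]
    · simp
  · rw [Lagrange.degree_basis gl.injOn (Finset.mem_univ i)]
    have := gl.one_le
    simp
    norm_cast
    omega

/-- The rule reflected at the origin. -/
noncomputable def reflect : GaussLobatto N where
  ξ i := -gl.ξ i.rev
  w i := gl.w i.rev
  mono := fun i j h => neg_lt_neg (gl.mono (Fin.rev_lt_rev.2 h))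
  first := by simp [gl.last]
  last := by simp [gl.first]
  exact p hp := by
    have h := gl.exact (p.comp (-X)) (by rwa [degree_comp_neg_X])
    simp only [eval_comp, eval_neg, eval_X] at h
    rw [intervalIntegral.integral_comp_neg (fun x => p.eval x), neg_neg] at h
    rw [h]
    exact (Equiv.sum_comp Fin.revPerm fun i => gl.w i * p.eval (-gl.ξ i)).symm

/-- Uniqueness applied to the rule and its reflection. -/
theorem ξ_rev (i : Fin (N + 1)) : gl.ξ i.rev = -gl.ξ i := by
  have h := congrFun (gl.ξ_unique gl.reflect) i
  rw [h]; simp [reflect]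

theorem w_rev (i : Fin (N + 1)) : gl.w i.rev = gl.w i := by
  have h : gl.reflect.w i = gl.w i := by
    rw [w_eq_integral, w_eq_integral, ← gl.ξ_unique gl.reflect]
  exact h

theorem w_pos_of_poly (i : Fin (N + 1)) (p : ℝ[X]) (hdeg : p.degree < (2 * N : ℕ))
    (hz : ∀ j, j ≠ i → p.eval (gl.ξ j) = 0) (hp : p ≠ 0)
    (h : ∀ x ∈ Icc (-1 : ℝ) 1, 0 ≤ p.eval x) : 0 < gl.w i := by
  have h1 := integral_eval_pos hp h
  rw [gl.exact p hdeg, Finset.sum_eq_single i (fun j _ hj => by rw [hz j hj, mul_zero])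
    (by simp)] at h1
  exact pos_of_mul_pos_left h1 (h _ (gl.mem_Icc i))

/-- The square of a Lagrange basis polynomial would isolate the weight but has degree `2N`, one too
many. Since `1 - X` and `1 + X` are already nonnegative on the interval, the end nodes need only a
simple factor; this brings the degree down to `2N - 1` for an end node and `2N - 2` for an inner
one. -/
theorem w_pos (i : Fin (N + 1)) : 0 < gl.w i := by
  have hN := gl.one_le
  have h0l : (0 : Fin (N + 1)) ≠ Fin.last N := by
    intro h; have := congrArg Fin.val h; simp at this; omega
  -- The inner nodes other than `i`: the ones that require a double root to keep the sign.
  let B : Finset (Fin (N + 1)) := ((Finset.univ.erase i).erase 0).erase (Fin.last N)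
  let q : ℝ[X] := ∏ j ∈ B, (X - C (gl.ξ j))
  have hqm : q.Monic := monic_prod_of_monic _ _ fun _ _ => monic_X_sub_C _
  have hqd : q.degree = (B.card : ℕ) := by
    simp only [q]; rw [degree_prod]; simp
  have hqz : ∀ j, j ≠ i → j ≠ 0 → j ≠ Fin.last N → q.eval (gl.ξ j) = 0 := by
    intro j h1 h2 h3
    simp only [q, eval_prod]
    exact Finset.prod_eq_zero (i := j) (by simp [B, h1, h2, h3]) (by simp)
  have hX1 : (1 - X : ℝ[X]) ≠ 0 := by
    intro h; have := congrArg (eval 0) h; simp at this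
  have hX2 : (1 + X : ℝ[X]) ≠ 0 := by
    intro h; have := congrArg (eval 0) h; simp at this
  have d1 : (1 - X : ℝ[X]).degree ≤ (1 : ℕ) := by compute_degree; norm_num
  have d2 : (1 + X : ℝ[X]).degree ≤ (1 : ℕ) := by compute_degree; norm_num
  by_cases hi0 : i = 0
  · subst hi0
    have hB : B.card = N - 1 := by
      have : B = (Finset.univ.erase 0).erase (Fin.last N) := by ext; simp [B]
      rw [this, Finset.card_erase_of_mem, Finset.card_erase_of_mem] <;> simp [h0l.symm]
    refine gl.w_pos_of_poly 0 ((1 - X) * q ^ 2) ?_ ?_ (mul_ne_zero hX1 (pow_ne_zero _ hqm.ne_zero)) ?_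
    · refine two_mul_lt_of_le (m := 1 + 2 * (N - 1)) ?_ (by omega)
      rw [degree_mul, degree_pow, hqd, hB]
      push_cast
      exact add_le_add d1 (by simp)
    · intro j hj
      by_cases hl : j = Fin.last N
      · rw [hl, gl.last]; simp
      · rw [eval_mul, eval_pow, hqz j hj hj hl]; simp
    · intro x hx
      simp only [eval_mul, eval_sub, eval_one, eval_X, eval_pow]
      exact mul_nonneg (by linarith [hx.2]) (sq_nonneg _)
  by_cases hil : i = Fin.last N
  · subst hil
    have hB : B.card = N - 1 := by
      have : B = (Finset.univ.erase 0).erase (Fin.last N) := by ext; simp [B]; tauto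
      rw [this, Finset.card_erase_of_mem, Finset.card_erase_of_mem] <;> simp [h0l.symm]
    refine gl.w_pos_of_poly _ ((1 + X) * q ^ 2) ?_ ?_ (mul_ne_zero hX2 (pow_ne_zero _ hqm.ne_zero)) ?_
    · refine two_mul_lt_of_le (m := 1 + 2 * (N - 1)) ?_ (by omega)
      rw [degree_mul, degree_pow, hqd, hB]
      push_cast
      exact add_le_add d2 (by simp)
    · intro j hj
      by_cases hl : j = 0
      · rw [hl, gl.first]; simp
      · rw [eval_mul, eval_pow, hqz j hj hl hj]; simp
    · intro x hx
      simp only [eval_mul, eval_add, eval_one, eval_X, eval_pow]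
      exact mul_nonneg (by linarith [hx.1]) (sq_nonneg _)
  · have hB : B.card = N - 2 := by
      simp only [B]
      rw [Finset.card_erase_of_mem, Finset.card_erase_of_mem, Finset.card_erase_of_mem] <;>
        simp [h0l.symm, Ne.symm hi0, Ne.symm hil]
      omega
    have hN2 : 2 ≤ N := by
      have h1 : (i : ℕ) ≠ 0 := fun h => hi0 (Fin.ext h)
      have h2 : (i : ℕ) ≠ N := fun h => hil (Fin.ext h)
      have := i.2; omega
    refine gl.w_pos_of_poly _ ((1 - X) * (1 + X) * q ^ 2) ?_ ?_
      (mul_ne_zero (mul_ne_zero hX1 hX2) (pow_ne_zero _ hqm.ne_zero)) ?_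
    · refine two_mul_lt_of_le (m := 1 + 1 + 2 * (N - 2)) ?_ (by omega)
      rw [degree_mul, degree_mul, degree_pow, hqd, hB]
      push_cast
      exact add_le_add (add_le_add d1 d2) (by simp)
    · intro j hj
      by_cases hl : j = 0
      · rw [hl, gl.first]; simp
      by_cases hl' : j = Fin.last N
      · rw [hl', gl.last]; simp
      · rw [eval_mul, eval_pow, hqz j hj hl hl']; simp
    · intro x hx
      simp only [eval_mul, eval_sub, eval_add, eval_one, eval_X, eval_pow]
      exact mul_nonneg (mul_nonneg (by linarith [hx.2]) (by linarith [hx.1])) (sq_nonneg _)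

theorem basis_comp_neg (j : Fin (N + 1)) :
    (Lagrange.basis Finset.univ gl.ξ j.rev).comp (-X) = Lagrange.basis Finset.univ gl.ξ j := by
  refine Polynomial.eq_of_degrees_lt_of_eval_index_eq (s := Finset.univ) (v := gl.ξ) gl.injOn ?_ ?_ ?_
  · rw [degree_comp_neg_X, Lagrange.degree_basis gl.injOn (Finset.mem_univ _)]
    simp; norm_cast; omega
  · rw [Lagrange.degree_basis gl.injOn (Finset.mem_univ _)]
    simp; norm_cast; omega
  · intro i _
    rw [eval_comp, eval_neg, eval_X, ← gl.ξ_rev]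
    by_cases h : j = i
    · subst h
      rw [Lagrange.eval_basis_self gl.injOn (Finset.mem_univ _),
        Lagrange.eval_basis_self gl.injOn (Finset.mem_univ _)]
    · rw [Lagrange.eval_basis_of_ne h (Finset.mem_univ _),
        Lagrange.eval_basis_of_ne (fun h' => h (Fin.rev_injective h')) (Finset.mem_univ _)]

/-- Chain rule for `x ↦ -x`, which permutes the Lagrange basis. This sign is what a flipped face
coordinate contributes to a tangential derivative. -/
theorem D_rev (i j : Fin (N + 1)) : gl.D i.rev j.rev = -gl.D i j := by
  unfold D
  rw [← gl.basis_comp_neg j, derivative_comp, gl.ξ_rev]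
  simp [eval_comp]

/-- Nodal differentiation on the one-dimensional grid. -/
noncomputable def d1 (g : Fin (N + 1) → ℝ) (i : Fin (N + 1)) : ℝ := ∑ m, gl.D i m * g m

theorem d1_eq_eval (g : Fin (N + 1) → ℝ) (i : Fin (N + 1)) :
    gl.d1 g i = (derivative (Lagrange.interpolate Finset.univ gl.ξ g)).eval (gl.ξ i) := by
  rw [Lagrange.interpolate_apply, derivative_sum, eval_finsetSum]
  refine Finset.sum_congr rfl fun m _ => ?_
  rw [derivative_C_mul, eval_C_mul, D, mul_comm]

/-- The left side is the quadrature of `(pq)'` for the interpolants `p`, `q`. It is exact, and the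
boundary values of `pq` are nodal values because the end points are nodes. -/
theorem sum_by_parts (g h : Fin (N + 1) → ℝ) :
    ∑ i, gl.w i * (g i * gl.d1 h i + gl.d1 g i * h i)
      = g (Fin.last N) * h (Fin.last N) - g 0 * h 0 := by
  set p := Lagrange.interpolate Finset.univ gl.ξ g with hp
  set q := Lagrange.interpolate Finset.univ gl.ξ h with hq
  have ep : ∀ i, p.eval (gl.ξ i) = g i := fun i =>
    Lagrange.eval_interpolate_at_node _ gl.injOn (Finset.mem_univ i)
  have eq : ∀ i, q.eval (gl.ξ i) = h i := fun i =>
    Lagrange.eval_interpolate_at_node _ gl.injOn (Finset.mem_univ i)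
  have hpd : p.natDegree ≤ N := by
    have := Lagrange.degree_interpolate_lt g gl.injOn
    rw [Finset.card_univ, Fintype.card_fin] at this
    exact natDegree_le_iff_degree_le.2 (Order.le_of_lt_succ (by exact_mod_cast this))
  have hqd : q.natDegree ≤ N := by
    have := Lagrange.degree_interpolate_lt h gl.injOn
    rw [Finset.card_univ, Fintype.card_fin] at this
    exact natDegree_le_iff_degree_le.2 (Order.le_of_lt_succ (by exact_mod_cast this))
  have hN := gl.one_le
  -- The product has degree at most `2N`; differentiation lowers it to the exactness limit.
  have hdeg : (derivative (p * q)).degree < (2 * N : ℕ) := by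
    refine two_mul_lt_of_le (m := 2 * N - 1) (natDegree_le_iff_degree_le.1 ?_) (by omega)
    have h1 := natDegree_derivative_le (p * q)
    have h2 := natDegree_mul_le (p := p) (q := q)
    omega
  have h1 := gl.exact _ hdeg
  rw [intervalIntegral.integral_eq_sub_of_hasDerivAt (fun x _ => (p * q).hasDerivAt x)
    ((derivative (p * q)).continuous.intervalIntegrable _ _)] at h1
  rw [eval_mul, eval_mul, ← gl.first, ← gl.last, ep, ep, eq, eq] at h1
  rw [h1]
  refine Finset.sum_congr rfl fun i _ => ?_
  rw [d1_eq_eval, d1_eq_eval, derivative_mul, eval_add, eval_mul, eval_mul, ep, eq]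
  ring

theorem vol_eq_sum (d : Fin 3) (g : Node N → ℝ) :
    gl.vol g = gl.face fun s => ∑ i, gl.w i * g (d.insertNth i s) := by
  unfold vol face
  rw [← Equiv.sum_comp (Fin.insertNthEquiv (fun _ => Fin (N + 1)) d), Fintype.sum_prod_type_right]
  refine Finset.sum_congr rfl fun s _ => ?_
  rw [Finset.mul_sum]
  refine Finset.sum_congr rfl fun i _ => ?_
  have e : (Fin.insertNthEquiv (fun _ => Fin (N + 1)) d) (i, s) = d.insertNth i s := rfl
  rw [e, Fin.prod_univ_succAbove _ d]
  simp
  ring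

theorem dXi_insertNth (d : Fin 3) (g : Node N → ℝ) (i : Fin (N + 1)) (s : FaceNode N) :
    gl.dXi d g (d.insertNth i s) = gl.d1 (fun m => g (d.insertNth m s)) i := by
  unfold dXi d1
  simp [Fin.update_insertNth]

/-- One-dimensional summation by parts along every grid line in direction `d`; the two end points of
the lines sweep out the two opposite faces. -/
theorem vol_by_parts (d : Fin 3) (g h : Node N → ℝ) :
    gl.vol (fun n => g n * gl.dXi d h n) + gl.vol (fun n => gl.dXi d g n * h n)
      = ∑ b : Bool, RefFace.sign (d, b) *
          gl.face (fun s => g (faceNode (d, b) s) * h (faceNode (d, b) s)) := by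
  rw [gl.vol_eq_sum d, gl.vol_eq_sum d, Fintype.sum_bool]
  unfold face
  rw [← Finset.sum_add_distrib, Finset.mul_sum, Finset.mul_sum, ← Finset.sum_add_distrib]
  refine Finset.sum_congr rfl fun s _ => ?_
  simp only [dXi_insertNth]
  rw [← mul_add, ← Finset.sum_add_distrib]
  have := gl.sum_by_parts (fun m => g (d.insertNth m s)) (fun m => h (d.insertNth m s))
  simp only [mul_add] at this
  rw [this]
  simp [faceNode, RefFace.sign]
  ring

end GaussLobatto

/-! ### Euclidean length, differentiation on faces, and linearity of the quadratures. -/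

theorem vlen_eq_zero {v : Vec} : vlen v = 0 ↔ v = 0 := by
  unfold vlen
  have h : 0 ≤ v ⬝ᵥ v := by
    simp only [dotProduct]; exact Finset.sum_nonneg fun i _ => mul_self_nonneg _
  rw [Real.sqrt_eq_zero h]
  exact dotProduct_self_eq_zero

theorem vlen_nonneg (v : Vec) : 0 ≤ vlen v := Real.sqrt_nonneg _

theorem vlen_neg (v : Vec) : vlen (-v) = vlen v := by simp [vlen]

theorem vlen_mul_self (v : Vec) : vlen v * vlen v = v ⬝ᵥ v :=
  Real.mul_self_sqrt (by simp only [dotProduct]; exact Finset.sum_nonneg fun i _ => mul_self_nonneg _)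

/-- Also true at `v = 0`, where the inverse is `0` by convention. Hence area vectors factor into
face Jacobian times normal even at nodes where the discrete face Jacobian vanishes. -/
theorem vlen_smul_inv_smul (v : Vec) : vlen v • ((vlen v)⁻¹ • v) = v := by
  by_cases h : vlen v = 0
  · rw [vlen_eq_zero.1 h]; simp
  · rw [smul_smul, mul_inv_cancel₀ h, one_smul]

namespace GaussLobatto

variable {N : ℕ} (gl : GaussLobatto N)

/-- Nodal differentiation on a face. -/
noncomputable def dFace (k : Fin 2) (g : FaceNode N → ℝ) (s : FaceNode N) : ℝ :=
  ∑ m, gl.D (s k) m * g (Function.update s k m)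

/-- A derivative tangential to a face uses values on that face only; this is what lets the two
neighbours compute the same tangential quantities. -/
theorem dXi_succAbove (d : Fin 3) (k : Fin 2) (g : Node N → ℝ) (i : Fin (N + 1))
    (s : FaceNode N) :
    gl.dXi (d.succAbove k) g (d.insertNth i s) = gl.dFace k (fun s' => g (d.insertNth i s')) s := by
  unfold dXi dFace
  refine Finset.sum_congr rfl fun m _ => ?_
  beta_reduce
  rw [Fin.insertNth_update, Fin.insertNth_apply_succAbove]

theorem dFace_const_mul (k : Fin 2) (c : ℝ) (g : FaceNode N → ℝ) (s : FaceNode N) :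
    gl.dFace k (fun s => c * g s) s = c * gl.dFace k g s := by
  unfold dFace
  rw [Finset.mul_sum]
  exact Finset.sum_congr rfl fun m _ => by ring

/-- The surface curl form of a pair of nodal functions on a face. -/
noncomputable def faceCurl (A B : FaceNode N → ℝ) (s : FaceNode N) : ℝ :=
  gl.dFace 0 (fun s => A s * gl.dFace 1 B s) s - gl.dFace 1 (fun s => A s * gl.dFace 0 B s) s

theorem face_nonneg {g : FaceNode N → ℝ} (h : ∀ s, 0 ≤ g s) : 0 ≤ gl.face g :=
  Finset.sum_nonneg fun s _ =>
    mul_nonneg (Finset.prod_nonneg fun _ _ => (gl.w_pos _).le) (h s)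

theorem vol_nonneg {g : Node N → ℝ} (h : ∀ s, 0 ≤ g s) : 0 ≤ gl.vol g :=
  Finset.sum_nonneg fun s _ =>
    mul_nonneg (Finset.prod_nonneg fun _ _ => (gl.w_pos _).le) (h s)

theorem vol_add (g h : Node N → ℝ) : gl.vol (fun n => g n + h n) = gl.vol g + gl.vol h := by
  simp only [vol, mul_add, Finset.sum_add_distrib]

theorem vol_const_mul (c : ℝ) (h : Node N → ℝ) : gl.vol (fun n => c * h n) = c * gl.vol h := by
  simp only [vol, Finset.mul_sum]
  exact Finset.sum_congr rfl fun _ _ => by ring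

theorem vol_sum {ι : Type*} (S : Finset ι) (g : ι → Node N → ℝ) :
    gl.vol (fun n => ∑ i ∈ S, g i n) = ∑ i ∈ S, gl.vol (g i) := by
  simp only [vol, Finset.mul_sum]
  exact Finset.sum_comm

theorem face_add (g h : FaceNode N → ℝ) : gl.face (fun n => g n + h n) = gl.face g + gl.face h := by
  simp only [face, mul_add, Finset.sum_add_distrib]

theorem face_const_mul (c : ℝ) (h : FaceNode N → ℝ) :
    gl.face (fun n => c * h n) = c * gl.face h := by
  simp only [face, Finset.mul_sum]
  exact Finset.sum_congr rfl fun _ _ => by ring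

end GaussLobatto

/-! ### Symmetries of the square acting on face nodes. -/

theorem perm_fin_two : ∀ e : Equiv.Perm (Fin 2), e = 1 ∨ e = Equiv.swap 0 1 := by decide

namespace FaceOrient

variable {N : ℕ} (gl : GaussLobatto N) (o : FaceOrient)

theorem nodeInv_node (s : FaceNode N) : o.nodeInv (o.node s) = s := by
  funext k
  simp only [nodeInv, node, Equiv.apply_symm_apply]
  split_ifs <;> simp

theorem node_nodeInv (s : FaceNode N) : o.node (o.nodeInv s) = s := by
  funext k
  simp only [nodeInv, node, Equiv.symm_apply_apply]
  split_ifs <;> simp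

/-- The action on face nodes as an equivalence. -/
def nodeEquiv (N : ℕ) : FaceNode N ≃ FaceNode N where
  toFun := o.node
  invFun := o.nodeInv
  left_inv := o.nodeInv_node
  right_inv := o.node_nodeInv

/-- The tensor-product weights are invariant under permuting the coordinates and, by `w_rev`, under
reversing them. -/
theorem face_comp_node (g : FaceNode N → ℝ) : gl.face (fun s => g (o.node s)) = gl.face g := by
  unfold GaussLobatto.face
  rw [← Equiv.sum_comp (o.nodeEquiv N) (fun s => (∏ k, gl.w (s k)) * g s)]
  refine Finset.sum_congr rfl fun s _ => ?_
  have h : ∏ k, gl.w (o.node s k) = ∏ k, gl.w (s k) := by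
    rw [← Equiv.prod_comp o.perm (fun k => gl.w (s k))]
    refine Finset.prod_congr rfl fun k _ => ?_
    unfold node
    split_ifs
    · rw [gl.w_rev]
    · rfl
  change _ = (∏ k, gl.w (o.node s k)) * g (o.node s)
  rw [h]

theorem pt_nodes (s : FaceNode N) : o.pt (fun k => gl.ξ (s k)) = fun k => gl.ξ (o.node s k) := by
  funext k
  unfold pt node
  split_ifs
  · rw [gl.ξ_rev]
  · rfl

/-- The sign with which a coordinate of the square is mapped. -/
def flipSign (k : Fin 2) : ℝ := if o.flip k then -1 else 1

theorem node_update (s : FaceNode N) (j : Fin 2) (m : Fin (N + 1)) :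
    o.node (Function.update s (o.perm j) m)
      = Function.update (o.node s) j (if o.flip j then m.rev else m) := by
  funext k
  by_cases h : k = j
  · subst h; simp [node]
  · have h' : o.perm k ≠ o.perm j := fun e => h (o.perm.injective e)
    simp [node, Function.update_of_ne h, Function.update_of_ne h']

/-- The discrete chain rule for a symmetry of the square; the sign of a flip comes from `D_rev`. -/
theorem dFace_comp_node (g : FaceNode N → ℝ) (j : Fin 2) (s : FaceNode N) :
    gl.dFace (o.perm j) (fun s => g (o.node s)) s = o.flipSign j * gl.dFace j g (o.node s) := by
  unfold GaussLobatto.dFace flipSign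
  simp only [node_update]
  by_cases h : o.flip j
  · simp only [h, if_true, node]
    rw [← Equiv.sum_comp Fin.revPerm, Finset.mul_sum]
    refine Finset.sum_congr rfl fun m _ => ?_
    simp only [Fin.revPerm_apply, Fin.rev_rev]
    have := gl.D_rev (s (o.perm j)).rev m
    rw [Fin.rev_rev] at this
    rw [this]
    ring
  · simp [h, node]

/-- The curl is antisymmetric in its two derivatives: each flip contributes its sign and a swap
exchanges the two terms, which together make up the determinant. -/
theorem faceCurl_comp_node (A B : FaceNode N → ℝ) (s : FaceNode N) :
    gl.faceCurl (fun s => A (o.node s)) (fun s => B (o.node s)) s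
      = o.det * gl.faceCurl A B (o.node s) := by
  have key : ∀ i j, gl.dFace (o.perm i)
      (fun s => A (o.node s) * gl.dFace (o.perm j) (fun s => B (o.node s)) s) s
      = o.flipSign i * o.flipSign j * gl.dFace i (fun s => A s * gl.dFace j B s) (o.node s) := by
    intro i j
    simp only [dFace_comp_node]
    rw [o.dFace_comp_node gl (fun s => A s * (o.flipSign j * gl.dFace j B s)) i s, mul_assoc,
      ← gl.dFace_const_mul (c := o.flipSign j)]
    congr 2
    funext s
    ring
  have h01 := key 0 1
  have h10 := key 1 0
  have hdet : o.det = ((Equiv.Perm.sign o.perm : ℤ) : ℝ) * (o.flipSign 0 * o.flipSign 1) := by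
    simp [det, flipSign, Fin.prod_univ_two]
  rw [hdet]
  unfold GaussLobatto.faceCurl
  rcases perm_fin_two o.perm with h | h <;> rw [h] at h01 h10 ⊢
  · simp only [Equiv.Perm.coe_one, id] at h01 h10
    rw [h01, h10, Equiv.Perm.sign_one]
    push_cast
    ring
  · simp only [Equiv.swap_apply_left, Equiv.swap_apply_right] at h01 h10
    rw [h01, h10, Equiv.Perm.sign_swap (by decide)]
    push_cast
    ring

end FaceOrient

theorem facePt_nodes {N : ℕ} (gl : GaussLobatto N) (a : RefFace) (s : FaceNode N) :
    facePt a (fun k => gl.ξ (s k)) = fun d => gl.ξ (faceNode a s d) := by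
  obtain ⟨i, b⟩ := a
  unfold facePt faceNode RefFace.sign
  funext d
  refine Fin.succAboveCases i ?_ (fun j => ?_) d
  · cases b <;> simp [gl.first, gl.last]
  · simp

/-! ### Matching discrete normals, sums over faces, summation by parts in an element. -/

namespace HexMesh

variable (M : HexMesh) {N : ℕ} (gl : GaussLobatto N)

theorem nodalX_match (f : Fin M.nI) (s : FaceNode N) :
    M.nodalX gl (M.left f).1 (faceNode (M.left f).2 s)
      = M.nodalX gl (M.right f).1 (faceNode (M.right f).2 ((M.orient f).node s)) := by
  have h := M.conform f (fun k => gl.ξ (s k))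
    ⟨fun k => (gl.mem_Icc (s k)).1, fun k => (gl.mem_Icc (s k)).2⟩
  rw [FaceOrient.pt_nodes, facePt_nodes, facePt_nodes] at h
  exact h

/-- The normal component of a curl differentiates only along the face, and the interpolated field
inside the curl is needed only in its tangential components. The area vector is therefore a function
of the node positions on the face alone, which is the point of the curl form. -/
theorem areaVec_eq (a : Fin M.nE × RefFace) (s : FaceNode N) (k : Fin 3) :
    M.areaVec gl a s k = -(RefFace.frameSign a.2 *
      gl.faceCurl (fun s => M.nodalX gl a.1 (faceNode a.2 s) (k + 2))
        (fun s => M.nodalX gl a.1 (faceNode a.2 s) (k + 1)) s) := by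
  obtain ⟨e, i, b⟩ := a
  have key : ∀ (j l : Fin 3) (p q : Fin 2), j = i.succAbove p → l = i.succAbove q →
      gl.dXi j (M.curlArg gl e k l) (faceNode (i, b) s)
        = gl.dFace p (fun s => M.nodalX gl e (faceNode (i, b) s) (k + 2) *
          gl.dFace q (fun s => M.nodalX gl e (faceNode (i, b) s) (k + 1)) s) s := by
    intro j l p q hj hl
    subst hj hl
    simp only [faceNode, gl.dXi_succAbove, curlArg, dCov]
  simp only [areaVec, dContra, Pi.smul_apply, smul_eq_mul, RefFace.frameSign,
    GaussLobatto.faceCurl]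
  fin_cases i
  · rw [key _ _ 0 1 (by decide) (by decide), key _ _ 1 0 (by decide) (by decide)]
    simp
    ring
  -- The tangential axes of direction `1` are cyclically `(2, 0)` but are listed increasingly as
  -- `(0, 2)`; the factor `(-1) ^ 1` in `frameSign` accounts for it.
  · rw [key _ _ 1 0 (by decide) (by decide), key _ _ 0 1 (by decide) (by decide)]
    simp
  · rw [key _ _ 0 1 (by decide) (by decide), key _ _ 1 0 (by decide) (by decide)]
    simp
    ring

/-- Both sides evaluate the same surface curl at the same points. The change of face coordinates
costs the determinant, and `M.opposite` turns this into a minus sign, so the discrete mesh has no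
gaps. -/
theorem areaVec_right (f : Fin M.nI) (s : FaceNode N) :
    M.areaVec gl (M.right f) ((M.orient f).node s) = -M.areaVec gl (M.left f) s := by
  funext k
  rw [Pi.neg_apply, areaVec_eq, areaVec_eq]
  simp only [nodalX_match]
  rw [(M.orient f).faceCurl_comp_node gl
    (fun s => M.nodalX gl (M.right f).1 (faceNode (M.right f).2 s) (k + 2))
    (fun s => M.nodalX gl (M.right f).1 (faceNode (M.right f).2 s) (k + 1)), ← mul_assoc]
  have h : RefFace.frameSign (M.left f).2 * (M.orient f).det
    = -RefFace.frameSign (M.right f).2 := M.opposite f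
  rw [h]
  ring

theorem faceJac_right (f : Fin M.nI) (s : FaceNode N) :
    M.faceJac gl (M.right f) ((M.orient f).node s) = M.faceJac gl (M.left f) s := by
  rw [faceJac, areaVec_right, vlen_neg, faceJac]

theorem normal_right (f : Fin M.nI) (s : FaceNode N) :
    M.normal gl (M.right f) ((M.orient f).node s) = -M.normal gl (M.left f) s := by
  rw [normal, faceJac_right, areaVec_right, smul_neg, normal]

theorem faceJac_smul_normal (a : Fin M.nE × RefFace) (s : FaceNode N) :
    M.faceJac gl a s • M.normal gl a s = M.areaVec gl a s := vlen_smul_inv_smul _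

theorem faceJac_nonneg (a : Fin M.nE × RefFace) (s : FaceNode N) : 0 ≤ M.faceJac gl a s :=
  vlen_nonneg _

theorem normal_dot_self (a : Fin M.nE × RefFace) (s : FaceNode N) (h : M.faceJac gl a s ≠ 0) :
    M.normal gl a s ⬝ᵥ M.normal gl a s = 1 := by
  unfold normal
  rw [smul_dotProduct, dotProduct_smul, ← vlen_mul_self, smul_eq_mul, smul_eq_mul]
  change (M.faceJac gl a s)⁻¹ * ((M.faceJac gl a s)⁻¹ * (M.faceJac gl a s * M.faceJac gl a s)) = 1
  field_simp

theorem onFace_left {α : Type} (f : Fin M.nI) (s : FaceNode N)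
    (inner : ℝ → Fin M.nI → FaceNode N → α) (bd : Fin M.nB → α) :
    M.onFace (M.left f) s inner bd = inner 1 f s := by
  simp [onFace, left]

theorem onFace_right {α : Type} (f : Fin M.nI) (s : FaceNode N)
    (inner : ℝ → Fin M.nI → FaceNode N → α) (bd : Fin M.nB → α) :
    M.onFace (M.right f) ((M.orient f).node s) inner bd = inner (-1) f s := by
  simp [onFace, right, FaceOrient.nodeInv_node]

theorem onFace_bdry {α : Type} (b : Fin M.nB) (s : FaceNode N)
    (inner : ℝ → Fin M.nI → FaceNode N → α) (bd : Fin M.nB → α) :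
    M.onFace (M.bdry b) s inner bd = bd b := by
  simp [onFace, bdry]

theorem sum_faces (g : Fin M.nE × RefFace → ℝ) :
    ∑ e, ∑ a, g (e, a) = ∑ f, (g (M.left f) + g (M.right f)) + ∑ b, g (M.bdry b) := by
  rw [← Fintype.sum_prod_type', ← Equiv.sum_comp M.faces, Fintype.sum_sum_type,
    Fintype.sum_sum_type, Finset.sum_add_distrib]
  rfl

/-- The surface terms of all elements, collected by faces. -/
theorem sum_surf (g : Fin M.nE × RefFace → FaceNode N → ℝ) :
    ∑ e, M.surf gl e (fun a s => g (e, a) s)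
      = ∑ f, gl.face (fun s => M.faceJac gl (M.left f) s *
          (g (M.left f) s + g (M.right f) ((M.orient f).node s)))
        + ∑ b, gl.face (fun s => M.faceJac gl (M.bdry b) s * g (M.bdry b) s) := by
  unfold surf
  rw [M.sum_faces (fun p => gl.face fun s => M.faceJac gl p s * g p s)]
  congr 1
  refine Finset.sum_congr rfl fun f _ => ?_
  rw [← (M.orient f).face_comp_node gl (fun s => M.faceJac gl (M.right f) s * g (M.right f) s),
    ← gl.face_add]
  simp only [faceJac_right, mul_add]

theorem surf_add (e : Fin M.nE) (g h : RefFace → FaceNode N → ℝ) :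
    M.surf gl e (fun a s => g a s + h a s) = M.surf gl e g + M.surf gl e h := by
  simp only [surf, mul_add, gl.face_add, Finset.sum_add_distrib]

theorem surf_const_mul (e : Fin M.nE) (c : ℝ) (g : RefFace → FaceNode N → ℝ) :
    M.surf gl e (fun a s => c * g a s) = c * M.surf gl e g := by
  simp only [surf, mul_left_comm _ c, gl.face_const_mul, Finset.mul_sum]

theorem surf_sum (e : Fin M.nE) {ι : Type*} (S : Finset ι) (g : ι → RefFace → FaceNode N → ℝ) :
    M.surf gl e (fun a s => ∑ i ∈ S, g i a s) = ∑ i ∈ S, M.surf gl e (g i) := by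
  classical
  induction S using Finset.induction_on with
  | empty => simp [surf, GaussLobatto.face]
  | insert i S hi ih => simp only [Finset.sum_insert hi, surf_add, ih]

/-- Summation by parts in an element. -/
theorem vol_by_parts (e : Fin M.nE) (g : Node N → ℝ) (F : Node N → Vec) :
    gl.vol (fun n => g n * ∑ d, gl.dXi d (fun n' => M.dContra gl e n' d ⬝ᵥ F n') n)
      + gl.vol (fun n => ∑ d, (M.dContra gl e n d ⬝ᵥ F n) * gl.dXi d g n)
      = M.surf gl e (fun a s => g (faceNode a s) * (F (faceNode a s) ⬝ᵥ M.normal gl (e, a) s)) := by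
  simp only [Finset.mul_sum, gl.vol_sum]
  rw [← Finset.sum_add_distrib]
  unfold surf
  rw [Fintype.sum_prod_type]
  refine Finset.sum_congr rfl fun d _ => ?_
  have h := gl.vol_by_parts d g (fun n => M.dContra gl e n d ⬝ᵥ F n)
  simp only [mul_comm (gl.dXi d g _)] at h
  rw [h]
  refine Finset.sum_congr rfl fun b _ => ?_
  rw [← gl.face_const_mul]
  congr 1
  funext s
  -- The boundary term carries `± 𝒥a^d`, which is the face Jacobian times the outward unit normal.
  have h1 := congrArg (fun v => F (faceNode (d, b) s) ⬝ᵥ v) (M.faceJac_smul_normal gl (e, (d, b)) s)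
  simp only [dotProduct_smul, areaVec, smul_eq_mul] at h1
  rw [dotProduct_comm (M.dContra gl e (faceNode (d, b) s) d)]
  linear_combination -g (faceNode (d, b) s) * h1

end HexMesh

/-! ### Entropy algebra of the pointwise inviscid fluxes. -/

namespace Params

variable (pr : Params)

theorem K_pos : 0 < pr.K :=
  mul_pos (lt_max_of_lt_left pr.ρ₁_pos) (pow_pos pr.c₀_pos 2)

theorem M₀_pos : 0 < pr.M₀ := div_pos pr.ε_pos (mul_pos pr.σ_pos pr.tCH_pos)

theorem s32_pos : 0 < pr.s32 := mul_pos (mul_pos (by norm_num) pr.σ_pos) pr.ε_pos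

theorem s32_eq : pr.s32 = 2 * pr.s34 := by unfold s32 s34; ring

/-- The entropy flux `∑ₖ W_k F_k · n`. -/
noncomputable def entFlux (q : PtState) (n : Vec) : ℝ := ∑ k, pr.W q k * (pr.fe q k ⬝ᵥ n)

/-- The compatibility `Wᵀ Φ_m = F_m` that makes the splitting skew-symmetric: tested with `W`, the
conservative and non-conservative terms become `∑ (W_k ∇·F_k + F_k·∇W_k)`, the two halves of a
product rule. The factor `K` in `Φ_m` cancels the `1/K` in the last entropy variable. -/
theorem sum_W_phi (q : PtState) (m : Fin 5) (v : Vec) :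
    ∑ k, pr.W q k * (v ⬝ᵥ pr.phi q m k) = v ⬝ᵥ pr.fe q m := by
  have hK := pr.K_pos.ne'
  fin_cases m <;>
    simp [Fin.sum_univ_five, Params.W, phi, fe, dotProduct, Fin.sum_univ_three, unitVec] <;>
    field_simp <;> ring

theorem sum_W_ncFlux (q : PtState) (n : Vec) :
    ∑ k, pr.W q k * pr.ncFlux q n k = pr.entFlux q n := by
  unfold ncFlux entFlux
  simp only [Finset.mul_sum]
  rw [Finset.sum_comm]
  refine Finset.sum_congr rfl fun m _ => ?_
  rw [dotProduct_comm, ← pr.sum_W_phi, Finset.mul_sum]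
  refine Finset.sum_congr rfl fun k _ => ?_
  rw [dotProduct_comm]
  ring

/-- Two different states are allowed because the wall flux pairs a state with its mirror image. -/
theorem sum_W_fe (q r : PtState) (n : Vec) :
    ∑ k, pr.W q k * (pr.fe r k ⬝ᵥ n) = q.μ * r.C * (r.U ⬝ᵥ n)
      + 1 / 2 * pr.rho r.C * (q.U ⬝ᵥ r.U) * (r.U ⬝ᵥ n) + r.P * (q.U ⬝ᵥ n) := by
  simp [Fin.sum_univ_five, Params.W, fe, dotProduct, Fin.sum_univ_three, unitVec]
  ring

theorem entFlux_eq (q : PtState) (n : Vec) :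
    pr.entFlux q n = q.μ * q.C * (q.U ⬝ᵥ n)
      + 1 / 2 * pr.rho q.C * (q.U ⬝ᵥ q.U) * (q.U ⬝ᵥ n) + q.P * (q.U ⬝ᵥ n) :=
  pr.sum_W_fe q q n

/-- The entropy flux of the inviscid interface terms, seen from the element with state `own`. -/
noncomputable def ifaceFlux (fl : InviscidFlux) (own L R : PtState) (n : Vec) : ℝ :=
  ∑ k, pr.W own k * (pr.numFlux fl L R n k + pr.diamondFlux fl own L R n k)

theorem sum_W_diamond_central (own L R : PtState) (n : Vec) :
    ∑ k, pr.W own k * pr.diamondFlux .central own L R n k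
      = ∑ k, (pr.fe own k ⬝ᵥ n) * ((pr.W L k + pr.W R k) / 2) := by
  simp only [diamondFlux, Finset.mul_sum]
  rw [Finset.sum_comm]
  refine Finset.sum_congr rfl fun m _ => ?_
  rw [dotProduct_comm, ← pr.sum_W_phi, Finset.sum_mul]
  refine Finset.sum_congr rfl fun k _ => ?_
  rw [dotProduct_comm]
  ring

/-- By `sum_W_phi` each side contributes `W_own·{F} + F_own·{W}`, and the difference of the two
sides is the discrete product rule `⟦W⟧·{F} + {W}·⟦F⟧ = ⟦W·F⟧`. -/
theorem central_balance (L R : PtState) (n : Vec) :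
    pr.ifaceFlux .central L L R n - pr.ifaceFlux .central R L R n
      = pr.entFlux L n - pr.entFlux R n := by
  unfold ifaceFlux entFlux
  simp only [mul_add, Finset.sum_add_distrib, sum_W_diamond_central]
  simp only [numFlux, ← Finset.sum_sub_distrib, ← Finset.sum_add_distrib]
  exact Finset.sum_congr rfl fun k _ => by ring

/-- Beyond the entropy flux there remain the mixed terms `W(q)·F(ghost) + W(ghost)·F(q)`, which
cancel since mirroring reverses only the normal velocity. -/
theorem central_wall (q : PtState) (n : Vec) (hn : n ⬝ᵥ n = 1) :
    pr.ifaceFlux .central q q (q.ghost n) n = pr.entFlux q n := by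
  have e : pr.ifaceFlux .central q q (q.ghost n) n
      = pr.entFlux q n + (∑ k, pr.W q k * (pr.fe (q.ghost n) k ⬝ᵥ n)
        + ∑ k, pr.W (q.ghost n) k * (pr.fe q k ⬝ᵥ n)) / 2 := by
    unfold ifaceFlux entFlux
    simp only [mul_add, Finset.sum_add_distrib, sum_W_diamond_central]
    simp only [numFlux, ← Finset.sum_add_distrib, Finset.sum_div]
    exact Finset.sum_congr rfl fun k _ => by ring
  rw [e, sum_W_fe, sum_W_fe]
  have h1 : (q.ghost n).U ⬝ᵥ n = -(q.U ⬝ᵥ n) := by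
    simp only [PtState.ghost, sub_dotProduct, smul_dotProduct, hn, smul_eq_mul]; ring
  simp only [h1, dotProduct_comm q.U (q.ghost n).U]
  simp only [PtState.ghost]
  ring

theorem ifaceFlux_ers (own L R : PtState) (n : Vec) :
    pr.ifaceFlux .ers own L R n
      = own.μ * ((L.C * (L.U ⬝ᵥ n) + R.C * (R.U ⬝ᵥ n)) / 2)
        + own.C * (own.U ⬝ᵥ n) * ((L.μ + R.μ) / 2)
        + pr.starP L R n * (own.U ⬝ᵥ n) + own.P * pr.starU L R n
        + pr.starRho L R n * pr.starU L R n * (pr.starVel L R n ⬝ᵥ own.U)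
        + 1 / 2 * pr.rho own.C * (own.U ⬝ᵥ n) * (own.U ⬝ᵥ own.U)
        - 1 / 2 * pr.starRho L R n * pr.starU L R n * (own.U ⬝ᵥ own.U) := by
  have hK := pr.K_pos.ne'
  simp only [ifaceFlux, numFlux, diamondFlux, Fin.sum_univ_five, Params.W]
  simp [dotProduct, Fin.sum_univ_three]
  field_simp
  ring

/-- Artificial compressibility is always subsonic: `λ⁺ > 0 > λ⁻`, so the denominators of the Riemann
solver do not vanish. -/
theorem abs_lt_wave (q : PtState) (n : Vec) (h : 0 < pr.rho q.C) :
    |q.U ⬝ᵥ n| < pr.wave q n := by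
  unfold wave
  rw [← Real.sqrt_sq_eq_abs]
  exact Real.sqrt_lt_sqrt (sq_nonneg _)
    (lt_add_of_pos_right _ (div_pos (mul_pos (by norm_num) pr.K_pos) h))

theorem lamP_pos (q : PtState) (n : Vec) (h : 0 < pr.rho q.C) : 0 < pr.lamP q n := by
  have := (abs_lt.1 (pr.abs_lt_wave q n h)).1
  unfold lamP; linarith

theorem lamM_neg (q : PtState) (n : Vec) (h : 0 < pr.rho q.C) : pr.lamM q n < 0 := by
  have := (abs_lt.1 (pr.abs_lt_wave q n h)).2
  unfold lamM; linarith

/-- The star velocity is exactly the one for which the pressure relations across the left and the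
right wave give the same star pressure. -/
theorem starP_eq_right (L R : PtState) (n : Vec) (hL : 0 < pr.rho L.C) (hR : 0 < pr.rho R.C) :
    pr.starP L R n = R.P + pr.rho R.C * pr.lamM R n * (R.U ⬝ᵥ n - pr.starU L R n) := by
  have h1 := mul_pos hL (pr.lamP_pos L n hL)
  have h2 := mul_neg_of_pos_of_neg hR (pr.lamM_neg R n hR)
  have h3 : pr.rho L.C * pr.lamP L n - pr.rho R.C * pr.lamM R n ≠ 0 := by linarith
  have h4 : pr.starU L R n * (pr.rho L.C * pr.lamP L n - pr.rho R.C * pr.lamM R n)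
    = L.P - R.P + pr.rho L.C * (L.U ⬝ᵥ n) * pr.lamP L n
      - pr.rho R.C * (R.U ⬝ᵥ n) * pr.lamM R n := by
    unfold starU
    rw [div_mul_cancel₀ _ h3]
  unfold starP
  linear_combination -h4

/-- `|v|²` splits into its normal and tangential parts. -/
theorem dot_split (v n : Vec) (hn : n ⬝ᵥ n = 1) :
    v ⬝ᵥ v = (v ⬝ᵥ n) ^ 2 + (v - (v ⬝ᵥ n) • n) ⬝ᵥ (v - (v ⬝ᵥ n) • n) := by
  simp only [sub_dotProduct, dotProduct_sub, smul_dotProduct, dotProduct_smul, smul_eq_mul, hn]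
  rw [dotProduct_comm n v]
  ring

theorem dot_self_nonneg (v : Vec) : 0 ≤ v ⬝ᵥ v := by
  simp only [dotProduct]; exact Finset.sum_nonneg fun i _ => mul_self_nonneg _

/-- With `A = ρ_L λ_L⁺ > 0`, `B = ρ_R λ_R⁻ < 0`, `u = U_n^⋆` and `g = ρ^⋆ u`, the entropy produced
is `(A - g/2)(U_nL - u)² + (g/2 - B)(U_nR - u)² + |g|/2 · |t_R - t_L|²`, where `t` is the tangential
velocity. The coefficients are nonnegative because `B ≤ g ≤ A`, and upwinding of the tangential part
gives the last term its sign. -/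
theorem ers_dissipation (L R : PtState) (n : Vec) (hn : n ⬝ᵥ n = 1) (hL : 0 < pr.rho L.C)
    (hR : 0 < pr.rho R.C) :
    pr.entFlux L n - pr.entFlux R n ≤ pr.ifaceFlux .ers L L R n - pr.ifaceFlux .ers R L R n := by
  rw [entFlux_eq, entFlux_eq, ifaceFlux_ers, ifaceFlux_ers]
  have hP := pr.starP_eq_right L R n hL hR
  have hPL : pr.starP L R n = L.P + pr.rho L.C * pr.lamP L n * (L.U ⬝ᵥ n - pr.starU L R n) := rfl
  have hlL := mul_pos hL (pr.lamP_pos L n hL)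
  have hlR := mul_neg_of_pos_of_neg hR (pr.lamM_neg R n hR)
  have hmL := pr.lamM_neg L n hL
  have hpR := pr.lamP_pos R n hR
  set u := pr.starU L R n with hu
  set A := pr.rho L.C * pr.lamP L n with hA
  set B := pr.rho R.C * pr.lamM R n with hB
  set g := pr.starRho L R n * u with hg
  set V := pr.starVel L R n with hV
  set Ps := pr.starP L R n
  -- Both pressures are expressed through the star pressure, so that only velocity differences to
  -- the star state remain.
  have hLPs : L.P = Ps - A * (L.U ⬝ᵥ n - u) := by linarith
  have hRPs : R.P = Ps - B * (R.U ⬝ᵥ n - u) := by linarith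
  set tL := L.U - (L.U ⬝ᵥ n) • n with htL
  set tR := R.U - (R.U ⬝ᵥ n) • n with htR
  have sL := dot_split L.U n hn
  have sR := dot_split R.U n hn
  have tnL : tL ⬝ᵥ n = 0 := by
    rw [htL, sub_dotProduct, smul_dotProduct, hn]; simp
  have tnR : tR ⬝ᵥ n = 0 := by
    rw [htR, sub_dotProduct, smul_dotProduct, hn]; simp
  have eL : L.U = (L.U ⬝ᵥ n) • n + tL := by rw [htL]; abel
  have eR : R.U = (R.U ⬝ᵥ n) • n + tR := by rw [htR]; abel
  have hVdot : ∀ (a b : ℝ) (s t : Vec), s ⬝ᵥ n = 0 → t ⬝ᵥ n = 0 →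
      (a • n + s) ⬝ᵥ (b • n + t) = a * b + s ⬝ᵥ t := by
    intro a b s t hs ht
    simp only [add_dotProduct, dotProduct_add, smul_dotProduct, dotProduct_smul, smul_eq_mul, hn,
      hs, dotProduct_comm n t, ht]
    ring
  have hJ : 0 ≤ (tR - tL) ⬝ᵥ (tR - tL) := dot_self_nonneg _
  have hJ' : (tR - tL) ⬝ᵥ (tR - tL) = tR ⬝ᵥ tR - 2 * (tL ⬝ᵥ tR) + tL ⬝ᵥ tL := by
    simp only [sub_dotProduct, dotProduct_sub, dotProduct_comm tR tL]; ring
  by_cases h0 : 0 ≤ u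
  · have eV : V = u • n + tL := by
      rw [hV, starVel, if_pos h0]
    -- The star density with its denominator cleared; as `λ_L⁻ < 0 ≤ u` it yields `0 ≤ g ≤ A`.
    have hgv : g * (u - pr.lamM L n) = A * u := by
      have : u - pr.lamM L n ≠ 0 := by linarith
      rw [hg, starRho, if_pos h0, ← hu, ← hA]
      field_simp
    have hg0 : 0 ≤ g := by
      have : 0 ≤ g * (u - pr.lamM L n) := hgv ▸ mul_nonneg hlL.le h0
      exact nonneg_of_mul_nonneg_left this (by linarith)
    have hgA : g ≤ A := by
      nlinarith
    have d1 : V ⬝ᵥ L.U = u * (L.U ⬝ᵥ n) + tL ⬝ᵥ tL := by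
      rw [eV]; nth_rw 1 [eL]; exact hVdot _ _ _ _ tnL tnL
    have d2 : V ⬝ᵥ R.U = u * (R.U ⬝ᵥ n) + tL ⬝ᵥ tR := by
      rw [eV]; nth_rw 1 [eR]; exact hVdot _ _ _ _ tnL tnR
    have a1 := mul_nonneg (by linarith : 0 ≤ A - g / 2) (sq_nonneg (L.U ⬝ᵥ n - u))
    have a2 := mul_nonneg (by linarith : 0 ≤ -B + g / 2) (sq_nonneg (R.U ⬝ᵥ n - u))
    have a3 := mul_nonneg hg0 hJ
    rw [d1, d2, sL, sR, hLPs, hRPs]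
    rw [hJ'] at a3
    linear_combination a1 + a2 + a3 / 2
  -- The mirrored case: the star density is taken from the right, and `B ≤ g ≤ 0`.
  · have eV : V = u • n + tR := by
      rw [hV, starVel, if_neg h0]
    push Not at h0
    have hgv : g * (u - pr.lamP R n) = B * u := by
      have : u - pr.lamP R n ≠ 0 := by linarith
      rw [hg, starRho, if_neg h0.not_ge, ← hu, ← hB]
      field_simp
    have hg0 : g ≤ 0 := by
      by_contra! h
      nlinarith [mul_pos_of_neg_of_neg hlR h0]
    have hgB : B ≤ g := by
      nlinarith
    have d1 : V ⬝ᵥ L.U = u * (L.U ⬝ᵥ n) + tR ⬝ᵥ tL := by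
      rw [eV]; nth_rw 1 [eL]; exact hVdot _ _ _ _ tnR tnL
    have d2 : V ⬝ᵥ R.U = u * (R.U ⬝ᵥ n) + tR ⬝ᵥ tR := by
      rw [eV]; nth_rw 1 [eR]; exact hVdot _ _ _ _ tnR tnR
    have a1 := mul_nonneg (by linarith : 0 ≤ A - g / 2) (sq_nonneg (L.U ⬝ᵥ n - u))
    have a2 := mul_nonneg (by linarith : 0 ≤ -B + g / 2) (sq_nonneg (R.U ⬝ᵥ n - u))
    have a3 := mul_nonneg (neg_nonneg.2 hg0) hJ
    rw [d1, d2, sL, sR, hLPs, hRPs]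
    rw [hJ'] at a3
    rw [dotProduct_comm tR tL]
    linear_combination a1 + a2 + a3 / 2

/-- For the mirrored state `λ⁻(ghost) = -λ⁺(q)`, so the star velocity is zero and the star pressure
is `P + ρ λ⁺ U_n`. The entropy produced is `ρ λ⁺ U_n²`. -/
theorem ers_wall (q : PtState) (n : Vec) (hn : n ⬝ᵥ n = 1) (h : 0 < pr.rho q.C) :
    pr.entFlux q n ≤ pr.ifaceFlux .ers q q (q.ghost n) n := by
  have hl := mul_pos h (pr.lamP_pos q n h)
  have hgn : (q.ghost n).U ⬝ᵥ n = -(q.U ⬝ᵥ n) := by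
    simp only [PtState.ghost, sub_dotProduct, smul_dotProduct, hn, smul_eq_mul]; ring
  have hw : pr.lamM (q.ghost n) n = -pr.lamP q n := by
    unfold lamM lamP wave
    rw [hgn]
    simp only [PtState.ghost]
    rw [neg_sq]; ring
  have hC : (q.ghost n).C = q.C := rfl
  have hP : (q.ghost n).P = q.P := rfl
  have hU : pr.starU q (q.ghost n) n = 0 := by
    unfold starU
    rw [hgn, hw, hC, hP]
    simp
  rw [entFlux_eq, ifaceFlux_ers, hU, starP, hU, hgn, hC]
  have hμ : (q.ghost n).μ = q.μ := rfl
  rw [hμ]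
  nlinarith [mul_nonneg hl.le (sq_nonneg (q.U ⬝ᵥ n))]

end Params

/-! ### Time derivatives of nodal quantities. -/

open Filter Topology

theorem Params.differentiable_f0 (pr : Params) : Differentiable ℝ pr.f0 := by
  unfold Params.f0; fun_prop

theorem hasDerivAt_dotProduct {ι : Type*} [Fintype ι] {f g : ℝ → ι → ℝ} {f' g' : ι → ℝ} {t : ℝ}
    (hf : HasDerivAt f f' t) (hg : HasDerivAt g g' t) :
    HasDerivAt (fun s => f s ⬝ᵥ g s) (f' ⬝ᵥ g t + f t ⬝ᵥ g') t := by
  rw [hasDerivAt_pi] at hf hg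
  simp only [dotProduct, ← Finset.sum_add_distrib]
  exact HasDerivAt.fun_sum fun i _ => (hf i).mul (hg i)

section TimeDerivatives

variable {N : ℕ} (gl : GaussLobatto N) {t : ℝ}

theorem GaussLobatto.hasDerivAt_vol {F : ℝ → Node N → ℝ} {F' : Node N → ℝ}
    (h : ∀ n, HasDerivAt (fun s => F s n) (F' n) t) :
    HasDerivAt (fun s => gl.vol (F s)) (gl.vol F') t :=
  HasDerivAt.fun_sum fun n _ => (h n).const_mul _

theorem GaussLobatto.hasDerivAt_face {F : ℝ → FaceNode N → ℝ} {F' : FaceNode N → ℝ}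
    (h : ∀ n, HasDerivAt (fun s => F s n) (F' n) t) :
    HasDerivAt (fun s => gl.face (F s)) (gl.face F') t :=
  HasDerivAt.fun_sum fun n _ => (h n).const_mul _

theorem GaussLobatto.hasDerivAt_dXi {F : ℝ → Node N → ℝ} {F' : Node N → ℝ} (d : Fin 3)
    (h : ∀ n, HasDerivAt (fun s => F s n) (F' n) t) (n : Node N) :
    HasDerivAt (fun s => gl.dXi d (F s) n) (gl.dXi d F' n) t :=
  HasDerivAt.fun_sum fun _ _ => (h _).const_mul _

namespace HexMesh

variable (M : HexMesh)

theorem hasDerivAt_surf (e : Fin M.nE) {F : ℝ → RefFace → FaceNode N → ℝ}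
    {F' : RefFace → FaceNode N → ℝ} (h : ∀ a n, HasDerivAt (fun s => F s a n) (F' a n) t) :
    HasDerivAt (fun s => M.surf gl e (F s)) (M.surf gl e F') t :=
  HasDerivAt.fun_sum fun a _ => gl.hasDerivAt_face fun n => (h a n).const_mul _

variable {M}

theorem hasDerivAt_aver {g : ℝ → Fin M.nE → Node N → ℝ} {g' : Fin M.nE → Node N → ℝ}
    (h : ∀ e n, HasDerivAt (fun s => g s e n) (g' e n) t) (f : Fin M.nI) (x : FaceNode N) :
    HasDerivAt (fun s => aver (g s) f x) (aver g' f x) t :=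
  ((h _ _).add (h _ _)).div_const _

theorem hasDerivAt_jump {g : ℝ → Fin M.nE → Node N → ℝ} {g' : Fin M.nE → Node N → ℝ}
    (h : ∀ e n, HasDerivAt (fun s => g s e n) (g' e n) t) (f : Fin M.nI) (x : FaceNode N) :
    HasDerivAt (fun s => jump (g s) f x) (jump g' f x) t :=
  (h _ _).sub (h _ _)

theorem hasDerivAt_starAver {g : ℝ → Fin M.nE → Node N → ℝ} {g' : Fin M.nE → Node N → ℝ}
    (h : ∀ e n, HasDerivAt (fun s => g s e n) (g' e n) t) (a : Fin M.nE × RefFace)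
    (x : FaceNode N) :
    HasDerivAt (fun s => starAver (g s) a x) (starAver g' a x) t := by
  unfold starAver onFace
  split
  · exact hasDerivAt_aver h _ _
  · exact hasDerivAt_aver h _ _
  · exact h _ _

/-- Discrete gradients inherit differentiability in time, and the time derivative of the
gradient is the gradient of the time derivative. -/
theorem hasDerivAt_gradient (hJ : ∀ e n, 0 < M.dJac gl e n)
    {g : ℝ → Fin M.nE → Node N → ℝ} {g' : Fin M.nE → Node N → ℝ}
    {G : ℝ → Fin M.nE → Node N → Vec}
    (h : ∀ e n, HasDerivAt (fun s => g s e n) (g' e n) t)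
    (hG : ∀ᶠ s in 𝓝 t, ∀ e, M.IsDGGradient gl e (g s e) (fun a x => starAver (g s) (e, a) x) (G s e)) :
    (∀ e n, HasDerivAt (fun s => G s e n) (deriv (fun s => G s e n) t) t) ∧
      ∀ e, M.IsDGGradient gl e (g' e) (fun a x => starAver g' (e, a) x)
        (fun n => deriv (fun s => G s e n) t) := by
  -- The right side of the gradient equation is linear in the nodal values of `g` with coefficients
  -- constant in time. No differentiability of `G` is assumed; it is recovered from this side.
  have hR : ∀ e (φ : Node N → Vec), HasDerivAt (fun s =>
      M.surf gl e (fun a x => (starAver (g s) (e, a) x - g s e (faceNode a x)) *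
        (φ (faceNode a x) ⬝ᵥ M.normal gl (e, a) x))
      + gl.vol (fun n => ∑ d, (M.dContra gl e n d ⬝ᵥ φ n) * gl.dXi d (g s e) n))
      (M.surf gl e (fun a x => (starAver g' (e, a) x - g' e (faceNode a x)) *
        (φ (faceNode a x) ⬝ᵥ M.normal gl (e, a) x))
      + gl.vol (fun n => ∑ d, (M.dContra gl e n d ⬝ᵥ φ n) * gl.dXi d (g' e) n)) t := by
    intro e φ
    refine HasDerivAt.add (M.hasDerivAt_surf gl e fun a x => ?_) (gl.hasDerivAt_vol fun n => ?_)
    · exact ((hasDerivAt_starAver h _ _).sub (h _ _)).mul_const _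
    · exact HasDerivAt.fun_sum fun d _ => (gl.hasDerivAt_dXi d (h e) n).const_mul _
  have hL : ∀ e (φ : Node N → Vec), HasDerivAt
      (fun s => gl.vol (fun n => M.dJac gl e n * (G s e n ⬝ᵥ φ n)))
      (M.surf gl e (fun a x => (starAver g' (e, a) x - g' e (faceNode a x)) *
        (φ (faceNode a x) ⬝ᵥ M.normal gl (e, a) x))
      + gl.vol (fun n => ∑ d, (M.dContra gl e n d ⬝ᵥ φ n) * gl.dXi d (g' e) n)) t := by
    intro e φ
    refine (hR e φ).congr_of_eventuallyEq ?_
    filter_upwards [hG] with s hs using hs e φ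
  have hd : ∀ e n, HasDerivAt (fun s => G s e n) (deriv (fun s => G s e n) t) t := by
    intro e n
    refine DifferentiableAt.hasDerivAt ?_
    rw [differentiableAt_pi]
    intro k
    -- Collocation makes the mass matrix diagonal: a test field concentrated at one node and one
    -- component isolates a single value of `G`, multiplied by the nonzero weight times Jacobian.
    have h1 := (hL e (Pi.single n (unitVec k))).differentiableAt
    have h2 : (fun s => G s e n k) = fun s => ((∏ d, gl.w (n d)) * M.dJac gl e n)⁻¹ *
        gl.vol (fun n' => M.dJac gl e n' *
          (G s e n' ⬝ᵥ (Pi.single n (unitVec k) : Node N → Vec) n')) := by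
      funext s
      have h3 : (∏ d, gl.w (n d)) * M.dJac gl e n ≠ 0 :=
        mul_ne_zero (Finset.prod_ne_zero_iff.2 fun d _ => (gl.w_pos _).ne') (hJ e n).ne'
      rw [GaussLobatto.vol, Finset.sum_eq_single n]
      · simp only [Pi.single_eq_same, unitVec, dotProduct_single, mul_one]
        rw [← mul_assoc (∏ d, gl.w (n d)), inv_mul_cancel_left₀ h3]
      · intro n' _ hn'
        rw [Pi.single_eq_of_ne hn']
        simp
      · simp
    rw [h2]
    exact h1.const_mul _
  refine ⟨hd, fun e φ => ?_⟩
  refine HasDerivAt.unique (gl.hasDerivAt_vol fun n => ?_) (hL e φ)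
  have := (hasDerivAt_dotProduct (hd e n) (hasDerivAt_const t (φ n))).const_mul (M.dJac gl e n)
  simpa using this

end HexMesh

end TimeDerivatives

/-! ### Weak divergences summed over the mesh. -/

namespace HexMesh

variable (M : HexMesh) {N : ℕ} (gl : GaussLobatto N)

/-- With averages for both the scalar and the flux, the Bassi-Rebay terms of the two sides cancel;
only the penalty `p`, paired with the jump, survives. -/
theorem averN_balance (g : Fin M.nE → Node N → ℝ) (V : Fin M.nE → Node N → Vec) (f : Fin M.nI)
    (s : FaceNode N) (p : ℝ) :
    ((aver g f s - trL g f s) * (trL V f s ⬝ᵥ M.normal gl (M.left f) s)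
        + trL g f s * (averN gl V f s + p))
      + ((aver g f s - trR g f s) * (trR V f s ⬝ᵥ -M.normal gl (M.left f) s)
        + trR g f s * -(averN gl V f s + p)) = -(jump g f s * p) := by
  simp only [aver, averN, jump, smul_dotProduct, add_dotProduct, dotProduct_neg, smul_eq_mul]
  ring

/-- The weak divergence of a field with averaged interface values, tested with a scalar field
whose gradient uses averaged interface values. -/
theorem sum_weak_divergence (g : Fin M.nE → Node N → ℝ) (G V : Fin M.nE → Node N → Vec)
    (gs vs : Fin M.nE × RefFace → FaceNode N → ℝ) (p : Fin M.nI → FaceNode N → ℝ)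
    (q : Fin M.nB → FaceNode N → ℝ)
    (hG : ∀ e, M.IsDGGradient gl e (g e) (fun a s => gs (e, a) s) (G e))
    (hgL : ∀ f s, gs (M.left f) s = aver g f s)
    (hgR : ∀ f s, gs (M.right f) ((M.orient f).node s) = aver g f s)
    (hvL : ∀ f s, vs (M.left f) s = averN gl V f s + p f s)
    (hvR : ∀ f s, vs (M.right f) ((M.orient f).node s) = -(averN gl V f s + p f s))
    (hb : ∀ b s, (gs (M.bdry b) s - trOwn g (M.bdry b) s) *
        (trOwn V (M.bdry b) s ⬝ᵥ M.normal gl (M.bdry b) s)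
        + trOwn g (M.bdry b) s * vs (M.bdry b) s = q b s) :
    ∑ e, (M.surf gl e (fun a s => g e (faceNode a s) * vs (e, a) s)
        - gl.vol (fun n => ∑ d, (M.dContra gl e n d ⬝ᵥ V e n) * gl.dXi d (g e) n))
      = -∑ e, gl.vol (fun n => M.dJac gl e n * (G e n ⬝ᵥ V e n))
        - ∑ f, gl.face (fun s => M.faceJac gl (M.left f) s * (jump g f s * p f s))
        + ∑ b, gl.face (fun s => M.faceJac gl (M.bdry b) s * q b s) := by
  have h1 : ∑ e, M.surf gl e (fun a s =>
      (gs (e, a) s - trOwn g (e, a) s) * (trOwn V (e, a) s ⬝ᵥ M.normal gl (e, a) s)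
        + trOwn g (e, a) s * vs (e, a) s)
      = - ∑ f, gl.face (fun s => M.faceJac gl (M.left f) s * (jump g f s * p f s))
        + ∑ b, gl.face (fun s => M.faceJac gl (M.bdry b) s * q b s) := by
    rw [M.sum_surf gl fun a s => (gs a s - trOwn g a s) * (trOwn V a s ⬝ᵥ M.normal gl a s)
        + trOwn g a s * vs a s]
    congr 1
    · rw [← Finset.sum_neg_distrib]
      refine Finset.sum_congr rfl fun f _ => ?_
      rw [← neg_one_mul, ← gl.face_const_mul]
      congr 1
      funext s
      have := M.averN_balance gl g V f s (p f s)
      rw [hgL, hgR, hvL, hvR, normal_right]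
      change _ * (_ + (_ * (trR V f s ⬝ᵥ _) + trR g f s * _)) = _
      change M.faceJac gl (M.left f) s * (((aver g f s - trL g f s) *
        (trL V f s ⬝ᵥ M.normal gl (M.left f) s) + trL g f s * (averN gl V f s + p f s))
        + ((aver g f s - trR g f s) * (trR V f s ⬝ᵥ -M.normal gl (M.left f) s)
        + trR g f s * -(averN gl V f s + p f s))) = _
      rw [this]
      ring
    · simp only [hb]
  simp only [surf_add, Finset.sum_add_distrib] at h1
  -- The gradient equation is tested with the flux field itself, which eliminates the volume term of
  -- the weak divergence.
  have h2 : ∀ e, gl.vol (fun n => M.dJac gl e n * (G e n ⬝ᵥ V e n)) = _ := fun e => hG e (V e)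
  simp only [trOwn] at h1
  rw [Finset.sum_sub_distrib]
  simp only [h2, Finset.sum_add_distrib]
  linarith

end HexMesh

/-! ### Entropy production of the inviscid terms. -/

section Balance

variable (pr : Params) (M : HexMesh) {N : ℕ} (gl : GaussLobatto N)

/-- The viscous stress is symmetric, so it sees only the symmetric part of the velocity gradient. -/
theorem sum_fv_dot (C : ℝ) (G : Fin 5 → Vec) :
    ∑ k, G k ⬝ᵥ pr.fv C G k
      = pr.M₀ * (G 0 ⬝ᵥ G 0) + 2 * pr.visc C * strainSq (fun i => G (momIdx i)) := by
  have e1 : momIdx 0 = 1 := rfl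
  have e2 : momIdx 1 = 2 := rfl
  have e3 : momIdx 2 = 3 := rfl
  simp [Fin.sum_univ_five, Params.fv, strainSq, dotProduct, Fin.sum_univ_three, strain, e1, e2, e3]
  ring

variable {M}

theorem trOwn_left {α : Type} (g : Fin M.nE → Node N → α) (f : Fin M.nI) (s : FaceNode N) :
    HexMesh.trOwn g (M.left f) s = HexMesh.trL g f s := rfl

theorem trOwn_right {α : Type} (g : Fin M.nE → Node N → α) (f : Fin M.nI) (s : FaceNode N) :
    HexMesh.trOwn g (M.right f) ((M.orient f).node s) = HexMesh.trR g f s := rfl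

/-- The entropy production of the inviscid interface terms at an interior face node. -/
noncomputable def ifaceProd (fl : InviscidFlux) (Y : DGFields M N) (f : Fin M.nI)
    (s : FaceNode N) : ℝ :=
  let L := HexMesh.trL (Y.state pr) f s
  let R := HexMesh.trR (Y.state pr) f s
  let n := M.normal gl (M.left f) s
  pr.ifaceFlux fl L L R n - pr.ifaceFlux fl R L R n - (pr.entFlux L n - pr.entFlux R n)

/-- The entropy production of the inviscid terms at a wall node. -/
noncomputable def wallProd (fl : InviscidFlux) (Y : DGFields M N) (b : Fin M.nB)
    (s : FaceNode N) : ℝ :=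
  let q := HexMesh.trOwn (Y.state pr) (M.bdry b) s
  let n := M.normal gl (M.bdry b) s
  pr.ifaceFlux fl q q (q.ghost n) n - pr.entFlux q n

/-- The total entropy production of the inviscid terms. -/
noncomputable def inviscidProd (fl : InviscidFlux) (Y : DGFields M N) : ℝ :=
  ∑ f, gl.face (fun s => M.faceJac gl (M.left f) s * ifaceProd pr gl fl Y f s)
    + ∑ b, gl.face (fun s => M.faceJac gl (M.bdry b) s * wallProd pr gl fl Y b s)

/-- Where the discrete face Jacobian vanishes the normal is not a unit vector and the flux
inequalities are not available, but such a node has no weight. -/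
theorem mul_nonneg_of_ne {a b : ℝ} (ha : 0 ≤ a) (h : a ≠ 0 → 0 ≤ b) : 0 ≤ a * b := by
  by_cases h0 : a = 0
  · simp [h0]
  · exact mul_nonneg ha (h h0)

theorem inviscidProd_nonneg (fl : InviscidFlux) (Y : DGFields M N)
    (hρ : ∀ e n, 0 < pr.rho (Y.C e n)) : 0 ≤ inviscidProd pr gl fl Y := by
  refine add_nonneg (Finset.sum_nonneg fun f _ => gl.face_nonneg fun s => ?_)
    (Finset.sum_nonneg fun b _ => gl.face_nonneg fun s => ?_)
  · refine mul_nonneg_of_ne (M.faceJac_nonneg gl _ _) fun h => ?_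
    have hn := M.normal_dot_self gl _ _ h
    dsimp only [ifaceProd]
    cases fl
    · rw [pr.central_balance, sub_self]
    · exact sub_nonneg.2 (pr.ers_dissipation _ _ _ hn (hρ _ _) (hρ _ _))
  · refine mul_nonneg_of_ne (M.faceJac_nonneg gl _ _) fun h => ?_
    have hn := M.normal_dot_self gl _ _ h
    dsimp only [wallProd]
    cases fl
    · rw [pr.central_wall _ _ hn, sub_self]
    · exact sub_nonneg.2 (pr.ers_wall _ _ hn (hρ _ _))

theorem inviscidProd_central (Y : DGFields M N) : inviscidProd pr gl .central Y = 0 := by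
  have h1 : ∀ f s, ifaceProd pr gl .central Y f s = 0 := fun f s => by
    dsimp only [ifaceProd]; rw [pr.central_balance, sub_self]
  have h2 : ∀ b s, M.faceJac gl (M.bdry b) s * wallProd pr gl .central Y b s = 0 := fun b s => by
    by_cases h : M.faceJac gl (M.bdry b) s = 0
    · rw [h, zero_mul]
    · dsimp only [wallProd]
      rw [pr.central_wall _ _ (M.normal_dot_self gl _ _ h), sub_self, mul_zero]
  simp [inviscidProd, h1, h2, GaussLobatto.face]

theorem dotProduct_fe_eq (Y : DGFields M N) (e : Fin M.nE) (m : Fin 5) (n : Node N) (v : Vec) :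
    ∑ k, Y.Wn pr k e n * (v ⬝ᵥ pr.phi (Y.state pr e n) m k) = v ⬝ᵥ pr.fe (Y.state pr e n) m :=
  pr.sum_W_phi _ _ _

/-- The inviscid terms of the scheme, tested with the entropy variables. -/
theorem inviscid_balance (fl : InviscidFlux) (Y : DGFields M N) :
    ∑ e, (M.surf gl e (fun a s => ∑ k, Y.Wn pr k e (faceNode a s) *
        (Y.FeStar pr gl fl k (e, a) s
          - pr.fe (Y.state pr e (faceNode a s)) k ⬝ᵥ M.normal gl (e, a) s
          - pr.ncFlux (Y.state pr e (faceNode a s)) (M.normal gl (e, a) s) k))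
    + gl.vol (fun n => ∑ k, Y.Wn pr k e n * ∑ d,
        gl.dXi d (fun n' => M.dContra gl e n' d ⬝ᵥ pr.fe (Y.state pr e n') k) n)
    + gl.vol (fun n => ∑ k, Y.Wn pr k e n * ∑ m, ∑ d,
        (M.dContra gl e n d ⬝ᵥ pr.phi (Y.state pr e n) m k) * gl.dXi d (Y.Wn pr m e) n))
    = inviscidProd pr gl fl Y := by
  -- By `sum_W_phi` the non-conservative term is exactly what summation by parts of the conservative
  -- one requires, so the volume terms equal the entropy flux through the element surface.
  have hvol : ∀ e, gl.vol (fun n => ∑ k, Y.Wn pr k e n * ∑ d,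
        gl.dXi d (fun n' => M.dContra gl e n' d ⬝ᵥ pr.fe (Y.state pr e n') k) n)
    + gl.vol (fun n => ∑ k, Y.Wn pr k e n * ∑ m, ∑ d,
        (M.dContra gl e n d ⬝ᵥ pr.phi (Y.state pr e n) m k) * gl.dXi d (Y.Wn pr m e) n)
      = M.surf gl e (fun a s => pr.entFlux (Y.state pr e (faceNode a s)) (M.normal gl (e, a) s)) := by
    intro e
    have h1 : (fun n => ∑ k, Y.Wn pr k e n * ∑ m, ∑ d,
        (M.dContra gl e n d ⬝ᵥ pr.phi (Y.state pr e n) m k) * gl.dXi d (Y.Wn pr m e) n)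
        = fun n => ∑ k, ∑ d, (M.dContra gl e n d ⬝ᵥ pr.fe (Y.state pr e n) k) *
          gl.dXi d (Y.Wn pr k e) n := by
      funext n
      simp only [Finset.mul_sum]
      rw [Finset.sum_comm]
      refine Finset.sum_congr rfl fun m _ => ?_
      rw [Finset.sum_comm]
      refine Finset.sum_congr rfl fun d _ => ?_
      rw [← dotProduct_fe_eq, Finset.sum_mul]
      exact Finset.sum_congr rfl fun k _ => by ring
    rw [h1, gl.vol_sum, gl.vol_sum, ← Finset.sum_add_distrib]
    simp only [Params.entFlux]
    rw [M.surf_sum]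
    refine Finset.sum_congr rfl fun k _ => ?_
    exact M.vol_by_parts gl e (Y.Wn pr k e) (fun n => pr.fe (Y.state pr e n) k)
  -- The subtracted own flux and the subtracted own non-conservative term each give one entropy
  -- flux; the volume terms restore one of the two.
  have hsurf : ∀ e, M.surf gl e (fun a s => ∑ k, Y.Wn pr k e (faceNode a s) *
        (Y.FeStar pr gl fl k (e, a) s
          - pr.fe (Y.state pr e (faceNode a s)) k ⬝ᵥ M.normal gl (e, a) s
          - pr.ncFlux (Y.state pr e (faceNode a s)) (M.normal gl (e, a) s) k))
      + M.surf gl e (fun a s => pr.entFlux (Y.state pr e (faceNode a s)) (M.normal gl (e, a) s))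
      = M.surf gl e (fun a s => ∑ k, HexMesh.trOwn (Y.Wn pr k) (e, a) s *
          Y.FeStar pr gl fl k (e, a) s
          - pr.entFlux (HexMesh.trOwn (Y.state pr) (e, a) s) (M.normal gl (e, a) s)) := by
    intro e
    rw [← M.surf_add]
    congr 1
    funext a s
    have h2 := pr.sum_W_ncFlux (Y.state pr e (faceNode a s)) (M.normal gl (e, a) s)
    have h3 : ∑ k, Y.Wn pr k e (faceNode a s) * (pr.fe (Y.state pr e (faceNode a s)) k ⬝ᵥ
      M.normal gl (e, a) s) = pr.entFlux (Y.state pr e (faceNode a s)) (M.normal gl (e, a) s) := rfl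
    simp only [mul_sub, Finset.sum_sub_distrib, h3]
    change _ - _ - (∑ k, pr.W (Y.state pr e (faceNode a s)) k * _) + _ = _
    rw [h2]
    simp only [HexMesh.trOwn]
    ring
  have e1 : ∀ e, (M.surf gl e (fun a s => ∑ k, Y.Wn pr k e (faceNode a s) *
        (Y.FeStar pr gl fl k (e, a) s
          - pr.fe (Y.state pr e (faceNode a s)) k ⬝ᵥ M.normal gl (e, a) s
          - pr.ncFlux (Y.state pr e (faceNode a s)) (M.normal gl (e, a) s) k))
    + gl.vol (fun n => ∑ k, Y.Wn pr k e n * ∑ d,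
        gl.dXi d (fun n' => M.dContra gl e n' d ⬝ᵥ pr.fe (Y.state pr e n') k) n)
    + gl.vol (fun n => ∑ k, Y.Wn pr k e n * ∑ m, ∑ d,
        (M.dContra gl e n d ⬝ᵥ pr.phi (Y.state pr e n) m k) * gl.dXi d (Y.Wn pr m e) n))
      = M.surf gl e (fun a s => ∑ k, HexMesh.trOwn (Y.Wn pr k) (e, a) s *
          Y.FeStar pr gl fl k (e, a) s
          - pr.entFlux (HexMesh.trOwn (Y.state pr) (e, a) s) (M.normal gl (e, a) s)) := by
    intro e
    rw [add_assoc, hvol, hsurf]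
  simp only [e1]
  rw [M.sum_surf gl fun a s => ∑ k, HexMesh.trOwn (Y.Wn pr k) a s * Y.FeStar pr gl fl k a s
    - pr.entFlux (HexMesh.trOwn (Y.state pr) a s) (M.normal gl a s)]
  unfold inviscidProd
  congr 1
  · refine Finset.sum_congr rfl fun f _ => ?_
    congr 1
    funext s
    congr 1
    simp only [DGFields.FeStar, M.onFace_left, M.onFace_right, HexMesh.normal_right, trOwn_left,
      trOwn_right, ifaceProd]
    have hneg : ∀ q n, pr.entFlux q (-n) = -pr.entFlux q n := fun q n => by
      simp [Params.entFlux]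
    rw [hneg]
    have hL : ∀ k, HexMesh.trL (Y.Wn pr k) f s = pr.W (HexMesh.trL (Y.state pr) f s) k :=
      fun _ => rfl
    have hR : ∀ k, HexMesh.trR (Y.Wn pr k) f s = pr.W (HexMesh.trR (Y.state pr) f s) k :=
      fun _ => rfl
    simp only [hL, hR, one_mul, neg_one_mul, mul_neg, Finset.sum_neg_distrib, Params.ifaceFlux]
    ring
  · refine Finset.sum_congr rfl fun b _ => ?_
    congr 1
    funext s
    congr 1
    simp only [DGFields.FeStar, M.onFace_bdry, wallProd]
    rfl

end Balance

/-! ### Assembly of the discrete entropy law. -/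

section DiscreteLaw

variable {pr : Params} {M : HexMesh} {N : ℕ} {gl : GaussLobatto N} {κ : ℝ} {fl : InviscidFlux}
  {wall : Fin M.nB → WallKind} {I : Set ℝ} {Y : ℝ → DGFields M N}

/-- The entropy production of the interface penalty on the chemical potential. -/
noncomputable def penaltyProd (gl : GaussLobatto N) (κ : ℝ) (Y : DGFields M N) : ℝ :=
  ∑ f, gl.face (fun s => M.faceJac gl (M.left f) s *
    (HexMesh.jump Y.μ f s * (M.penalty gl κ f s * HexMesh.jump Y.μ f s)))

theorem penalty_nonneg (hJ : ∀ e n, 0 < M.dJac gl e n) (hκ : 0 ≤ κ) (f : Fin M.nI)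
    (s : FaceNode N) : 0 ≤ M.penalty gl κ f s := by
  unfold HexMesh.penalty HexMesh.aver HexMesh.trL HexMesh.trR
  have h1 := (inv_pos.2 (hJ (M.left f).1 (faceNode (M.left f).2 s))).le
  have h2 := (inv_pos.2 (hJ (M.right f).1 (faceNode (M.right f).2 ((M.orient f).node s)))).le
  have h3 := M.faceJac_nonneg gl (M.left f) s
  positivity

theorem penaltyProd_nonneg (hJ : ∀ e n, 0 < M.dJac gl e n) (hκ : 0 ≤ κ) (Y : DGFields M N) :
    0 ≤ penaltyProd gl κ Y :=
  Finset.sum_nonneg fun f _ => gl.face_nonneg fun s => mul_nonneg (M.faceJac_nonneg gl _ _) (by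
    nlinarith [mul_nonneg (penalty_nonneg hJ hκ f s) (mul_self_nonneg (HexMesh.jump Y.μ f s))])

theorem penaltyProd_zero (Y : DGFields M N) : penaltyProd gl 0 Y = 0 := by
  simp [penaltyProd, HexMesh.penalty, GaussLobatto.face]

theorem dDissipation_nonneg (hJ : ∀ e n, 0 < M.dJac gl e n) (Y : DGFields M N)
    (h : ∀ e n, 0 ≤ pr.visc (Y.C e n)) : 0 ≤ dDissipation pr gl Y := by
  refine Finset.sum_nonneg fun e _ => gl.vol_nonneg fun n => mul_nonneg (hJ e n).le ?_
  refine add_nonneg (mul_nonneg pr.M₀_pos.le (Params.dot_self_nonneg _))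
    (mul_nonneg (mul_nonneg (by norm_num) (h e n)) ?_)
  exact Finset.sum_nonneg fun i _ => Finset.sum_nonneg fun j _ => sq_nonneg _

namespace IsSemiDiscreteSolution

variable (h : IsSemiDiscreteSolution pr M gl κ fl wall I Y) {t : ℝ}

include h

theorem hasDerivAt_C (ht : t ∈ I) (e : Fin M.nE) (n : Node N) :
    HasDerivAt (fun s => (Y s).C e n) (deriv (fun s => (Y s).C e n) t) t :=
  (h.diff_C t ht e n).hasDerivAt

theorem gradient_C (hJ : ∀ e n, 0 < M.dJac gl e n) (hI : IsOpen I) (ht : t ∈ I) :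
    (∀ e n, HasDerivAt (fun s => (Y s).Gc e n) (deriv (fun s => (Y s).Gc e n) t) t) ∧
      ∀ e, M.IsDGGradient gl e (fun n => deriv (fun s => (Y s).C e n) t)
        (fun a x => HexMesh.starAver (fun e n => deriv (fun s => (Y s).C e n) t) (e, a) x)
        (fun n => deriv (fun s => (Y s).Gc e n) t) :=
  HexMesh.hasDerivAt_gradient gl hJ (h.hasDerivAt_C ht)
    (by filter_upwards [hI.mem_nhds ht] with s hs using h.eq_c s hs)

theorem gradient_P (hJ : ∀ e n, 0 < M.dJac gl e n) (hI : IsOpen I) (ht : t ∈ I) (e : Fin M.nE)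
    (n : Node N) : HasDerivAt (fun s => (Y s).Gp e n) (deriv (fun s => (Y s).Gp e n) t) t :=
  (HexMesh.hasDerivAt_gradient gl hJ (fun e n => (h.diff_P t ht e n).hasDerivAt)
    (by filter_upwards [hI.mem_nhds ht] with s hs using h.eq_p s hs)).1 e n

/-- The chemical potential equation, tested with the time derivative of the concentration. -/
theorem chemical_balance (hJ : ∀ e n, 0 < M.dJac gl e n) (hI : IsOpen I) (ht : t ∈ I) :
    ∑ e, gl.vol (fun n => M.dJac gl e n * (Y t).μ e n * deriv (fun s => (Y s).C e n) t)
      = ∑ e, gl.vol (fun n => M.dJac gl e n * deriv pr.f0 ((Y t).C e n)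
          * deriv (fun s => (Y s).C e n) t)
        + pr.s32 * (∑ e, gl.vol (fun n => M.dJac gl e n *
            (deriv (fun s => (Y s).Gc e n) t ⬝ᵥ (Y t).Gc e n))
          + ∑ f, gl.face (fun s => M.faceJac gl (M.left f) s *
            (HexMesh.jump (fun e n => deriv (fun r => (Y r).C e n) t) f s *
              (M.penalty gl κ f s * HexMesh.jump (Y t).C f s))))
        + ∑ b, gl.face (fun s => M.faceJac gl (M.bdry b) s *
            (HexMesh.trOwn (fun e n => deriv (fun r => (Y r).C e n) t) (M.bdry b) s *
              deriv pr.fw (HexMesh.trOwn (Y t).C (M.bdry b) s))) := by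
  -- The scalar is `C_t`, whose discrete gradient is the time derivative of `G_c`, and the flux is
  -- `G_c` itself. At walls `C^⋆ = C`, so only the prescribed `f_w'` contributes.
  have hb := M.sum_weak_divergence gl (fun e n => deriv (fun r => (Y r).C e n) t)
    (fun e n => deriv (fun s => (Y s).Gc e n) t) (Y t).Gc
    (HexMesh.starAver (fun e n => deriv (fun r => (Y r).C e n) t))
    ((Y t).GcStar pr gl κ)
    (fun f s => M.penalty gl κ f s * HexMesh.jump (Y t).C f s)
    (fun b s => HexMesh.trOwn (fun e n => deriv (fun r => (Y r).C e n) t) (M.bdry b) s *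
      (-deriv pr.fw (HexMesh.trOwn (Y t).C (M.bdry b) s) / pr.s32))
    (h.gradient_C hJ hI ht).2
    (fun f s => by simp only [HexMesh.starAver, M.onFace_left])
    (fun f s => by simp only [HexMesh.starAver, M.onFace_right])
    (fun f s => by simp only [DGFields.GcStar, M.onFace_left, one_mul])
    (fun f s => by simp only [DGFields.GcStar, M.onFace_right, neg_one_mul])
    (fun b s => by
      simp only [HexMesh.starAver, DGFields.GcStar, M.onFace_bdry, sub_self, zero_mul, zero_add])
  have hμ : ∀ e, gl.vol (fun n => M.dJac gl e n * (Y t).μ e n * deriv (fun s => (Y s).C e n) t)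
      = gl.vol (fun n => M.dJac gl e n * deriv pr.f0 ((Y t).C e n) * deriv (fun s => (Y s).C e n) t)
      - pr.s32 * (M.surf gl e (fun a s => deriv (fun r => (Y r).C e (faceNode a s)) t *
            (Y t).GcStar pr gl κ (e, a) s)
        - gl.vol (fun n => ∑ d, (M.dContra gl e n d ⬝ᵥ (Y t).Gc e n) *
            gl.dXi d (fun n => deriv (fun s => (Y s).C e n) t) n)) := by
    intro e
    rw [h.eq_μ t ht e fun n => deriv (fun s => (Y s).C e n) t, mul_sub, ← M.surf_const_mul,
      ← gl.vol_const_mul]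
    simp only [Finset.mul_sum, mul_assoc]
    ring
  simp only [hμ, Finset.sum_sub_distrib, ← Finset.mul_sum] at hb ⊢
  have h32 := pr.s32_pos.ne'
  have hbd : ∑ b, gl.face (fun s => M.faceJac gl (M.bdry b) s *
      (HexMesh.trOwn (fun e n => deriv (fun r => (Y r).C e n) t) (M.bdry b) s *
      (-deriv pr.fw (HexMesh.trOwn (Y t).C (M.bdry b) s) / pr.s32)))
      = -(1 / pr.s32) * ∑ b, gl.face (fun s => M.faceJac gl (M.bdry b) s *
            (HexMesh.trOwn (fun e n => deriv (fun r => (Y r).C e n) t) (M.bdry b) s *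
              deriv pr.fw (HexMesh.trOwn (Y t).C (M.bdry b) s))) := by
    rw [Finset.mul_sum]
    refine Finset.sum_congr rfl fun b _ => ?_
    rw [← gl.face_const_mul]
    congr 1
    funext s
    ring
  rw [hbd] at hb
  rw [hb]
  field_simp
  ring

/-- The pressure terms of the scheme, tested with `P / (ρ₀c₀²)`. -/
theorem pressure_balance (ht : t ∈ I) :
    ∑ e, (M.surf gl e (fun a s => (Y t).Wn pr 4 e (faceNode a s) *
          gptStar M gl (fun e' n' => deriv (fun r => (Y r).Gp e' n') t) (e, a) s)
        - gl.vol (fun n => ∑ d,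
            (M.dContra gl e n d ⬝ᵥ deriv (fun s => (Y s).Gp e n) t)
              * gl.dXi d ((Y t).Wn pr 4 e) n))
      = -∑ e, gl.vol (fun n => M.dJac gl e n *
          ((Y t).Gp e n ⬝ᵥ deriv (fun s => (Y s).Gp e n) t / pr.K)) := by
  have hb := M.sum_weak_divergence gl (Y t).P (Y t).Gp (fun e n => deriv (fun s => (Y s).Gp e n) t)
    (HexMesh.starAver (Y t).P)
    (gptStar M gl (fun e' n' => deriv (fun r => (Y r).Gp e' n') t))
    (fun _ _ => 0) (fun _ _ => 0) (h.eq_p t ht)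
    (fun f s => by simp only [HexMesh.starAver, M.onFace_left])
    (fun f s => by simp only [HexMesh.starAver, M.onFace_right])
    (fun f s => by simp only [gptStar, M.onFace_left, one_mul, add_zero])
    (fun f s => by simp only [gptStar, M.onFace_right, neg_one_mul, add_zero])
    (fun b s => by simp only [HexMesh.starAver, gptStar, M.onFace_bdry]; ring)
  have hz' : gl.face (fun _ => 0) = 0 := by simp [GaussLobatto.face]
  simp only [mul_zero, hz', Finset.sum_const_zero, add_zero, sub_zero] at hb
  -- The test function is a constant multiple of the pressure, so the balance for the gradient `G_p`
  -- applies after scaling.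
  have h1 : ∀ e, (Y t).Wn pr 4 e = fun n => (pr.K)⁻¹ * (Y t).P e n := by
    intro e
    funext n
    change (Y t).P e n / pr.K = _
    ring
  have h2 : ∀ e d n, gl.dXi d ((Y t).Wn pr 4 e) n = (pr.K)⁻¹ * gl.dXi d ((Y t).P e) n := by
    intro e d n
    rw [h1]
    simp only [GaussLobatto.dXi, Finset.mul_sum]
    exact Finset.sum_congr rfl fun m _ => by ring
  simp only [h2]
  simp only [h1, mul_assoc, M.surf_const_mul, mul_left_comm _ (pr.K)⁻¹, ← Finset.mul_sum,
    gl.vol_const_mul, ← mul_sub, div_eq_inv_mul]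
  rw [hb]
  ring

/-- The viscous terms of the scheme, tested with the entropy variables. -/
theorem viscous_balance (ht : t ∈ I) :
    ∑ e, (M.surf gl e (fun a s => ∑ k, (Y t).Wn pr k e (faceNode a s) *
          (Y t).FvStar pr gl κ wall k (e, a) s)
      - gl.vol (fun n => ∑ k, ∑ d,
          (M.dContra gl e n d ⬝ᵥ (Y t).Fv pr k e n) * gl.dXi d ((Y t).Wn pr k e) n))
      = -dDissipation pr gl (Y t) - penaltyProd gl κ (Y t) := by
  have hb : ∀ k, _ := fun k => M.sum_weak_divergence gl ((Y t).Wn pr k)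
    (fun e n => (Y t).G e n k) ((Y t).Fv pr k)
    ((Y t).Wstar pr wall k) ((Y t).FvStar pr gl κ wall k)
    (fun f s => if k = 0 then M.penalty gl κ f s * HexMesh.jump (Y t).μ f s else 0)
    (fun _ _ => 0) (fun e => h.eq_g t ht e k)
    (fun f s => by simp only [DGFields.Wstar, M.onFace_left])
    (fun f s => by simp only [DGFields.Wstar, M.onFace_right])
    (fun f s => by simp only [DGFields.FvStar, M.onFace_left, one_mul])
    (fun f s => by simp only [DGFields.FvStar, M.onFace_right, neg_one_mul])
    -- Wall terms vanish for every component: either `W^⋆ = W` and the flux is zero, or, for a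
    -- no-slip velocity, `W^⋆ = 0` and the flux is the own one, so that `(0 - U)F + UF = 0`.
    (fun b s => by
      simp only [DGFields.Wstar, DGFields.FvStar, M.onFace_bdry]
      rcases wall b with _ | _
      · simp
      · have h4 : HexMesh.trOwn ((Y t).Fv pr 4) (M.bdry b) s = 0 := rfl
        fin_cases k <;> simp [h4])
  have hz' : gl.face (fun _ => 0) = 0 := by simp [GaussLobatto.face]
  have hs := Finset.sum_congr rfl fun k (_ : k ∈ (Finset.univ : Finset (Fin 5))) => hb k
  rw [Finset.sum_comm] at hs
  have hl : ∀ e, (M.surf gl e (fun a s => ∑ k, (Y t).Wn pr k e (faceNode a s) *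
          (Y t).FvStar pr gl κ wall k (e, a) s)
      - gl.vol (fun n => ∑ k, ∑ d,
          (M.dContra gl e n d ⬝ᵥ (Y t).Fv pr k e n) * gl.dXi d ((Y t).Wn pr k e) n))
      = ∑ k, (M.surf gl e (fun a s => (Y t).Wn pr k e (faceNode a s) *
          (Y t).FvStar pr gl κ wall k (e, a) s)
      - gl.vol (fun n => ∑ d,
          (M.dContra gl e n d ⬝ᵥ (Y t).Fv pr k e n) * gl.dXi d ((Y t).Wn pr k e) n)) := by
    intro e
    rw [Finset.sum_sub_distrib, M.surf_sum, gl.vol_sum]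
  simp only [hl]
  rw [hs]
  simp only [mul_zero, hz', Finset.sum_const_zero, add_zero, Finset.sum_sub_distrib,
    Finset.sum_neg_distrib]
  congr 1
  · rw [Finset.sum_comm]
    unfold dDissipation
    congr 1
    refine Finset.sum_congr rfl fun e _ => ?_
    rw [← gl.vol_sum]
    congr 1
    funext n
    rw [← sum_fv_dot, Finset.mul_sum]
    rfl
  · rw [Fin.sum_univ_succ]
    have : ∀ i : Fin 4, i.succ ≠ 0 := fun i => Fin.succ_ne_zero i
    simp only [if_true, this, if_false, mul_zero, hz', Finset.sum_const_zero, add_zero]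
    rfl

end IsSemiDiscreteSolution

end DiscreteLaw

section DiscreteLaw

variable {pr : Params} {M : HexMesh} {N : ℕ} {gl : GaussLobatto N} {κ : ℝ} {fl : InviscidFlux}
  {wall : Fin M.nB → WallKind} {I : Set ℝ} {Y : ℝ → DGFields M N}

/-- The kinetic energy expressed by `√ρU`. -/
theorem kinetic_eq (Z : DGFields M N) (e : Fin M.nE) (n : Node N) (hρ : 0 < pr.rho (Z.C e n)) :
    1 / 2 * pr.rho (Z.C e n) * ((Z.state pr e n).U ⬝ᵥ (Z.state pr e n).U)
      = 1 / 2 * (Z.Q e n ⬝ᵥ Z.Q e n) := by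
  have h1 := Real.mul_self_sqrt hρ.le
  have h2 : Real.sqrt (pr.rho (Z.C e n)) ≠ 0 := (Real.sqrt_pos.2 hρ).ne'
  simp only [DGFields.state, smul_dotProduct, dotProduct_smul, smul_eq_mul]
  nth_rw 1 [← h1]
  field_simp

namespace IsSemiDiscreteSolution

variable (h : IsSemiDiscreteSolution pr M gl κ fl wall I Y) {t : ℝ}

include h

/-- The scheme, tested with the entropy variables and summed over the elements. -/
theorem evolution_balance (ht : t ∈ I) :
    ∑ e, gl.vol (fun n => M.dJac gl e n * (Y t).μ e n * deriv (fun s => (Y s).C e n) t)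
      + ∑ e, gl.vol (fun n => M.dJac gl e n *
          ((Y t).Q e n ⬝ᵥ deriv (fun s => (Y s).Q e n) t))
      + ∑ e, gl.vol (fun n => M.dJac gl e n *
          ((Y t).Gp e n ⬝ᵥ deriv (fun s => (Y s).Gp e n) t / pr.K))
      = -dDissipation pr gl (Y t) - penaltyProd gl κ (Y t) - inviscidProd pr gl fl (Y t) := by
  have hq := Finset.sum_congr rfl fun e (_ : e ∈ (Finset.univ : Finset (Fin M.nE))) =>
    h.eq_q t ht e fun k => (Y t).Wn pr k e
  have hv := h.viscous_balance ht
  have hp := h.pressure_balance ht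
  have hi := inviscid_balance pr gl fl (Y t)
  -- With `U = Q/√ρ` the momentum term `√ρ Q_t · U` is `Q_t · Q`, the rate of `½|Q|²`.
  have hkin : ∀ e, gl.vol (fun n => M.dJac gl e n * (deriv (fun s => (Y s).C e n) t *
        (Y t).Wn pr 0 e n + ∑ i, Real.sqrt (pr.rho ((Y t).C e n)) *
          deriv (fun s => (Y s).Q e n) t i * (Y t).Wn pr (momIdx i) e n))
      = gl.vol (fun n => M.dJac gl e n * (Y t).μ e n * deriv (fun s => (Y s).C e n) t)
      + gl.vol (fun n => M.dJac gl e n * ((Y t).Q e n ⬝ᵥ deriv (fun s => (Y s).Q e n) t)) := by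
    intro e
    rw [← gl.vol_add]
    congr 1
    funext n
    have hs : Real.sqrt (pr.rho ((Y t).C e n)) ≠ 0 := (Real.sqrt_pos.2 (h.rho_pos t ht e n)).ne'
    have h0 : (Y t).Wn pr 0 e n = (Y t).μ e n := rfl
    have hU : ∀ i, (Y t).Wn pr (momIdx i) e n
        = (Real.sqrt (pr.rho ((Y t).C e n)))⁻¹ * (Y t).Q e n i := by
      intro i; fin_cases i <;> rfl
    rw [mul_assoc, ← mul_add, h0, dotProduct]
    congr 2
    · ring
    · refine Finset.sum_congr rfl fun i _ => ?_
      rw [hU]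
      field_simp
  simp only [hkin] at hq
  simp only [Finset.sum_add_distrib, Finset.sum_sub_distrib] at hq hv hp hi
  linarith

/-- The time derivative of the discrete entropy. -/
theorem hasDerivAt_entropy (hJ : ∀ e n, 0 < M.dJac gl e n) (hI : IsOpen I) (ht : t ∈ I) :
    HasDerivAt (fun s => dTotalEntropy pr gl κ (Y s) + dSurfaceEnergy pr gl (Y s))
      (-dDissipation pr gl (Y t) - penaltyProd gl κ (Y t) - inviscidProd pr gl fl (Y t)) t := by
  have hC := h.hasDerivAt_C ht
  have hGc := (h.gradient_C hJ hI ht).1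
  have hGp := h.gradient_P hJ hI ht
  -- The kinetic energy is written as `½|Q|²`, so `ρ(C)` never has to be differentiated in time;
  -- with the cutoff it need not be differentiable.
  have hd : HasDerivAt (fun s =>
      (∑ e, gl.vol (fun n => M.dJac gl e n * (pr.f0 ((Y s).C e n)
          + pr.s34 * ((Y s).Gc e n ⬝ᵥ (Y s).Gc e n) + 1 / 2 * ((Y s).Q e n ⬝ᵥ (Y s).Q e n)
          + ((Y s).Gp e n ⬝ᵥ (Y s).Gp e n) / (2 * pr.K)))
        + pr.s34 * ∑ f, gl.face (fun x => M.faceJac gl (M.left f) x *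
          (M.penalty gl κ f x * HexMesh.jump (Y s).C f x ^ 2)))
        + ∑ b, gl.face (fun x => M.faceJac gl (M.bdry b) x *
            pr.fw (HexMesh.trOwn (Y s).C (M.bdry b) x)))
      ((∑ e, gl.vol (fun n => M.dJac gl e n * (deriv pr.f0 ((Y t).C e n)
            * deriv (fun s => (Y s).C e n) t
          + pr.s34 * (deriv (fun s => (Y s).Gc e n) t ⬝ᵥ (Y t).Gc e n
            + (Y t).Gc e n ⬝ᵥ deriv (fun s => (Y s).Gc e n) t)
          + 1 / 2 * (deriv (fun s => (Y s).Q e n) t ⬝ᵥ (Y t).Q e n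
            + (Y t).Q e n ⬝ᵥ deriv (fun s => (Y s).Q e n) t)
          + (deriv (fun s => (Y s).Gp e n) t ⬝ᵥ (Y t).Gp e n
            + (Y t).Gp e n ⬝ᵥ deriv (fun s => (Y s).Gp e n) t) / (2 * pr.K)))
        + pr.s34 * ∑ f, gl.face (fun x => M.faceJac gl (M.left f) x *
          (M.penalty gl κ f x * (2 * HexMesh.jump (Y t).C f x *
            HexMesh.jump (fun e n => deriv (fun r => (Y r).C e n) t) f x))))
        + ∑ b, gl.face (fun x => M.faceJac gl (M.bdry b) x *
            (deriv pr.fw (HexMesh.trOwn (Y t).C (M.bdry b) x) *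
              HexMesh.trOwn (fun e n => deriv (fun r => (Y r).C e n) t) (M.bdry b) x))) t := by
    refine ((HasDerivAt.fun_sum fun e _ => gl.hasDerivAt_vol fun n => ?_).add
      ((HasDerivAt.fun_sum fun f _ => gl.hasDerivAt_face fun x => ?_).const_mul _)).add
      (HasDerivAt.fun_sum fun b _ => gl.hasDerivAt_face fun x => ?_)
    · refine HasDerivAt.const_mul _ (((HasDerivAt.add ?_ ?_).add ?_).add ?_)
      · exact (pr.differentiable_f0 _).hasDerivAt.comp t (hC e n)
      · exact (hasDerivAt_dotProduct (hGc e n) (hGc e n)).const_mul _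
      · exact (hasDerivAt_dotProduct (h.diff_Q t ht e n).hasDerivAt
          (h.diff_Q t ht e n).hasDerivAt).const_mul _
      · exact (hasDerivAt_dotProduct (hGp e n) (hGp e n)).div_const _
    · have := ((HexMesh.hasDerivAt_jump hC f x).pow 2)
      simp only [Nat.cast_ofNat, Nat.add_one_sub_one, pow_one] at this
      exact (this.const_mul _).const_mul _
    · exact ((((pr.fw_smooth.differentiable (by norm_num)) _).hasDerivAt.comp t
        (hC _ _)).const_mul _)
  refine (hd.congr_of_eventuallyEq ?_).congr_deriv ?_
  · filter_upwards [hI.mem_nhds ht] with s hs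
    have hk : ∀ e n, dEntropy2 pr (Y s) e n = pr.f0 ((Y s).C e n)
          + pr.s34 * ((Y s).Gc e n ⬝ᵥ (Y s).Gc e n) + 1 / 2 * ((Y s).Q e n ⬝ᵥ (Y s).Q e n)
          + ((Y s).Gp e n ⬝ᵥ (Y s).Gp e n) / (2 * pr.K) := fun e n => by
      rw [← kinetic_eq (Y s) e n (h.rho_pos s hs e n)]
      rfl
    simp only [dTotalEntropy, dSurfaceEnergy, hk]
  -- The term `μ C_t` of the evolution balance is replaced by the rates of the chemical, gradient,
  -- penalty and wall energies; the factor `2` in `s32 = 2 s34` is that of differentiating a square.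
  rw [← h.evolution_balance ht, h.chemical_balance hJ hI ht, pr.s32_eq, mul_add, Finset.mul_sum,
    Finset.mul_sum, Finset.mul_sum]
  have e1 : ∀ e, gl.vol (fun n => M.dJac gl e n * (deriv pr.f0 ((Y t).C e n)
            * deriv (fun s => (Y s).C e n) t
          + pr.s34 * (deriv (fun s => (Y s).Gc e n) t ⬝ᵥ (Y t).Gc e n
            + (Y t).Gc e n ⬝ᵥ deriv (fun s => (Y s).Gc e n) t)
          + 1 / 2 * (deriv (fun s => (Y s).Q e n) t ⬝ᵥ (Y t).Q e n
            + (Y t).Q e n ⬝ᵥ deriv (fun s => (Y s).Q e n) t)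
          + (deriv (fun s => (Y s).Gp e n) t ⬝ᵥ (Y t).Gp e n
            + (Y t).Gp e n ⬝ᵥ deriv (fun s => (Y s).Gp e n) t) / (2 * pr.K)))
      = gl.vol (fun n => M.dJac gl e n * deriv pr.f0 ((Y t).C e n)
          * deriv (fun s => (Y s).C e n) t)
        + 2 * pr.s34 * gl.vol (fun n => M.dJac gl e n *
            (deriv (fun s => (Y s).Gc e n) t ⬝ᵥ (Y t).Gc e n))
        + gl.vol (fun n => M.dJac gl e n *
          ((Y t).Q e n ⬝ᵥ deriv (fun s => (Y s).Q e n) t))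
        + gl.vol (fun n => M.dJac gl e n *
          ((Y t).Gp e n ⬝ᵥ deriv (fun s => (Y s).Gp e n) t / pr.K)) := by
    intro e
    rw [← gl.vol_const_mul, ← gl.vol_add, ← gl.vol_add, ← gl.vol_add]
    congr 1
    funext n
    have hK : (Y t).Gp e n ⬝ᵥ deriv (fun s => (Y s).Gp e n) t / pr.K
        = ((Y t).Gp e n ⬝ᵥ deriv (fun s => (Y s).Gp e n) t) / pr.K := rfl
    have hK0 := pr.K_pos.ne'
    rw [dotProduct_comm (deriv (fun s => (Y s).Gp e n) t),
      dotProduct_comm (deriv (fun s => (Y s).Gc e n) t),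
      dotProduct_comm (deriv (fun s => (Y s).Q e n) t)]
    field_simp
    ring
  have e2 : ∀ f, pr.s34 * gl.face (fun x => M.faceJac gl (M.left f) x *
          (M.penalty gl κ f x * (2 * HexMesh.jump (Y t).C f x *
            HexMesh.jump (fun e n => deriv (fun r => (Y r).C e n) t) f x)))
      = 2 * pr.s34 * gl.face (fun s => M.faceJac gl (M.left f) s *
            (HexMesh.jump (fun e n => deriv (fun r => (Y r).C e n) t) f s *
              (M.penalty gl κ f s * HexMesh.jump (Y t).C f s))) := by
    intro f
    rw [← gl.face_const_mul, ← gl.face_const_mul]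
    congr 1
    funext x
    ring
  simp only [e1, e2, Finset.sum_add_distrib]
  simp only [mul_comm (deriv pr.fw _)]
  ring

end IsSemiDiscreteSolution

/-- The discrete entropy law. -/
theorem discrete_entropy_law (hI : IsOpen I) (hJ : ∀ e n, 0 < M.dJac gl e n) (hκ : 0 ≤ κ)
    (h : IsSemiDiscreteSolution pr M gl κ fl wall I Y) {t : ℝ} (ht : t ∈ I) :
    ∃ d : ℝ, HasDerivAt (fun s => dTotalEntropy pr gl κ (Y s) + dSurfaceEnergy pr gl (Y s)) d t ∧
      d ≤ -dDissipation pr gl (Y t) ∧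
      (fl = InviscidFlux.central → κ = 0 → d = -dDissipation pr gl (Y t)) ∧
      ((∀ e n, 0 ≤ pr.visc ((Y t).C e n)) → -dDissipation pr gl (Y t) ≤ 0) := by
  refine ⟨_, h.hasDerivAt_entropy hJ hI ht, ?_, ?_, fun hv =>
    neg_nonpos.2 (dDissipation_nonneg hJ (Y t) hv)⟩
  · have h1 := penaltyProd_nonneg (gl := gl) hJ hκ (Y t)
    have h2 := inviscidProd_nonneg pr gl fl (Y t) (h.rho_pos t ht)
    linarith
  · rintro rfl rfl
    rw [penaltyProd_zero, inviscidProd_central]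
    ring

end DiscreteLaw

/-! ## Calculus in space and time -/

/-- `f : ℝ → Vec → ℝ` is jointly `n` times continuously differentiable on `W`. -/
def SmoothOn (n : ℕ) (W : Set (ℝ × Vec)) (f : ℝ → Vec → ℝ) : Prop :=
  ContDiffOn ℝ n (fun z : ℝ × Vec => f z.1 z.2) W

/-- The time derivative of a scalar field. -/
noncomputable def td (f : ℝ → Vec → ℝ) (t : ℝ) (x : Vec) : ℝ := deriv (fun s => f s x) t

namespace SmoothOn

variable {n : ℕ} {W : Set (ℝ × Vec)} {f g : ℝ → Vec → ℝ} {t : ℝ} {x : Vec}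

theorem of_le {m : ℕ} (h : SmoothOn n W f) (hm : m ≤ n) : SmoothOn m W f :=
  ContDiffOn.of_le h (by exact_mod_cast hm)

theorem congr (h : SmoothOn n W f) (hfg : ∀ t x, (t, x) ∈ W → g t x = f t x) : SmoothOn n W g :=
  ContDiffOn.congr h fun z hz => hfg z.1 z.2 hz

theorem add (hf : SmoothOn n W f) (hg : SmoothOn n W g) : SmoothOn n W fun t x => f t x + g t x :=
  ContDiffOn.add hf hg

theorem sub (hf : SmoothOn n W f) (hg : SmoothOn n W g) : SmoothOn n W fun t x => f t x - g t x :=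
  ContDiffOn.sub hf hg

theorem mul (hf : SmoothOn n W f) (hg : SmoothOn n W g) : SmoothOn n W fun t x => f t x * g t x :=
  ContDiffOn.mul hf hg

theorem const (c : ℝ) : SmoothOn n W fun _ _ => c := contDiffOn_const

theorem const_mul (c : ℝ) (hf : SmoothOn n W f) : SmoothOn n W fun t x => c * f t x :=
  (const c).mul hf

theorem sum {ι : Type*} {S : Finset ι} {f : ι → ℝ → Vec → ℝ} (h : ∀ i ∈ S, SmoothOn n W (f i)) :
    SmoothOn n W fun t x => ∑ i ∈ S, f i t x :=
  ContDiffOn.sum h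

theorem comp {φ : ℝ → ℝ} (hφ : ContDiff ℝ n φ) (hf : SmoothOn n W f) :
    SmoothOn n W fun t x => φ (f t x) :=
  hφ.comp_contDiffOn hf

theorem continuousOn (h : SmoothOn n W f) : ContinuousOn (fun z : ℝ × Vec => f z.1 z.2) W :=
  ContDiffOn.continuousOn h

theorem differentiableAt (h : SmoothOn 1 W f) (hW : IsOpen W) (hz : (t, x) ∈ W) :
    DifferentiableAt ℝ (fun z : ℝ × Vec => f z.1 z.2) (t, x) :=
  (ContDiffOn.contDiffAt h (hW.mem_nhds hz)).differentiableAt (by norm_num)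

theorem hasFDerivAt_slice (h : SmoothOn 1 W f) (hW : IsOpen W) (hz : (t, x) ∈ W) :
    HasFDerivAt (f t) ((fderiv ℝ (fun z : ℝ × Vec => f z.1 z.2) (t, x)).comp
      (ContinuousLinearMap.inr ℝ ℝ Vec)) x :=
  (h.differentiableAt hW hz).hasFDerivAt.comp x (hasFDerivAt_prodMk_right t x)

theorem differentiableAt_slice (h : SmoothOn 1 W f) (hW : IsOpen W) (hz : (t, x) ∈ W) :
    DifferentiableAt ℝ (f t) x := (h.hasFDerivAt_slice hW hz).differentiableAt

/-- Expresses the derivative at frozen time by the joint derivative, so that it inherits joint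
smoothness in time and space. -/
theorem pd_eq (h : SmoothOn 1 W f) (hW : IsOpen W) (hz : (t, x) ∈ W) (i : Fin 3) :
    pd i (f t) x = fderiv ℝ (fun z : ℝ × Vec => f z.1 z.2) (t, x) (0, unitVec i) := by
  rw [pd, (h.hasFDerivAt_slice hW hz).fderiv]
  rfl

theorem hasDerivAt_time (h : SmoothOn 1 W f) (hW : IsOpen W) (hz : (t, x) ∈ W) :
    HasDerivAt (fun s => f s x) (td f t x) t := by
  have h1 := (h.differentiableAt hW hz).hasFDerivAt.comp_hasDerivAt t
    ((hasDerivAt_id t).prodMk (hasDerivAt_const t x))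
  exact (DifferentiableAt.hasDerivAt h1.differentiableAt :)

theorem td_eq (h : SmoothOn 1 W f) (hW : IsOpen W) (hz : (t, x) ∈ W) :
    td f t x = fderiv ℝ (fun z : ℝ × Vec => f z.1 z.2) (t, x) (1, 0) := by
  have h1 := (h.differentiableAt hW hz).hasFDerivAt.comp_hasDerivAt t
    ((hasDerivAt_id t).prodMk (hasDerivAt_const t x))
  exact h1.deriv

theorem fderiv_apply (h : SmoothOn (n + 1) W f) (hW : IsOpen W) (v : ℝ × Vec) :
    ContDiffOn ℝ n (fun z => fderiv ℝ (fun z : ℝ × Vec => f z.1 z.2) z v) W :=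
  (ContDiffOn.fderiv_of_isOpen h hW (by norm_cast)).clm_apply contDiffOn_const

theorem pd (h : SmoothOn (n + 1) W f) (hW : IsOpen W) (i : Fin 3) :
    SmoothOn n W fun t x => pd i (f t) x :=
  (h.fderiv_apply hW (0, unitVec i)).congr fun _ hz =>
    (h.of_le (by omega)).pd_eq hW hz i

theorem td (h : SmoothOn (n + 1) W f) (hW : IsOpen W) : SmoothOn n W (td f) :=
  (h.fderiv_apply hW (1, 0)).congr fun _ hz => (h.of_le (by omega)).td_eq hW hz

/-- Space and time derivatives commute. -/
theorem pd_td (h : SmoothOn 2 W f) (hW : IsOpen W) (hz : (t, x) ∈ W) (i : Fin 3) :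
    INSCH.pd i (INSCH.td f t) x = INSCH.td (fun t x => INSCH.pd i (f t) x) t x := by
  have h1 : SmoothOn 1 W f := h.of_le (by norm_num)
  set F := fun z : ℝ × Vec => f z.1 z.2 with hF
  have hd : DifferentiableAt ℝ (fderiv ℝ F) (t, x) :=
    ((ContDiffOn.fderiv_of_isOpen h hW (m := 1) (by norm_num)).contDiffAt
      (hW.mem_nhds hz)).differentiableAt (by norm_num)
  have hsym : IsSymmSndFDerivAt ℝ F (t, x) :=
    (ContDiffOn.contDiffAt h (hW.mem_nhds hz)).isSymmSndFDerivAt (by simp)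
  -- Both iterated derivatives become values of the second derivative of `F`, whose symmetry
  -- finishes the proof.
  have e1 : ∀ v, fderiv ℝ (fun z => fderiv ℝ F z v) (t, x)
      = (fderiv ℝ (fderiv ℝ F) (t, x)).flip v := by
    intro v
    have := hd.hasFDerivAt.clm_apply (hasFDerivAt_const v (t, x))
    rw [this.fderiv]
    ext <;> simp
  rw [(SmoothOn.td (n := 1) h hW).pd_eq hW hz i, (SmoothOn.pd (n := 1) h hW i).td_eq hW hz]
  have g1 : (fun z : ℝ × Vec => INSCH.td f z.1 z.2) =ᶠ[𝓝 (t, x)] fun z => fderiv ℝ F z (1, 0) := by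
    filter_upwards [hW.mem_nhds hz] with z hz using h1.td_eq hW hz
  have g2 : (fun z : ℝ × Vec => INSCH.pd i (f z.1) z.2) =ᶠ[𝓝 (t, x)]
      fun z => fderiv ℝ F z (0, unitVec i) := by
    filter_upwards [hW.mem_nhds hz] with z hz using h1.pd_eq hW hz i
  rw [g1.fderiv_eq, g2.fderiv_eq, e1, e1]
  exact hsym.eq _ _

end SmoothOn

section Pointwise

variable {f g : Vec → ℝ} {x : Vec}

theorem pd_mul (i : Fin 3) (hf : DifferentiableAt ℝ f x) (hg : DifferentiableAt ℝ g x) :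
    pd i (fun y => f y * g y) x = pd i f x * g x + f x * pd i g x := by
  unfold pd
  rw [fderiv_fun_mul hf hg]
  simp
  ring

theorem pd_add (i : Fin 3) (hf : DifferentiableAt ℝ f x) (hg : DifferentiableAt ℝ g x) :
    pd i (fun y => f y + g y) x = pd i f x + pd i g x := by
  unfold pd
  rw [fderiv_fun_add hf hg]
  rfl

theorem pd_sub (i : Fin 3) (hf : DifferentiableAt ℝ f x) (hg : DifferentiableAt ℝ g x) :
    pd i (fun y => f y - g y) x = pd i f x - pd i g x := by
  unfold pd
  rw [fderiv_fun_sub hf hg]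
  rfl

theorem pd_const_mul (i : Fin 3) (c : ℝ) (hf : DifferentiableAt ℝ f x) :
    pd i (fun y => c * f y) x = c * pd i f x := by
  unfold pd
  rw [fderiv_const_mul hf]
  rfl

theorem pd_sum {ι : Type*} (S : Finset ι) (i : Fin 3) {f : ι → Vec → ℝ}
    (hf : ∀ j ∈ S, DifferentiableAt ℝ (f j) x) :
    pd i (fun y => ∑ j ∈ S, f j y) x = ∑ j ∈ S, pd i (f j) x := by
  unfold pd
  rw [fderiv_fun_sum hf]
  simp

theorem pd_congr (i : Fin 3) (h : f =ᶠ[𝓝 x] g) : pd i f x = pd i g x := by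
  unfold pd
  rw [h.fderiv_eq]

end Pointwise

theorem Params.deriv_f0 (pr : Params) : deriv pr.f0 = fun c =>
    12 * pr.σ / pr.ε * (2 * c * (1 - c) ^ 2 - 2 * c ^ 2 * (1 - c)) := by
  funext c
  have h : HasDerivAt pr.f0 (12 * pr.σ / pr.ε * (2 * c) * (1 - c) ^ 2
      + 12 * pr.σ / pr.ε * c ^ 2 * (2 * (1 - c) * (-1))) c := by
    unfold Params.f0
    have h1 : HasDerivAt (fun c : ℝ => 1 - c) (-1) c := by
      simpa using (hasDerivAt_id c).const_sub 1
    have h2 := (hasDerivAt_pow 2 c).const_mul (12 * pr.σ / pr.ε)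
    have h3 := h1.pow 2
    refine HasDerivAt.congr_deriv (h2.mul h3) ?_
    simp
  rw [h.deriv]
  ring

theorem Params.contDiff_deriv_f0 (pr : Params) (n : ℕ) : ContDiff ℝ n (deriv pr.f0) := by
  rw [pr.deriv_f0]; fun_prop

theorem Params.contDiff_f0 (pr : Params) (n : ℕ) : ContDiff ℝ n pr.f0 := by
  unfold Params.f0; fun_prop

theorem Params.contDiff_visc (pr : Params) (n : ℕ) : ContDiff ℝ n pr.visc := by
  unfold Params.visc; fun_prop

theorem SmoothOn.lap {n : ℕ} {W : Set (ℝ × Vec)} {f : ℝ → Vec → ℝ} (h : SmoothOn (n + 2) W f)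
    (hW : IsOpen W) : SmoothOn n W fun t x => lap (f t) x :=
  SmoothOn.sum fun i _ => (h.pd hW i).pd hW i

theorem SmoothOn.chemPot {W : Set (ℝ × Vec)} {f : ℝ → Vec → ℝ} (pr : Params)
    (h : SmoothOn 4 W f) (hW : IsOpen W) : SmoothOn 2 W fun t x => chemPot pr (f t) x :=
  ((h.of_le (by norm_num)).comp (pr.contDiff_deriv_f0 2)).sub ((h.lap hW).const_mul pr.s32)

/-! ## The divergence theorem on a mesh -/

theorem linearMap_eq_sum (L : Vec →L[ℝ] Vec) (v : Vec) : L v = ∑ k, v k • L (unitVec k) := by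
  conv_lhs => rw [← Finset.univ_sum_single v, map_sum]
  refine Finset.sum_congr rfl fun k _ => ?_
  rw [← map_smul]
  congr 1
  ext j
  simp [unitVec, Pi.single_apply]

theorem openCube_eq : openCube = Set.univ.pi fun _ => Ioo (-1 : ℝ) 1 := by
  ext ξ; simp [openCube]

theorem openCube_subset : openCube ⊆ cube := fun _ h =>
  ⟨fun i => (h i).1.le, fun i => (h i).2.le⟩

theorem isOpen_openCube : IsOpen openCube := by
  rw [openCube_eq]; exact isOpen_set_pi finite_univ fun _ _ => isOpen_Ioo

theorem openCube_ae_eq : openCube =ᵐ[volume] cube := by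
  rw [openCube_eq]; exact Measure.univ_pi_Ioo_ae_eq_Icc

theorem isCompact_cube : IsCompact cube := isCompact_Icc

theorem isCompact_square : IsCompact square := isCompact_Icc

section Mapping

variable {X : Vec → Vec} (hX : ContDiff ℝ 2 X)

theorem det_fderiv (X : Vec → Vec) (ξ : Vec) : (fderiv ℝ X ξ).det = jac X ξ := by
  unfold ContinuousLinearMap.det
  rw [← LinearMap.det_toMatrix', Matrix.det_fin_three]
  have h : ∀ i j, LinearMap.toMatrix' ((fderiv ℝ X ξ : Vec →L[ℝ] Vec) : Vec →ₗ[ℝ] Vec) i j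
      = covBasis X ξ j i := fun i j => by
    rw [LinearMap.toMatrix'_apply]
    rfl
  simp only [h, jac, cross_apply, dotProduct, Fin.sum_univ_three]
  simp
  ring

include hX

theorem contDiff_covBasis (i : Fin 3) : ContDiff ℝ 1 fun ξ => covBasis X ξ i :=
  (hX.fderiv_right (by norm_num)).clm_apply contDiff_const

theorem contDiff_contra (i : Fin 3) : ContDiff ℝ 1 fun ξ => contra X ξ i := by
  have h : ∀ j k, ContDiff ℝ 1 fun ξ => covBasis X ξ j k := fun j k =>
    contDiff_pi.1 (contDiff_covBasis hX j) k
  rw [contDiff_pi]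
  intro k
  simp only [contra, cross_apply]
  fin_cases k
  · exact ((h _ _).mul (h _ _)).sub ((h _ _).mul (h _ _))
  · exact ((h _ _).mul (h _ _)).sub ((h _ _).mul (h _ _))
  · exact ((h _ _).mul (h _ _)).sub ((h _ _).mul (h _ _))

/-- A map with surjective strict derivative is open at the point, and a nonzero Jacobian gives
surjectivity. -/
theorem isOpen_image {s : Set Vec} (hs : IsOpen s) (hJ : ∀ ξ ∈ s, jac X ξ ≠ 0) :
    IsOpen (X '' s) := by
  rw [isOpen_iff_mem_nhds]
  rintro _ ⟨ξ, hξ, rfl⟩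
  have h1 : HasStrictFDerivAt X (fderiv ℝ X ξ) ξ :=
    hX.contDiffAt.hasStrictFDerivAt (by norm_num)
  have h2 : ((fderiv ℝ X ξ : Vec →L[ℝ] Vec) : Vec →ₗ[ℝ] Vec).range = ⊤ := by
    have h3 : LinearMap.det ((fderiv ℝ X ξ : Vec →L[ℝ] Vec) : Vec →ₗ[ℝ] Vec) ≠ 0 := by
      have := det_fderiv X ξ
      unfold ContinuousLinearMap.det at this
      rw [this]; exact hJ ξ hξ
    exact LinearMap.range_eq_top.2 (LinearMap.equivOfDetNeZero _ h3).surjective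
  rw [← h1.map_nhds_eq_of_surj h2]
  exact image_mem_map (hs.mem_nhds hξ)

end Mapping

theorem hasDerivAt_triple {u v z : ℝ → Vec} {u' v' z' : Vec} {t : ℝ} (hu : HasDerivAt u u' t)
    (hv : HasDerivAt v v' t) (hz : HasDerivAt z z' t) :
    HasDerivAt (fun s => (crossProduct (u s) (v s)) ⬝ᵥ z s)
      ((crossProduct u' (v t)) ⬝ᵥ z t + (crossProduct (u t) v') ⬝ᵥ z t
        + (crossProduct (u t) (v t)) ⬝ᵥ z') t := by
  rw [hasDerivAt_pi] at hu hv hz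
  have h : ∀ i j k l m : Fin 3, HasDerivAt (fun s => (u s i * v s j - u s k * v s l) * z s m) _ t :=
    fun i j k l m => (((hu i).mul (hv j)).sub ((hu k).mul (hv l))).mul (hz m)
  have h1 := ((h 1 2 2 1 0).add (h 2 0 0 2 1)).add (h 0 1 1 0 2)
  refine (h1.congr_deriv ?_).congr_of_eventuallyEq (Eventually.of_forall fun s => ?_)
  · simp [cross_apply, dotProduct, Fin.sum_univ_three]
    ring
  · simp [cross_apply, dotProduct, Fin.sum_univ_three]

/-- The Piola transform of a vector field. -/
noncomputable def piola (X Z : Vec → Vec) (ξ : Vec) : Vec := fun i => contra X ξ i ⬝ᵥ Z (X ξ)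

/-- The second derivatives of `X` cancel in pairs (the continuous metric identities). What remains
is `∑ (a_j × a_k)·DZ a_i` over cyclic `(i, j, k)`, and this equals the triple product of the basis
times the trace of `DZ`. -/
theorem divergence_piola {X Z : Vec → Vec} (hX : ContDiff ℝ 2 X) {ξ : Vec}
    (hZ : DifferentiableAt ℝ Z (X ξ)) (hP : DifferentiableAt ℝ (piola X Z) ξ) :
    ∑ i, fderiv ℝ (piola X Z) ξ (Pi.single i 1) i = jac X ξ * divg Z (X ξ) := by
  set H : Fin 3 → Fin 3 → Vec := fun i j => fderiv ℝ (fderiv ℝ X) ξ (unitVec j) (unitVec i) with hH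
  have hXd : DifferentiableAt ℝ X ξ := hX.differentiable (by norm_num) ξ
  have hXdd : DifferentiableAt ℝ (fderiv ℝ X) ξ :=
    (hX.fderiv_right (m := 1) (by norm_num)).differentiable (by norm_num) ξ
  have hsym : ∀ i j, H i j = H j i := fun i j =>
    (hX.contDiffAt.isSymmSndFDerivAt (by simp)).eq (unitVec j) (unitVec i)
  have hA : ∀ i j, HasLineDerivAt ℝ (fun ξ => covBasis X ξ i) (H i j) ξ (unitVec j) := by
    intro i j
    have := (hXdd.hasFDerivAt.clm_apply (hasFDerivAt_const (unitVec i) ξ)).hasLineDerivAt (unitVec j)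
    simp only [ContinuousLinearMap.comp_zero, zero_add, ContinuousLinearMap.flip_apply] at this
    exact this
  have hz : ∀ j, HasLineDerivAt ℝ (fun ξ => Z (X ξ)) (fderiv ℝ Z (X ξ) (covBasis X ξ j)) ξ
      (unitVec j) := fun j =>
    (hZ.hasFDerivAt.comp ξ hXd.hasFDerivAt).hasLineDerivAt (unitVec j)
  have hi : ∀ i, fderiv ℝ (piola X Z) ξ (Pi.single i 1) i
      = (crossProduct (H (i + 1) i) (covBasis X ξ (i + 2))) ⬝ᵥ Z (X ξ)
        + (crossProduct (covBasis X ξ (i + 1)) (H (i + 2) i)) ⬝ᵥ Z (X ξ)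
        + contra X ξ i ⬝ᵥ fderiv ℝ Z (X ξ) (covBasis X ξ i) := by
    intro i
    have h1 : HasLineDerivAt ℝ (fun ξ => piola X Z ξ i) (fderiv ℝ (piola X Z) ξ (unitVec i) i) ξ
        (unitVec i) := (hasFDerivAt_pi'.1 hP.hasFDerivAt i).hasLineDerivAt (unitVec i)
    have h2 := hasDerivAt_triple (hA (i + 1) i) (hA (i + 2) i) (hz i)
    simp only [zero_smul, add_zero] at h2
    exact HasDerivAt.unique h1 h2
  have hdiv : divg Z (X ξ) = ∑ i, fderiv ℝ Z (X ξ) (unitVec i) i := by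
    refine Finset.sum_congr rfl fun i _ => ?_
    rw [pd, (hasFDerivAt_pi'.1 hZ.hasFDerivAt i).fderiv]
    rfl
  rw [hdiv]
  simp only [hi, linearMap_eq_sum (fderiv ℝ Z (X ξ)) (covBasis X ξ _)]
  simp only [Fin.sum_univ_three, contra, jac, Fin.isValue]
  have e1 : (1 : Fin 3) + 1 = 2 := rfl
  have e2 : (1 : Fin 3) + 2 = 0 := rfl
  have e3 : (2 : Fin 3) + 1 = 0 := rfl
  have e4 : (2 : Fin 3) + 2 = 1 := rfl
  -- Identifying the mixed second derivatives makes the six triple products containing them three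
  -- pairs of opposite sign.
  simp only [zero_add, e1, e2, e3, e4, hsym 1 0, hsym 2 0, hsym 2 1]
  simp [cross_apply, dotProduct, Fin.sum_univ_three]
  ring

theorem flipSign_mul_self (o : FaceOrient) (k : Fin 2) : o.flipSign k * o.flipSign k = 1 := by
  unfold FaceOrient.flipSign; split_ifs <;> norm_num

namespace FaceOrient

variable (o : FaceOrient)

theorem pt_eq (y : Fin 2 → ℝ) (k : Fin 2) : o.pt y k = o.flipSign k * y (o.perm k) := by
  unfold pt flipSign; split_ifs <;> ring

theorem continuous_pt : Continuous o.pt := by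
  refine continuous_pi fun k => ?_
  simp only [pt_eq]
  fun_prop

theorem pt_injective : Function.Injective o.pt := by
  intro y z h
  funext j
  have h1 := congrFun h (o.perm.symm j)
  simp only [pt_eq, Equiv.apply_symm_apply] at h1
  have h2 := flipSign_mul_self o (o.perm.symm j)
  have h3 := congrArg (o.flipSign (o.perm.symm j) * ·) h1
  simpa only [← mul_assoc, h2, one_mul] using h3

theorem measurePreserving_pt : MeasurePreserving o.pt volume volume := by
  have h1 := volume_measurePreserving_piCongrLeft (fun _ : Fin 2 => ℝ) o.perm.symm
  have h2 : MeasurePreserving (fun (a : Fin 2 → ℝ) k => (if o.flip k then -(a k) else a k))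
      volume volume := by
    refine volume_preserving_pi (f := fun k x => if o.flip k then -x else x) fun k => ?_
    by_cases h : o.flip k
    · simp only [h, if_true]
      exact Measure.measurePreserving_neg volume
    · simp only [h]
      exact MeasurePreserving.id volume
  have h3 := h2.comp h1
  have e : o.pt = (fun (a : Fin 2 → ℝ) k => (if o.flip k then -(a k) else a k)) ∘
      (MeasurableEquiv.piCongrLeft (fun _ : Fin 2 => ℝ) o.perm.symm) := by
    funext y k
    have hk : (MeasurableEquiv.piCongrLeft (fun _ : Fin 2 => ℝ) o.perm.symm) y k
        = y (o.perm k) := by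
      have := MeasurableEquiv.piCongrLeft_apply_apply o.perm.symm (β := fun _ => ℝ) y (o.perm k)
      rwa [Equiv.symm_apply_apply] at this
    simp only [Function.comp, pt, hk]
  rw [e]
  exact h3

theorem pt_mem_square {y : Fin 2 → ℝ} : o.pt y ∈ square ↔ y ∈ square := by
  have hsq : ∀ z : Fin 2 → ℝ, z ∈ square ↔ ∀ k, |z k| ≤ 1 := fun z => by
    simp only [square, mem_Icc, Pi.le_def, abs_le]
    exact ⟨fun h k => ⟨h.1 k, h.2 k⟩, fun h => ⟨fun k => (h k).1, fun k => (h k).2⟩⟩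
  rw [hsq, hsq]
  have : ∀ k, |o.pt y k| = |y (o.perm k)| := fun k => by
    unfold pt; split_ifs
    · rw [abs_neg]
    · rfl
  simp only [this]
  exact o.perm.forall_congr_right (q := fun k => |y k| ≤ 1)

theorem integral_comp_pt (g : (Fin 2 → ℝ) → ℝ) :
    ∫ y in square, g (o.pt y) = ∫ y in square, g y := by
  have h := o.measurePreserving_pt.setIntegral_preimage_emb
    (o.continuous_pt.measurableEmbedding o.pt_injective) g square
  have e : o.pt ⁻¹' square = square := by ext y; exact o.pt_mem_square
  rwa [e] at h

end FaceOrient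

/-- Tangent vectors of a mapped face. -/
theorem hasLineDerivAt_face {X : Vec → Vec} (hX : Differentiable ℝ X) (a : RefFace)
    (y : Fin 2 → ℝ) (j : Fin 2) (c : ℝ) :
    HasDerivAt (fun s : ℝ => X (facePt a (y + (s * c) • Pi.single j 1)))
      (c • covBasis X (facePt a y) (a.1.succAbove j)) 0 := by
  have h1 : HasDerivAt (fun s : ℝ => facePt a (y + (s * c) • Pi.single j 1))
      (c • unitVec (a.1.succAbove j)) 0 := by
    have e : (fun s : ℝ => facePt a (y + (s * c) • Pi.single j 1))
        = fun s : ℝ => facePt a y + s • (c • unitVec (a.1.succAbove j)) := by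
      funext s d
      unfold facePt unitVec
      refine Fin.succAboveCases a.1 ?_ (fun k => ?_) d
      · simp [(Fin.succAbove_ne _ _).symm]
      · simp [Pi.single_apply]
    rw [e]
    simpa using ((hasDerivAt_id (0 : ℝ)).smul_const (c • unitVec (a.1.succAbove j))).const_add
      (facePt a y)
  have h2 := (hX (facePt a y)).hasFDerivAt
  have h3 : facePt a (y + ((0 : ℝ) * c) • Pi.single j 1) = facePt a y := by simp
  rw [← h3] at h2
  have h4 := h2.comp_hasDerivAt (0 : ℝ) h1
  rw [h3, map_smul] at h4
  exact h4

/-- Outward normal `± J a^i` of an element face. -/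
noncomputable def contAreaVec (X : Vec → Vec) (a : RefFace) (y : Fin 2 → ℝ) : Vec :=
  RefFace.sign a • contra X (facePt a y) a.1

/-- Rewrites the normal by the tangents in increasing order, the order in which the two sides of a
face are compared; `frameSign` absorbs the difference from the cyclic order. -/
theorem contAreaVec_eq (X : Vec → Vec) (a : RefFace) (y : Fin 2 → ℝ) :
    contAreaVec X a y = RefFace.frameSign a • crossProduct
      (covBasis X (facePt a y) (a.1.succAbove 0)) (covBasis X (facePt a y) (a.1.succAbove 1)) := by
  obtain ⟨i, b⟩ := a
  unfold contAreaVec contra RefFace.frameSign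
  fin_cases i
  · simp [Fin.succAbove]
  · have e1 : Fin.succAbove (1 : Fin 3) 0 = 0 := rfl
    have e2 : Fin.succAbove (1 : Fin 3) 1 = 2 := rfl
    have e3 : (1 : Fin 3) + 1 = 2 := rfl
    have e4 : (1 : Fin 3) + 2 = 0 := rfl
    simp only [Fin.mk_one, e1, e2, e3, e4]
    simp
    rw [← smul_neg, cross_anticomm]
  · have e1 : Fin.succAbove (2 : Fin 3) 0 = 0 := rfl
    have e2 : Fin.succAbove (2 : Fin 3) 1 = 1 := rfl
    have e3 : (2 : Fin 3) + 1 = 0 := rfl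
    have e4 : (2 : Fin 3) + 2 = 1 := rfl
    simp only [Fin.reduceFinMk, e1, e2, e3, e4]
    simp

/-- The open reference square. -/
def openSquare : Set (Fin 2 → ℝ) := Set.univ.pi fun _ => Ioo (-1 : ℝ) 1

theorem openSquare_ae_eq : openSquare =ᵐ[volume] square := Measure.univ_pi_Ioo_ae_eq_Icc

theorem isOpen_openSquare : IsOpen openSquare := isOpen_set_pi finite_univ fun _ _ => isOpen_Ioo

theorem openSquare_subset : openSquare ⊆ square := fun _ h =>
  ⟨fun i => (h i trivial).1.le, fun i => (h i trivial).2.le⟩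

namespace HexMesh

variable (M : HexMesh)

/-- Differentiating the conformity relation along the face matches the tangents up to permutation
and signs; their cross product acquires the determinant, and `M.opposite` makes the total sign
negative. Conformity is known on the square only, so the point must be interior to have a
neighbourhood to differentiate in. -/
theorem contAreaVec_right (f : Fin M.nI) {y : Fin 2 → ℝ} (hy : y ∈ openSquare) :
    contAreaVec (M.X (M.right f).1) (M.right f).2 ((M.orient f).pt y)
      = -contAreaVec (M.X (M.left f).1) (M.left f).2 y := by
  set o := M.orient f with ho
  have hd : ∀ e, Differentiable ℝ (M.X e) := fun e => (M.smooth e).differentiable (by norm_num)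
  have ht : ∀ k, covBasis (M.X (M.left f).1) (facePt (M.left f).2 y)
      ((M.left f).2.1.succAbove (o.perm k))
      = o.flipSign k • covBasis (M.X (M.right f).1) (facePt (M.right f).2 (o.pt y))
        ((M.right f).2.1.succAbove k) := by
    intro k
    have h1 := hasLineDerivAt_face (hd (M.left f).1) (M.left f).2 y (o.perm k) 1
    have h2 := hasLineDerivAt_face (hd (M.right f).1) (M.right f).2 (o.pt y) k (o.flipSign k)
    rw [one_smul] at h1
    refine HasDerivAt.unique (h1.congr_of_eventuallyEq ?_) h2
    have hc : Tendsto (fun s : ℝ => y + (s * 1) • (Pi.single (o.perm k) 1 : Fin 2 → ℝ)) (𝓝 0)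
        (𝓝 y) := by
      have : Continuous fun s : ℝ => y + (s * 1) • (Pi.single (o.perm k) 1 : Fin 2 → ℝ) := by
        fun_prop
      simpa using this.tendsto 0
    filter_upwards [hc (isOpen_openSquare.mem_nhds hy)] with s hs
    have h3 := M.conform f _ (openSquare_subset hs)
    change _ = M.X (M.left f).1 _
    refine (h3.trans ?_).symm
    change M.X (M.right f).1 _ = M.X (M.right f).1 _
    congr 2
    funext j
    simp only [FaceOrient.pt_eq, Pi.add_apply, Pi.smul_apply, smul_eq_mul, ← ho]
    by_cases hj : j = k
    · subst hj; simp; ring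
    · simp [hj]
  have h0 := ht 0
  have h1 := ht 1
  have hopp : RefFace.frameSign (M.left f).2 * o.det
    = -RefFace.frameSign (M.right f).2 := M.opposite f
  have hdet : o.det = ((Equiv.Perm.sign o.perm : ℤ) : ℝ) * (o.flipSign 0 * o.flipSign 1) := by
    simp [FaceOrient.det, FaceOrient.flipSign, Fin.prod_univ_two]
  rw [contAreaVec_eq, contAreaVec_eq, eq_neg_iff_add_eq_zero, ← neg_neg (RefFace.frameSign
    (M.right f).2), ← hopp, hdet]
  rcases perm_fin_two o.perm with h | h <;> rw [h] at h0 h1 ⊢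
  · simp only [Equiv.Perm.coe_one, id] at h0 h1
    rw [h0, h1]
    simp [smul_smul]
    rw [← neg_smul, ← add_smul]
    simp
    left; ring
  · simp only [Equiv.swap_apply_left, Equiv.swap_apply_right] at h0 h1
    rw [h0, h1, Equiv.Perm.sign_swap (by decide), ← cross_anticomm (o.flipSign 0 • _)]
    simp [smul_smul]
    rw [← sub_eq_add_neg, ← sub_smul]
    simp
    left; ring

end HexMesh

theorem facePt_mem_cube {a : RefFace} {y : Fin 2 → ℝ} (hy : y ∈ square) : facePt a y ∈ cube := by
  obtain ⟨i, b⟩ := a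
  have h : ∀ d, facePt (i, b) y d ∈ Icc (-1 : ℝ) 1 := by
    intro d
    unfold facePt RefFace.sign
    refine Fin.succAboveCases i ?_ (fun k => ?_) d
    · cases b <;> simp
    · simpa using ⟨hy.1 k, hy.2 k⟩
  exact ⟨fun d => (h d).1, fun d => (h d).2⟩

theorem continuous_facePt (a : RefFace) : Continuous (facePt a) := by
  refine continuous_pi fun d => ?_
  unfold facePt
  refine Fin.succAboveCases a.1 ?_ (fun k => ?_) d
  · simp only [Fin.insertNth_apply_same]; exact continuous_const
  · simp only [Fin.insertNth_apply_succAbove]; exact continuous_apply k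

namespace HexMesh

variable (M : HexMesh)

theorem image_subset (e : Fin M.nE) : M.X e '' cube ⊆ M.closedDomain :=
  subset_iUnion (fun e => M.X e '' cube) e

theorem mem_closedDomain (e : Fin M.nE) {ξ : Vec} (h : ξ ∈ cube) : M.X e ξ ∈ M.closedDomain :=
  M.image_subset e (mem_image_of_mem _ h)

theorem isCompact_closedDomain : IsCompact M.closedDomain :=
  isCompact_iUnion fun e => isCompact_cube.image (M.smooth e).continuous

theorem isOpen_domain : IsOpen M.domain := isOpen_interior

theorem domain_subset : M.domain ⊆ M.closedDomain := interior_subset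

theorem isOpen_element (e : Fin M.nE) : IsOpen (M.X e '' openCube) :=
  isOpen_image (M.smooth e) isOpen_openCube fun ξ hξ => (M.jac_pos e ξ (openCube_subset hξ)).ne'

theorem element_subset_domain (e : Fin M.nE) : M.X e '' openCube ⊆ M.domain :=
  interior_maximal ((image_mono openCube_subset).trans (M.image_subset e)) (M.isOpen_element e)

/-- The domain exceeds the open elements only by images of the boundary of the cube, and
differentiable maps send null sets to null sets. -/
theorem domain_ae_eq : M.domain =ᵐ[volume] ⋃ e, M.X e '' openCube := by
  rw [ae_eq_set, sdiff_eq_empty.2 (iUnion_subset M.element_subset_domain), measure_empty]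
  refine ⟨measure_mono_null (t := ⋃ e, M.X e '' (cube \ openCube)) ?_ ?_, rfl⟩
  · rintro x ⟨hx, hx'⟩
    obtain ⟨e, ξ, hξ, rfl⟩ := mem_iUnion.1 (M.domain_subset hx)
    exact mem_iUnion.2 ⟨e, ξ, ⟨hξ, fun h => hx' (mem_iUnion.2 ⟨e, ξ, h, rfl⟩)⟩, rfl⟩
  · refine measure_iUnion_null fun e => ?_
    exact addHaar_image_eq_zero_of_differentiableOn_of_addHaar_eq_zero volume
      ((M.smooth e).differentiable (by norm_num)).differentiableOn (ae_eq_set.1 openCube_ae_eq).2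

theorem sum_elements {g : Vec → ℝ} (hg : IntegrableOn g M.closedDomain) :
    ∫ x in M.domain, g x = ∑ e, ∫ ξ in cube, jac (M.X e) ξ * g (M.X e ξ) := by
  rw [setIntegral_congr_set M.domain_ae_eq, integral_iUnion_fintype
    (fun e => (M.isOpen_element e).measurableSet) (fun e e' h => M.nonoverlap e e' h)
    (fun e => hg.mono_set ((M.element_subset_domain e).trans M.domain_subset))]
  refine Finset.sum_congr rfl fun e _ => ?_
  rw [integral_image_eq_integral_abs_det_fderiv_smul volume isOpen_openCube.measurableSet
    (fun ξ _ => ((M.smooth e).differentiable (by norm_num) ξ).hasFDerivAt.hasFDerivWithinAt)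
    (M.inj e), setIntegral_congr_set openCube_ae_eq.symm]
  refine setIntegral_congr_fun isOpen_openCube.measurableSet fun ξ hξ => ?_
  rw [det_fderiv, abs_of_pos (M.jac_pos e ξ (openCube_subset hξ)), smul_eq_mul]

/-- The divergence theorem in one element, on the reference cube. -/
theorem element_divergence (e : Fin M.nE) {Z : Vec → Vec} {V : Set Vec} (hV : IsOpen V)
    (hM : M.closedDomain ⊆ V) (hZ : ContDiffOn ℝ 1 Z V) :
    ∫ ξ in cube, jac (M.X e) ξ * divg Z (M.X e ξ)
      = ∑ a : RefFace, ∫ y in square, contAreaVec (M.X e) a y ⬝ᵥ Z (M.X e (facePt a y)) := by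
  have hX := M.smooth e
  have hV' : IsOpen (M.X e ⁻¹' V) := hV.preimage hX.continuous
  have hc : cube ⊆ M.X e ⁻¹' V := fun ξ hξ => hM (M.mem_closedDomain e hξ)
  have hZX : ContDiffOn ℝ 1 (fun ξ => Z (M.X e ξ)) (M.X e ⁻¹' V) :=
    hZ.comp (hX.of_le (by norm_num)).contDiffOn fun _ h => h
  have hP : ContDiffOn ℝ 1 (piola (M.X e) Z) (M.X e ⁻¹' V) := by
    rw [contDiffOn_pi]
    intro i
    simp only [piola, dotProduct]
    exact ContDiffOn.sum fun k _ => (contDiff_pi.1 (contDiff_contra hX i) k).contDiffOn.mul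
      (contDiffOn_pi.1 hZX k)
  have hPd : ∀ ξ ∈ cube, DifferentiableAt ℝ (piola (M.X e) Z) ξ := fun ξ hξ =>
    (hP.contDiffAt (hV'.mem_nhds (hc hξ))).differentiableAt (by norm_num)
  -- The divergence theorem on the box for the Piola transform, whose normal components on the faces
  -- are `± J a^i · Z`.
  have hdiv := integral_divergence_of_hasFDerivAt_off_countable (fun _ : Fin 3 => (-1 : ℝ))
    (fun _ => 1) (fun _ => by norm_num) (piola (M.X e) Z) (fun ξ => fderiv ℝ (piola (M.X e) Z) ξ)
    ∅ countable_empty (hP.continuousOn.mono hc)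
    (fun ξ hξ => (hPd ξ (openCube_subset (by
      have := hξ.1; rwa [← openCube_eq] at this))).hasFDerivAt)
    (by
      refine ContinuousOn.integrableOn_compact isCompact_cube ?_
      refine continuousOn_finsetSum _ fun i _ => ?_
      have h1 : ContinuousOn (fderiv ℝ (piola (M.X e) Z)) cube :=
        ((hP.continuousOn_fderiv_of_isOpen hV' le_rfl)).mono hc
      exact (continuous_apply i).comp_continuousOn (h1.clm_apply continuousOn_const))
  have hl : ∫ ξ in cube, jac (M.X e) ξ * divg Z (M.X e ξ)
      = ∫ ξ in cube, ∑ i, fderiv ℝ (piola (M.X e) Z) ξ (Pi.single i 1) i := by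
    refine setIntegral_congr_fun measurableSet_Icc fun ξ hξ => ?_
    exact (divergence_piola hX ((hZ.contDiffAt (hV.mem_nhds (hc hξ))).differentiableAt
      (by norm_num)) (hPd ξ hξ)).symm
  rw [hl]
  refine hdiv.trans ?_
  rw [Fintype.sum_prod_type]
  refine Finset.sum_congr rfl fun i _ => ?_
  rw [Fintype.sum_bool, sub_eq_add_neg, ← integral_neg]
  congr 1
  · refine setIntegral_congr_fun measurableSet_Icc fun y _ => ?_
    simp only [contAreaVec, RefFace.sign, if_true, one_smul]
    rfl
  · refine setIntegral_congr_fun measurableSet_Icc fun y _ => ?_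
    simp only [contAreaVec, RefFace.sign, Bool.false_eq_true, if_false, neg_smul, one_smul,
      neg_dotProduct]
    rfl

/-- The divergence theorem on a mesh: the contributions of interior faces cancel. -/
theorem divergence_theorem {Z : Vec → Vec} {V : Set Vec} (hV : IsOpen V)
    (hM : M.closedDomain ⊆ V) (hZ : ContDiffOn ℝ 1 Z V) :
    ∫ x in M.domain, divg Z x
      = ∑ b, ∫ y in square, M.bdryAreaVec b y ⬝ᵥ Z (M.bdryPt b y) := by
  have hdc : ContinuousOn (divg Z) M.closedDomain := by
    refine ContinuousOn.mono ?_ hM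
    refine continuousOn_finsetSum _ fun i _ => ?_
    exact ((contDiffOn_pi.1 hZ i).continuousOn_fderiv_of_isOpen hV le_rfl).clm_apply
      continuousOn_const
  rw [M.sum_elements (hdc.integrableOn_compact M.isCompact_closedDomain)]
  simp only [M.element_divergence _ hV hM hZ]
  rw [M.sum_faces fun p => ∫ y in square, contAreaVec (M.X p.1) p.2 y ⬝ᵥ Z (M.X p.1 (facePt p.2 y))]
  rw [Finset.sum_eq_zero, zero_add]
  · rfl
  intro f _
  -- The right face integral is pulled back to the coordinates of the left side; the integrands are
  -- then opposite on the open square, which has full measure.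
  rw [← (M.orient f).integral_comp_pt fun y => contAreaVec (M.X (M.right f).1) (M.right f).2 y ⬝ᵥ
    Z (M.X (M.right f).1 (facePt (M.right f).2 y))]
  rw [add_eq_zero_iff_eq_neg, ← integral_neg, setIntegral_congr_set openSquare_ae_eq.symm,
    setIntegral_congr_set openSquare_ae_eq.symm]
  refine setIntegral_congr_fun isOpen_openSquare.measurableSet fun y hy => ?_
  have h : M.X (M.left f).1 (facePt (M.left f).2 y)
    = M.X (M.right f).1 (facePt (M.right f).2 ((M.orient f).pt y)) :=
    M.conform f y (openSquare_subset hy)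
  rw [M.contAreaVec_right f hy, h, neg_dotProduct, neg_neg]

end HexMesh

/-! ## The continuous energy law -/

/-- On a closed time interval around `t` times the compact `K`, the time derivative is bounded, and
a constant bound suffices for dominated convergence. It serves both the domain and the boundary
faces. -/
theorem hasDerivAt_setIntegral_of_compact {α : Type*} [TopologicalSpace α] [MeasurableSpace α]
    [OpensMeasurableSpace α] [T2Space α] {μ : Measure α}
    [IsFiniteMeasureOnCompacts μ] {I : Set ℝ} (hI : IsOpen I) {K S : Set α} (hK : IsCompact K)
    (hSK : S ⊆ K) (hS : MeasurableSet S) {F F' : ℝ → α → ℝ}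
    (hF : ContinuousOn (fun z : ℝ × α => F z.1 z.2) (I ×ˢ K))
    (hF' : ContinuousOn (fun z : ℝ × α => F' z.1 z.2) (I ×ˢ K))
    (hd : ∀ s ∈ I, ∀ x ∈ K, HasDerivAt (fun s => F s x) (F' s x) s) {t : ℝ} (ht : t ∈ I) :
    HasDerivAt (fun s => ∫ x in S, F s x ∂μ) (∫ x in S, F' t x ∂μ) t := by
  obtain ⟨δ, hδ, hball⟩ := Metric.nhds_basis_closedBall.mem_iff.1 (hI.mem_nhds ht)
  have hcomp : IsCompact (Metric.closedBall t δ ×ˢ K) := (isCompact_closedBall t δ).prod hK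
  obtain ⟨C, hC⟩ := hcomp.exists_bound_of_continuousOn
    (hF'.mono (prod_mono hball subset_rfl))
  have hint : ∀ {G : ℝ → α → ℝ}, ContinuousOn (fun z : ℝ × α => G z.1 z.2) (I ×ˢ K) →
      ∀ s ∈ I, IntegrableOn (G s) S μ := by
    intro G hG s hs
    have h1 : ContinuousOn (G s) K :=
      hG.comp (Continuous.prodMk_right s).continuousOn fun x hx => ⟨hs, hx⟩
    exact (h1.integrableOn_compact hK).mono_set hSK
  refine (hasDerivAt_integral_of_dominated_loc_of_deriv_le (μ := μ.restrict S)
    (Metric.closedBall_mem_nhds t hδ) ?_ (hint hF t ht) (hint hF' t ht).aestronglyMeasurable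
    (bound := fun _ => C) ?_ ?_ ?_).2
  · filter_upwards [hI.mem_nhds ht] with s hs using (hint hF s hs).aestronglyMeasurable
  · exact (ae_restrict_iff' hS).2 (Eventually.of_forall fun x hx s hs => hC (s, x) ⟨hs, hSK hx⟩)
  · have hfin : μ S < ⊤ := (measure_mono hSK).trans_lt hK.measure_lt_top
    exact integrableOn_const hfin.ne
  · exact (ae_restrict_iff' hS).2 (Eventually.of_forall fun x hx s hs =>
      hd s (hball hs) x (hSK hx))

theorem SmoothOn.contDiffOn_slice {n : ℕ} {W : Set (ℝ × Vec)} {f : ℝ → Vec → ℝ}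
    (h : SmoothOn n W f) (t : ℝ) : ContDiffOn ℝ n (f t) {x | (t, x) ∈ W} :=
  ContDiffOn.comp (g := fun z : ℝ × Vec => f z.1 z.2) (f := fun x => (t, x)) h
    (contDiff_prodMk_right t).contDiffOn fun _ hx => hx

theorem continuousOn_slice {f : ℝ → Vec → ℝ} {n : ℕ} {W : Set (ℝ × Vec)} (h : SmoothOn n W f)
    (t : ℝ) : ContinuousOn (f t) {x | (t, x) ∈ W} := (h.contDiffOn_slice t).continuousOn

section Fields

variable (pr : Params) (c p R : ℝ → Vec → ℝ) (u : ℝ → Vec → Vec)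

/-- The viscous stress. -/
noncomputable def stress (i j : Fin 3) (t : ℝ) (x : Vec) : ℝ :=
  2 * pr.visc (c t x) * strain (velGrad (u t) x) i j

/-- The entropy density, with the density field `R`. -/
noncomputable def entropyDensity (t : ℝ) (x : Vec) : ℝ :=
  pr.f0 (c t x) + pr.s34 * ∑ i, pd i (c t) x * pd i (c t) x
    + 1 / 2 * (R t x * ∑ i, u t x i * u t x i)
    + (2 * pr.K)⁻¹ * ∑ i, pd i (p t) x * pd i (p t) x

/-- The energy flux. -/
noncomputable def energyFlux (t : ℝ) (x : Vec) (j : Fin 3) : ℝ :=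
  pr.s32 * (td c t x * pd j (c t) x) - 1 / 2 * ((R t x * ∑ i, u t x i * u t x i) * u t x j)
    + ∑ i, stress pr c u i j t x * u t x i - (chemPot pr (c t) x * c t x) * u t x j
    + pr.M₀ * (chemPot pr (c t) x * pd j (chemPot pr (c t)) x)
    + (pr.K)⁻¹ * (p t x * pd j (td p t) x) - p t x * u t x j

variable {c p R u} {W : Set (ℝ × Vec)} (hW : IsOpen W) (hc : SmoothOn 4 W c)
  (hu : ∀ i, SmoothOn 2 W fun t x => u t x i) (hp : SmoothOn 3 W p) (hR : SmoothOn 1 W R)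

include hW

theorem smoothOn_strain (hu : ∀ i, SmoothOn 2 W fun t x => u t x i) (i j : Fin 3) :
    SmoothOn 1 W fun t x => strain (velGrad (u t) x) i j := by
  have h := (((hu i).pd (n := 1) hW j).add ((hu j).pd (n := 1) hW i)).mul (SmoothOn.const (2⁻¹))
  exact h.congr fun t x _ => div_eq_mul_inv _ _

theorem smoothOn_stress (hc : SmoothOn 4 W c) (hu : ∀ i, SmoothOn 2 W fun t x => u t x i)
    (i j : Fin 3) : SmoothOn 1 W (stress pr c u i j) :=
  (((hc.of_le (by norm_num)).comp (pr.contDiff_visc 1)).const_mul 2).mul (smoothOn_strain hW hu i j)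

include hc hu in
theorem smoothOn_dissipation : SmoothOn 1 W fun t x => dissipation pr (c t) (u t) x := by
  have hμ : ∀ i, SmoothOn 1 W fun t x => pd i (chemPot pr (c t)) x := fun i =>
    (hc.chemPot pr hW).pd (n := 1) hW i
  have h1 : SmoothOn 1 W fun t x => ∑ i, pd i (chemPot pr (c t)) x * pd i (chemPot pr (c t)) x :=
    SmoothOn.sum fun i _ => (hμ i).mul (hμ i)
  have h2 : SmoothOn 1 W fun t x => ∑ i, ∑ j,
      strain (velGrad (u t) x) i j * strain (velGrad (u t) x) i j :=
    SmoothOn.sum fun i _ => SmoothOn.sum fun j _ =>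
      (smoothOn_strain hW hu i j).mul (smoothOn_strain hW hu i j)
  refine ((h1.const_mul pr.M₀).add ((((hc.of_le (by norm_num)).comp
    (pr.contDiff_visc 1)).const_mul 2).mul h2)).congr fun t x _ => ?_
  simp only [dissipation, strainSq, sq]
  rfl

include hc hu hp hR

theorem smoothOn_entropyDensity : SmoothOn 1 W (entropyDensity pr c p R u) := by
  have h1 : SmoothOn 1 W fun t x => ∑ i, pd i (c t) x * pd i (c t) x :=
    SmoothOn.sum fun i _ => (((hc.of_le (by norm_num)).pd (n := 1) hW i)).mul
      (((hc.of_le (by norm_num)).pd (n := 1) hW i))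
  have h2 : SmoothOn 1 W fun t x => ∑ i, u t x i * u t x i :=
    SmoothOn.sum fun i _ => ((hu i).of_le (by norm_num)).mul ((hu i).of_le (by norm_num))
  have h3 : SmoothOn 1 W fun t x => ∑ i, pd i (p t) x * pd i (p t) x :=
    SmoothOn.sum fun i _ => (((hp.of_le (by norm_num)).pd (n := 1) hW i)).mul
      (((hp.of_le (by norm_num)).pd (n := 1) hW i))
  exact ((((hc.of_le (by norm_num)).comp (pr.contDiff_f0 1)).add (h1.const_mul pr.s34)).add
    ((hR.mul h2).const_mul (1 / 2))).add (h3.const_mul _)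

theorem smoothOn_energyFlux (j : Fin 3) :
    SmoothOn 1 W fun t x => energyFlux pr c p R u t x j := by
  have hc1 : SmoothOn 1 W c := hc.of_le (by norm_num)
  have hp1 : SmoothOn 1 W p := hp.of_le (by norm_num)
  have hu1 : ∀ i, SmoothOn 1 W fun t x => u t x i := fun i => (hu i).of_le (by norm_num)
  have hμ := hc.chemPot pr hW
  have hμ1 : SmoothOn 1 W fun t x => chemPot pr (c t) x := hμ.of_le (by norm_num)
  have h2 : SmoothOn 1 W fun t x => ∑ i, u t x i * u t x i :=
    SmoothOn.sum fun i _ => (hu1 i).mul (hu1 i)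
  exact (((((((((hc.of_le (by norm_num)).td (n := 1) hW).mul
    ((hc.of_le (by norm_num)).pd (n := 1) hW j)).const_mul pr.s32).sub
    (((hR.mul h2).mul (hu1 j)).const_mul (1 / 2))).add
    (SmoothOn.sum fun i _ => (smoothOn_stress pr hW hc hu i j).mul (hu1 i))).sub
    ((hμ1.mul hc1).mul (hu1 j))).add
    ((hμ1.mul (hμ.pd (n := 1) hW j)).const_mul pr.M₀)).add
    ((hp1.mul ((hp.td (n := 2) hW).pd (n := 1) hW j)).const_mul _)).sub (hp1.mul (hu1 j))

theorem td_entropyDensity {t : ℝ} {x : Vec} (hz : (t, x) ∈ W) :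
    td (entropyDensity pr c p R u) t x
      = deriv pr.f0 (c t x) * td c t x + pr.s32 * ∑ i, pd i (c t) x * pd i (td c t) x
        + (1 / 2 * td R t x * ∑ i, u t x i * u t x i
          + R t x * ∑ i, u t x i * td (fun t x => u t x i) t x)
        + (pr.K)⁻¹ * ∑ i, pd i (p t) x * pd i (td p t) x := by
  have hc' := (hc.of_le (m := 1) (by norm_num)).hasDerivAt_time hW hz
  have hci : ∀ i, HasDerivAt (fun s => pd i (c s) x) (pd i (td c t) x) t := fun i => by
    rw [(hc.of_le (by norm_num)).pd_td hW hz i]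
    exact ((hc.of_le (by norm_num)).pd (n := 1) hW i).hasDerivAt_time hW hz
  have hpi : ∀ i, HasDerivAt (fun s => pd i (p s) x) (pd i (td p t) x) t := fun i => by
    rw [(hp.of_le (by norm_num)).pd_td hW hz i]
    exact ((hp.of_le (by norm_num)).pd (n := 1) hW i).hasDerivAt_time hW hz
  have hui : ∀ i, HasDerivAt (fun s => u s x i) (td (fun t x => u t x i) t x) t := fun i =>
    ((hu i).of_le (m := 1) (by norm_num)).hasDerivAt_time hW hz
  have hR' := hR.hasDerivAt_time hW hz
  have h0 := (pr.differentiable_f0 (c t x)).hasDerivAt.comp t hc'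
  have h1 := (HasDerivAt.fun_sum fun i (_ : i ∈ Finset.univ) => (hci i).mul (hci i)).const_mul pr.s34
  have h2 := (hR'.mul (HasDerivAt.fun_sum fun i (_ : i ∈ Finset.univ) =>
    (hui i).mul (hui i))).const_mul (1 / 2)
  have h3 := (HasDerivAt.fun_sum fun i (_ : i ∈ Finset.univ) => (hpi i).mul (hpi i)).const_mul
    (2 * pr.K)⁻¹
  refine (((h0.add h1).add h2).add h3).deriv.trans ?_
  rw [pr.s32_eq]
  simp only [Fin.sum_univ_three, Pi.mul_apply, mul_inv]
  ring

end Fields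

section Fields

variable (pr : Params) {c p R : ℝ → Vec → ℝ} {u : ℝ → Vec → Vec} {W : Set (ℝ × Vec)}

/-- The divergence of the energy flux. -/
theorem divg_energyFlux (hW : IsOpen W) (hc : SmoothOn 4 W c)
    (hu : ∀ i, SmoothOn 2 W fun t x => u t x i) (hp : SmoothOn 3 W p) (hR : SmoothOn 1 W R)
    {t : ℝ} {x : Vec} (hz : (t, x) ∈ W) :
    divg (energyFlux pr c p R u t) x = ∑ j,
      (pr.s32 * (pd j (td c t) x * pd j (c t) x + td c t x * pd j (pd j (c t)) x)
      - 1 / 2 * ((pd j (R t) x * ∑ i, u t x i * u t x i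
          + R t x * ∑ i, (pd j (fun y => u t y i) x * u t x i + u t x i * pd j (fun y => u t y i) x))
            * u t x j + (R t x * ∑ i, u t x i * u t x i) * pd j (fun y => u t y j) x)
      + ∑ i, (pd j (stress pr c u i j t) x * u t x i
          + stress pr c u i j t x * pd j (fun y => u t y i) x)
      - ((pd j (chemPot pr (c t)) x * c t x + chemPot pr (c t) x * pd j (c t) x) * u t x j
          + (chemPot pr (c t) x * c t x) * pd j (fun y => u t y j) x)
      + pr.M₀ * (pd j (chemPot pr (c t)) x * pd j (chemPot pr (c t)) x
          + chemPot pr (c t) x * pd j (pd j (chemPot pr (c t))) x)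
      + (pr.K)⁻¹ * (pd j (p t) x * pd j (td p t) x + p t x * pd j (pd j (td p t)) x)
      - (pd j (p t) x * u t x j + p t x * pd j (fun y => u t y j) x)) := by
  have hc1 := (hc.of_le (m := 1) (by norm_num)).differentiableAt_slice hW hz
  have hct := ((hc.of_le (by norm_num)).td (n := 1) hW).differentiableAt_slice hW hz
  have hcj : ∀ j, DifferentiableAt ℝ (pd j (c t)) x := fun j =>
    ((hc.of_le (by norm_num)).pd (n := 1) hW j).differentiableAt_slice hW hz
  have hp1 := (hp.of_le (m := 1) (by norm_num)).differentiableAt_slice hW hz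
  have hpj : ∀ j, DifferentiableAt ℝ (pd j (td p t)) x := fun j =>
    ((hp.td (n := 2) hW).pd (n := 1) hW j).differentiableAt_slice hW hz
  have hu1 : ∀ i, DifferentiableAt ℝ (fun y => u t y i) x := fun i =>
    ((hu i).of_le (m := 1) (by norm_num)).differentiableAt_slice hW hz
  have hR1 := hR.differentiableAt_slice hW hz
  have hμ1 : DifferentiableAt ℝ (fun y => chemPot pr (c t) y) x :=
    ((hc.chemPot pr hW).of_le (m := 1) (by norm_num)).differentiableAt_slice hW hz
  have hμj : ∀ j, DifferentiableAt ℝ (pd j (chemPot pr (c t))) x := fun j =>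
    ((hc.chemPot pr hW).pd (n := 1) hW j).differentiableAt_slice hW hz
  have hs : ∀ i j, DifferentiableAt ℝ (stress pr c u i j t) x := fun i j =>
    (smoothOn_stress pr hW hc hu i j).differentiableAt_slice hW hz
  have huu : DifferentiableAt ℝ (fun y => ∑ i, u t y i * u t y i) x :=
    DifferentiableAt.fun_sum fun i _ => (hu1 i).fun_mul (hu1 i)
  have hss : ∀ j, DifferentiableAt ℝ (fun y => ∑ i, stress pr c u i j t y * u t y i) x := fun j =>
    DifferentiableAt.fun_sum fun i _ => (hs i j).fun_mul (hu1 i)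
  refine Finset.sum_congr rfl fun j _ => ?_
  unfold energyFlux
  have d1 := (hct.fun_mul (hcj j)).const_mul pr.s32
  have d2 := ((hR1.fun_mul huu).fun_mul (hu1 j)).const_mul (1 / 2)
  have d4 := (hμ1.fun_mul hc1).fun_mul (hu1 j)
  have d5 := (hμ1.fun_mul (hμj j)).const_mul pr.M₀
  have d6 := (hp1.fun_mul (hpj j)).const_mul (pr.K)⁻¹
  have d7 := hp1.fun_mul (hu1 j)
  have e1 := d1.fun_sub d2
  have e2 := e1.fun_add (hss j)
  have e3 := e2.fun_sub d4
  have e4 := e3.fun_add d5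
  have e5 := e4.fun_add d6
  rw [pd_sub j e5 d7, pd_add j e4 d6, pd_add j e3 d5, pd_sub j e2 d4, pd_add j e1 (hss j),
    pd_sub j d1 d2, pd_const_mul j _ (hct.fun_mul (hcj j)), pd_mul j hct (hcj j),
    pd_const_mul j _ ((hR1.fun_mul huu).fun_mul (hu1 j)), pd_mul j (hR1.fun_mul huu) (hu1 j),
    pd_mul j hR1 huu, pd_sum _ j (fun i _ => (hu1 i).fun_mul (hu1 i)),
    pd_sum _ j (fun i _ => (hs i j).fun_mul (hu1 i)), pd_mul j (hμ1.fun_mul hc1) (hu1 j),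
    pd_mul j hμ1 hc1, pd_const_mul j _ (hμ1.fun_mul (hμj j)), pd_mul j hμ1 (hμj j),
    pd_const_mul j _ (hp1.fun_mul (hpj j)), pd_mul j hp1 (hpj j), pd_mul j hp1 (hu1 j)]
  simp only [pd_mul j (hu1 _) (hu1 _), pd_mul j (hs _ j) (hu1 _)]

end Fields

/-- `S:S = S:∇u` for symmetric `S`, the form in which the viscous term arises from the momentum
equation. -/
theorem dissipation_eq (pr : Params) (c : Vec → ℝ) (u : Vec → Vec) (x : Vec) :
    dissipation pr c u x = pr.M₀ * ∑ i, pd i (chemPot pr c) x * pd i (chemPot pr c) x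
      + ∑ i, ∑ j, 2 * pr.visc (c x) * strain (velGrad u x) i j * pd j (fun y => u y i) x := by
  unfold dissipation strainSq strain velGrad grad dotProduct
  simp only [Fin.sum_univ_three]
  ring

namespace IsClassicalSolution

variable {pr : Params} {M : HexMesh} {wall : Fin M.nB → WallKind} {I : Set ℝ}
  {c p : ℝ → Vec → ℝ} {u : ℝ → Vec → Vec} {R : ℝ → Vec → ℝ} {W : Set (ℝ × Vec)}

/-- The local energy balance. -/
theorem local_balance (h : IsClassicalSolution pr M wall I c u p) (hI : IsOpen I) (hW : IsOpen W)
    (hMW : I ×ˢ M.closedDomain ⊆ W) (hc : SmoothOn 4 W c)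
    (hu : ∀ i, SmoothOn 2 W fun t x => u t x i) (hp : SmoothOn 3 W p) (hR : SmoothOn 1 W R)
    (hρ : ∀ t ∈ I, ∀ x ∈ M.closedDomain, R t x = pr.rho (c t x)) {t : ℝ} (ht : t ∈ I) {x : Vec}
    (hx : x ∈ M.domain) :
    td (entropyDensity pr c p R u) t x
      = divg (energyFlux pr c p R u t) x - dissipation pr (c t) (u t) x := by
  have hx' := M.domain_subset hx
  have hz : (t, x) ∈ W := hMW ⟨ht, hx'⟩
  have hc1 := (hc.of_le (m := 1) (by norm_num)).differentiableAt_slice hW hz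
  have hu1 : ∀ i, DifferentiableAt ℝ (fun y => u t y i) x := fun i =>
    ((hu i).of_le (m := 1) (by norm_num)).differentiableAt_slice hW hz
  have hR1 := hR.differentiableAt_slice hW hz
  have hCH : td c t x + ∑ j, (pd j (c t) x * u t x j + c t x * pd j (fun y => u t y j) x)
      = pr.M₀ * ∑ j, pd j (pd j (chemPot pr (c t))) x := by
    have h1 := h.cahnHilliard t ht x hx
    have h2 : divg (fun y => c t y • u t y) x
        = ∑ j, (pd j (c t) x * u t x j + c t x * pd j (fun y => u t y j) x) :=
      Finset.sum_congr rfl fun j _ => pd_mul j hc1 (hu1 j)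
    rw [h2] at h1
    exact h1
  have hcomp : -∑ j, pd j (pd j (td p t)) x + pr.K * ∑ j, pd j (fun y => u t y j) x = 0 :=
    h.compressibility t ht x hx
  have hpos : 0 < R t x := by rw [hρ t ht x hx']; exact h.rho_pos t ht x hx'
  have hmom : ∀ i, R t x * td (fun t x => u t x i) t x + 1 / 2 * td R t x * u t x i
      + ∑ j, (1 / 2 * (pd j (R t) x * u t x i + R t x * pd j (fun y => u t y i) x) * u t x j
          + 1 / 2 * (R t x * u t x i) * pd j (fun y => u t y j) x)
      + 1 / 2 * R t x * ∑ j, u t x j * pd j (fun y => u t y i) x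
      + c t x * pd i (chemPot pr (c t)) x
      = -pd i (p t) x + ∑ j, pd j (stress pr c u i j t) x := by
    intro i
    have h1 := h.momentum t ht x hx i
    have h2 : divg (fun y => (1 / 2 * pr.rho (c t y) * u t y i) • u t y) x
        = ∑ j, (1 / 2 * (pd j (R t) x * u t x i + R t x * pd j (fun y => u t y i) x) * u t x j
          + 1 / 2 * (R t x * u t x i) * pd j (fun y => u t y j) x) := by
      refine Finset.sum_congr rfl fun j _ => ?_
      -- `R` agrees with `ρ(c)` on the whole open domain, so it may replace it under spatial
      -- derivatives at `x`.
      have e : (fun y => ((1 / 2 * pr.rho (c t y) * u t y i) • u t y) j)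
          =ᶠ[𝓝 x] fun y => 1 / 2 * (R t y * u t y i) * u t y j := by
        filter_upwards [M.isOpen_domain.mem_nhds hx] with y hy
        rw [hρ t ht y (M.domain_subset hy), Pi.smul_apply, smul_eq_mul, mul_assoc (1 / 2)]
      rw [pd_congr j e, pd_mul j ((hR1.fun_mul (hu1 i)).const_mul (1 / 2)) (hu1 j),
        pd_const_mul j _ (hR1.fun_mul (hu1 i)), pd_mul j hR1 (hu1 i)]
    -- `√ρ(√ρu)_t = ρu_t + ½ρ_t u`; the open time set allows `ρ(c)` to be replaced by `R` near `t`.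
    have h3 : Real.sqrt (pr.rho (c t x)) * deriv (fun s => Real.sqrt (pr.rho (c s x)) * u s x i) t
        = R t x * td (fun t x => u t x i) t x + 1 / 2 * td R t x * u t x i := by
      have e : (fun s => Real.sqrt (pr.rho (c s x)) * u s x i)
          =ᶠ[𝓝 t] fun s => Real.sqrt (R s x) * u s x i := by
        filter_upwards [hI.mem_nhds ht] with s hs
        rw [hρ s hs x hx']
      have d := ((hR.hasDerivAt_time hW hz).sqrt hpos.ne').mul
        (((hu i).of_le (m := 1) (by norm_num)).hasDerivAt_time hW hz)
      have d' : deriv (fun s => Real.sqrt (R s x) * u s x i) t = _ := d.deriv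
      rw [e.deriv_eq, d', ← hρ t ht x hx']
      have hs := Real.mul_self_sqrt hpos.le
      have hs0 : Real.sqrt (R t x) ≠ 0 := (Real.sqrt_pos.2 hpos).ne'
      field_simp
      rw [Real.sq_sqrt hpos.le]
      ring
    rw [h2, h3, ← hρ t ht x hx'] at h1
    exact h1
  have hμ : chemPot pr (c t) x = deriv pr.f0 (c t x) - pr.s32 * ∑ j, pd j (pd j (c t)) x := rfl
  have hK : pr.K * (pr.K)⁻¹ = 1 := mul_inv_cancel₀ pr.K_pos.ne'
  have hm0 := hmom 0
  have hm1 := hmom 1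
  have hm2 := hmom 2
  rw [td_entropyDensity pr hW hc hu hp hR hz, divg_energyFlux pr hW hc hu hp hR hz, dissipation_eq]
  have hst : ∀ i j, 2 * pr.visc (c t x) * strain (velGrad (u t) x) i j = stress pr c u i j t x :=
    fun _ _ => rfl
  simp only [hst]
  simp only [Fin.sum_univ_three] at hCH hcomp hm0 hm1 hm2 hμ ⊢
  -- The multipliers are the entropy variables `μ`, `u`, `p/K`, together with `-c_t` for the
  -- definition of `μ`; the last term clears `K·K⁻¹` in front of `p∇·u`.
  linear_combination chemPot pr (c t) x * hCH + u t x 0 * hm0 + u t x 1 * hm1 + u t x 2 * hm2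
    + p t x * (pr.K)⁻¹ * hcomp - td c t x * hμ
    - p t x * (pd 0 (fun y => u t y 0) x + pd 1 (fun y => u t y 1) x
      + pd 2 (fun y => u t y 2) x) * hK

end IsClassicalSolution

namespace HexMesh

variable (M : HexMesh)

theorem bdryPt_mem (b : Fin M.nB) {y : Fin 2 → ℝ} (hy : y ∈ square) :
    M.bdryPt b y ∈ M.closedDomain := M.mem_closedDomain _ (facePt_mem_cube hy)

theorem continuous_bdryPt (b : Fin M.nB) : Continuous (M.bdryPt b) :=
  (M.smooth _).continuous.comp (continuous_facePt _)

theorem continuous_vlen_bdryAreaVec (b : Fin M.nB) :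
    Continuous fun y => vlen (M.bdryAreaVec b y) := by
  have h : Continuous (M.bdryAreaVec b) :=
    ((contDiff_contra (M.smooth (M.bdry b).1) (M.bdry b).2.1).continuous.comp
      (continuous_facePt (M.bdry b).2)).const_smul (RefFace.sign (M.bdry b).2)
  exact Real.continuous_sqrt.comp (h.dotProduct h)

theorem vlen_smul_bdryNormal (b : Fin M.nB) (y : Fin 2 → ℝ) :
    vlen (M.bdryAreaVec b y) • M.bdryNormal b y = M.bdryAreaVec b y := vlen_smul_inv_smul _

end HexMesh

theorem dissipation_nonneg (pr : Params) {c : Vec → ℝ} {u : Vec → Vec} {x : Vec}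
    (h : 0 ≤ pr.visc (c x)) : 0 ≤ dissipation pr c u x := by
  refine add_nonneg (mul_nonneg pr.M₀_pos.le (Params.dot_self_nonneg _))
    (mul_nonneg (mul_nonneg (by norm_num) h) ?_)
  exact Finset.sum_nonneg fun i _ => Finset.sum_nonneg fun j _ => sq_nonneg _

namespace IsClassicalSolution

variable {pr : Params} {M : HexMesh} {wall : Fin M.nB → WallKind} {I : Set ℝ}
  {c p : ℝ → Vec → ℝ} {u : ℝ → Vec → Vec} {R : ℝ → Vec → ℝ} {W : Set (ℝ × Vec)}

/-- The energy flux through the boundary. -/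
theorem energyFlux_boundary (h : IsClassicalSolution pr M wall I c u p) {t : ℝ} (ht : t ∈ I)
    (b : Fin M.nB) {y : Fin 2 → ℝ} (hy : y ∈ square) :
    M.bdryAreaVec b y ⬝ᵥ energyFlux pr c p R u t (M.bdryPt b y)
      = -(deriv pr.fw (c t (M.bdryPt b y)) * td c t (M.bdryPt b y)
          * vlen (M.bdryAreaVec b y)) := by
  set x := M.bdryPt b y with hx
  set n := M.bdryNormal b y with hn
  have hc : -pr.s32 * ∑ j, pd j (c t) x * n j = deriv pr.fw (c t x) := h.bc_c t ht b y hy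
  have hμ : ∑ j, pd j (chemPot pr (c t)) x * n j = 0 := h.bc_mu t ht b y hy
  have hp : ∑ j, pd j (td p t) x * n j = 0 := h.bc_p t ht b y hy
  -- The two wall types enter only through these facts: no flow through the wall, and no work done
  -- by the viscous stress.
  have hu : (∑ j, u t x j * n j = 0) ∧ ∑ j, (∑ i, stress pr c u i j t x * u t x i) * n j = 0 := by
    have h1 := h.bc_u t ht b y hy
    rw [← hx, ← hn] at h1
    cases hw : wall b with
    | noSlip =>
      rw [hw] at h1
      have h2 : u t x = 0 := h1
      simp [h2]
    | freeSlip =>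
      rw [hw] at h1
      obtain ⟨h2, h3⟩ : u t x ⬝ᵥ n = 0 ∧ ∀ i, strain (velGrad (u t) x) i ⬝ᵥ n = 0 := h1
      refine ⟨h2, ?_⟩
      have e : ∀ i, ∑ j, stress pr c u i j t x * n j = 0 := fun i => by
        have h4 : ∑ j, stress pr c u i j t x * n j
            = 2 * pr.visc (c t x) * (strain (velGrad (u t) x) i ⬝ᵥ n) := by
          rw [dotProduct, Finset.mul_sum]
          exact Finset.sum_congr rfl fun j _ => by unfold stress; ring
        rw [h4, h3 i, mul_zero]
      simp only [Finset.sum_mul]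
      rw [Finset.sum_comm]
      refine Finset.sum_eq_zero fun i _ => ?_
      calc ∑ j, stress pr c u i j t x * u t x i * n j
          = u t x i * ∑ j, stress pr c u i j t x * n j := by
            rw [Finset.mul_sum]; exact Finset.sum_congr rfl fun j _ => by ring
        _ = 0 := by rw [e, mul_zero]
  obtain ⟨hu1, hu2⟩ := hu
  rw [← M.vlen_smul_bdryNormal b y, smul_dotProduct, ← hn, smul_eq_mul,
    M.vlen_smul_bdryNormal b y]
  -- Only the capillary flux `(3/2)σε c_t ∂_n c` survives, and the contact condition turns it into
  -- `-f_w'(c) c_t`.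
  have hflux : n ⬝ᵥ energyFlux pr c p R u t x = -(deriv pr.fw (c t x) * td c t x) := by
    rw [← hc]
    unfold energyFlux dotProduct
    simp only [Fin.sum_univ_three] at *
    linear_combination pr.M₀ * chemPot pr (c t) x * hμ + (pr.K)⁻¹ * p t x * hp + hu2
      - (1 / 2 * (R t x * (u t x 0 * u t x 0 + u t x 1 * u t x 1 + u t x 2 * u t x 2))
        + chemPot pr (c t) x * c t x + p t x) * hu1
  rw [hflux]
  ring

theorem entropy2_eq {t : ℝ} {x : Vec} (hρ : R t x = pr.rho (c t x)) :
    entropy2 pr (c t) (u t) (p t) x = entropyDensity pr c p R u t x := by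
  unfold entropy2 entropyDensity grad dotProduct
  rw [hρ]
  ring

/-- The energy law for classical solutions. -/
theorem energy_law (h : IsClassicalSolution pr M wall I c u p) (hI : IsOpen I) {t : ℝ}
    (ht : t ∈ I) :
    IntegrableOn (entropy2 pr (c t) (u t) (p t)) M.domain ∧
    IntegrableOn (dissipation pr (c t) (u t)) M.domain ∧
    HasDerivAt (fun s => (∫ x in M.domain, entropy2 pr (c s) (u s) (p s) x)
        + M.bdryIntegral (fun x => pr.fw (c s x)))
      (-∫ x in M.domain, dissipation pr (c t) (u t) x) t := by
  obtain ⟨W, hW, hMW, hc, hu', hp, r, hr, hρ'⟩ := h.regular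
  have hu : ∀ i, SmoothOn 2 W fun t x => u t x i := fun i => contDiffOn_pi.1 hu' i
  -- A `C¹` field on an open set that agrees with `ρ(c)` on the closed domain; it is differentiated
  -- instead of the density law, which the cutoff makes non-smooth.
  set R : ℝ → Vec → ℝ := fun t x => r (t, x) with hRdef
  have hR : SmoothOn 1 W R := hr
  have hc : SmoothOn 4 W c := hc
  have hp : SmoothOn 3 W p := hp
  have hρ : ∀ t ∈ I, ∀ x ∈ M.closedDomain, R t x = pr.rho (c t x) := hρ'
  have hE := smoothOn_entropyDensity pr hW hc hu hp hR
  have hD := smoothOn_dissipation pr hW hc hu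
  have hsl : ∀ s ∈ I, M.closedDomain ⊆ {x | (s, x) ∈ W} := fun s hs x hx => hMW ⟨hs, hx⟩
  have hEint : IntegrableOn (entropyDensity pr c p R u t) M.closedDomain :=
    ((continuousOn_slice hE t).mono (hsl t ht)).integrableOn_compact M.isCompact_closedDomain
  have hDint : IntegrableOn (dissipation pr (c t) (u t)) M.domain :=
    (((continuousOn_slice hD t).mono (hsl t ht)).integrableOn_compact
      M.isCompact_closedDomain).mono_set M.domain_subset
  have hEeq : ∀ s ∈ I, ∀ x ∈ M.domain, entropy2 pr (c s) (u s) (p s) x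
      = entropyDensity pr c p R u s x := fun s hs x hx =>
    entropy2_eq (hρ s hs x (M.domain_subset hx))
  have hmeas := M.isOpen_domain.measurableSet
  refine ⟨(hEint.mono_set M.domain_subset).congr_fun (fun x hx => (hEeq t ht x hx).symm) hmeas,
    hDint, ?_⟩
  have hd1 : HasDerivAt (fun s => ∫ x in M.domain, entropy2 pr (c s) (u s) (p s) x)
      (∫ x in M.domain, td (entropyDensity pr c p R u) t x) t := by
    have h1 := hasDerivAt_setIntegral_of_compact (μ := volume) hI M.isCompact_closedDomain
      M.domain_subset hmeas (F := entropyDensity pr c p R u)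
      (F' := td (entropyDensity pr c p R u))
      (hE.continuousOn.mono hMW) ((SmoothOn.td (n := 0) hE hW).continuousOn.mono hMW)
      (fun s hs x hx => hE.hasDerivAt_time hW (hMW ⟨hs, hx⟩)) ht
    refine h1.congr_of_eventuallyEq ?_
    filter_upwards [hI.mem_nhds ht] with s hs
    exact setIntegral_congr_fun hmeas (hEeq s hs)
  have hc1 : SmoothOn 1 W c := hc.of_le (by norm_num)
  have hd2 : HasDerivAt (fun s => M.bdryIntegral (fun x => pr.fw (c s x)))
      (∑ b, ∫ y in square, deriv pr.fw (c t (M.bdryPt b y)) * td c t (M.bdryPt b y)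
        * vlen (M.bdryAreaVec b y)) t := by
    unfold HexMesh.bdryIntegral
    refine HasDerivAt.fun_sum fun b _ => ?_
    have hmap : ∀ {f : ℝ → Vec → ℝ} {n : ℕ}, SmoothOn n W f →
        ContinuousOn (fun z : ℝ × (Fin 2 → ℝ) => f z.1 (M.bdryPt b z.2)) (I ×ˢ square) := by
      intro f n hf
      refine hf.continuousOn.comp (f := fun z : ℝ × (Fin 2 → ℝ) => (z.1, M.bdryPt b z.2))
        (continuous_fst.prodMk
          ((M.continuous_bdryPt b).comp continuous_snd)).continuousOn fun z hz => ?_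
      exact hMW ⟨hz.1, M.bdryPt_mem b hz.2⟩
    have hv : ContinuousOn (fun z : ℝ × (Fin 2 → ℝ) => vlen (M.bdryAreaVec b z.2)) (I ×ˢ square) :=
      ((M.continuous_vlen_bdryAreaVec b).comp continuous_snd).continuousOn
    refine hasDerivAt_setIntegral_of_compact (μ := volume) hI isCompact_square subset_rfl
      measurableSet_Icc (F := fun s y => pr.fw (c s (M.bdryPt b y)) * vlen (M.bdryAreaVec b y))
      (F' := fun s y => deriv pr.fw (c s (M.bdryPt b y)) * td c s (M.bdryPt b y)
        * vlen (M.bdryAreaVec b y)) ?_ ?_ ?_ ht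
    · exact (pr.fw_smooth.continuous.comp_continuousOn (hmap hc1)).mul hv
    · exact (((pr.fw_smooth.continuous_deriv (by norm_num)).comp_continuousOn (hmap hc1)).mul
        (hmap (SmoothOn.td (n := 0) hc1 hW))).mul hv
    · intro s hs y hy
      exact (((pr.fw_smooth.differentiable (by norm_num) _).hasDerivAt.comp s
        (hc1.hasDerivAt_time hW (hMW ⟨hs, M.bdryPt_mem b hy⟩))).mul_const _)
  refine (hd1.add hd2).congr_deriv ?_
  have hZ : ContDiffOn ℝ 1 (energyFlux pr c p R u t) {x | (t, x) ∈ W} :=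
    contDiffOn_pi.2 fun j => (smoothOn_energyFlux pr hW hc hu hp hR j).contDiffOn_slice t
  have hV : IsOpen {x | (t, x) ∈ W} := hW.preimage (Continuous.prodMk_right t)
  have hdiv := M.divergence_theorem hV (hsl t ht) hZ
  have hdivInt : IntegrableOn (divg (energyFlux pr c p R u t)) M.domain := by
    have h1 : ContinuousOn (divg (energyFlux pr c p R u t)) M.closedDomain := by
      refine ContinuousOn.mono ?_ (hsl t ht)
      refine continuousOn_finsetSum _ fun i _ => ?_
      exact ((contDiffOn_pi.1 hZ i).continuousOn_fderiv_of_isOpen hV le_rfl).clm_apply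
        continuousOn_const
    exact (h1.integrableOn_compact M.isCompact_closedDomain).mono_set M.domain_subset
  rw [setIntegral_congr_fun hmeas fun x hx => h.local_balance hI hW hMW hc hu hp hR hρ ht hx,
    integral_sub hdivInt hDint, hdiv]
  have hb : ∀ b, ∫ y in square, M.bdryAreaVec b y ⬝ᵥ energyFlux pr c p R u t (M.bdryPt b y)
      = -∫ y in square, deriv pr.fw (c t (M.bdryPt b y)) * td c t (M.bdryPt b y)
          * vlen (M.bdryAreaVec b y) := by
    intro b
    rw [← integral_neg]
    exact setIntegral_congr_fun measurableSet_Icc fun y hy => h.energyFlux_boundary ht b hy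
  simp only [hb, Finset.sum_neg_distrib]
  ring

end IsClassicalSolution

end INSCH

theorem mainTheorem4 (pr : INSCH.Params) (M : INSCH.HexMesh)
    (wall : Fin M.nB → INSCH.WallKind) (I : Set ℝ) (hI : IsOpen I) :
    (∀ (c : ℝ → INSCH.Vec → ℝ) (u : ℝ → INSCH.Vec → INSCH.Vec) (p : ℝ → INSCH.Vec → ℝ),
      INSCH.IsClassicalSolution pr M wall I c u p → ∀ t ∈ I,
        IntegrableOn (INSCH.entropy2 pr (c t) (u t) (p t)) M.domain ∧
        IntegrableOn (INSCH.dissipation pr (c t) (u t)) M.domain ∧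
        HasDerivAt
          (fun s => (∫ x in M.domain, INSCH.entropy2 pr (c s) (u s) (p s) x)
            + M.bdryIntegral (fun x => pr.fw (c s x)))
          (-∫ x in M.domain, INSCH.dissipation pr (c t) (u t) x) t ∧
        ((∀ x ∈ M.domain, 0 ≤ pr.visc (c t x)) →
          -∫ x in M.domain, INSCH.dissipation pr (c t) (u t) x ≤ 0)) ∧
    (∀ (N : ℕ) (gl : INSCH.GaussLobatto N), (∀ e n, 0 < M.dJac gl e n) →
      ∀ (κ : ℝ), 0 ≤ κ → ∀ (fl : INSCH.InviscidFlux) (Y : ℝ → INSCH.DGFields M N),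
        INSCH.IsSemiDiscreteSolution pr M gl κ fl wall I Y → ∀ t ∈ I,
          ∃ d : ℝ,
            HasDerivAt
              (fun s => INSCH.dTotalEntropy pr gl κ (Y s) + INSCH.dSurfaceEnergy pr gl (Y s)) d t ∧
            d ≤ -INSCH.dDissipation pr gl (Y t) ∧
            (fl = INSCH.InviscidFlux.central → κ = 0 → d = -INSCH.dDissipation pr gl (Y t)) ∧
            ((∀ e n, 0 ≤ pr.visc ((Y t).C e n)) → -INSCH.dDissipation pr gl (Y t) ≤ 0)) := by
  refine ⟨fun c u p h t ht => ?_, fun N gl hJ κ hκ fl Y h t ht =>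
    INSCH.discrete_entropy_law hI hJ hκ h ht⟩
  obtain ⟨h1, h2, h3⟩ := h.energy_law hI ht
  exact ⟨h1, h2, h3, fun hv => neg_nonpos.2 (setIntegral_nonneg M.isOpen_domain.measurableSet
    fun x hx => INSCH.dissipation_nonneg pr (hv x hx))⟩
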